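/- **The category $\mathcal{T}gl$.** Objects are the integers $n\ge 0$. Consider unoriented framed tangles (up to isotopy) in $\mathbb R^2\times[0,1]$ with $2k$ end points $1^+,1^-,\dots,k^+,k^-$ on the top line and $2l$ end points $1^+,1^-,\dots,l^+,l^-$ on the bottom line, given by diagrams with the framing in the plane of projection. Such a tangle is *admissible* $k\to l$ if every end point belongs to a top strand (a component joining $j^+$ and $j^-$ on the top line), a bottom strand (the same on the bottom line), or a through strand (two components joining $i^+$ and $i^-$ on the top line to $j^{+},j^{-}$, in either order, on the bottom line); there may be further, closed, components. A morphism $k\to l$ is an admissible tangle modulo the smallest equivalence relation that is compatible with stacking and juxtaposition and contains isotopy and the following moves: (i) addition of an isolated Hopf link with one $0$-framed and one $0$- or $1$-framed component; (ii) 2-handle slides: a strand is replaced by its band sum with a push-off, along the framing, of another component, which is closed; (iii) the boundary move: the identity of the object $1$ is equivalent to the tangle consisting of an arc joining the two upper ends, an arc joining the two lower ends, and a $0$-framed annulus through which both arcs pass (in formulas $K^+K^-$ below). Composition $T'\circ T$ is given by stacking $T$ on top of $T'$, tensor product by juxtaposition ($n\otimes m=n+m$), and the braiding of $k$ and $l$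 by the crossing of $2k$ with $2l$ parallel strands (replacing $\sigma$ below). **The category $\mathcal{A}lg$.** It is the strict braided tensor category with objects $A^{\otimes n}$, $n\ge0$, braiding of $A$ with itself $c$, and with generating morphisms $1:1\to A$, $\mathsf m:A^{\otimes 2}\to A$, $\epsilon:A\to1$, $\Delta:A\to A^{\otimes2}$, $\Gamma^{\pm1}:A\to A$, $v^{\pm1}:1\to A$, $\mu:A\to 1$, $c^{\pm1}:A^{\otimes2}\to A^{\otimes 2}$, in which equality is the smallest congruence (for $\circ$ and $\otimes$) satisfying the axioms of a strict braided tensor category (interchange, $c$ and $c^{-1}$ mutually inverse, naturality of the braiding with respect to all generators), and: $\mathsf m$ is associative with unit $1$; $\Delta$ is coassociative with counit $\epsilon$; $\Delta\mathsf m=(\mathsf m\otimes\mathsf m)(1\otimes c\otimes1)(\Delta\otimes\Delta)$, $\epsilon\mathsf m=\epsilon\otimes\epsilon$, $\Delta 1=1\otimes1$; $\mathsf m(\Gamma\otimes1)\Delta=1\epsilon=\mathsf m(1\otimes\Gamma)\Delta$, $\Gamma\Gamma^{-1}=\Gamma^{-1}\Gamma=\mathrm{id}$; $(1\otimes\mu)\Delta=1\mu=(\mu\otimes1)\Delta$,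 $\mu\Gamma=\mu$; $\mathsf m(v\otimes1)=\mathsf m(1\otimes v)$, $\mathsf m(v\otimes v^{-1})=1$, $\Gamma v=v$; for $V^{-1}=\mathsf m(v^{-1}\otimes 1)$ and $\omega=(V^{-1}\otimes V^{-1})\Delta v$: $(1\otimes\Delta)\omega=(\mathsf m\otimes1\otimes1)(1\otimes\omega\otimes1)\omega$, and, for all $m\ge 0$ and $f,g:A\to A^{\otimes m}$, $(f\otimes1)\omega=(g\otimes1)\omega$ implies $f=g$; and the normalizations $\epsilon 1=1$, $\epsilon v=1$, $\mu\lambda=1$ for $\lambda=(1\otimes\mu)\omega$. **The assigned tangles.** Read tangle diagrams from top to bottom, as products from left to right. Let $\cap_i$ insert a maximum whose legs become the strands number $i,i+1$, let $\cup_i$ join the strands $i,i+1$ by a minimum, and let $\sigma_i$ be the crossing of the strands $i,i+1$ at which the strand going from the upper left to the lower right passes under the other one. Put $K^{\pm}=\cap_3\,\sigma_2^{\pm1}\sigma_2^{\pm1}\,\cup_1$. Then $T_g$ is given by $$\begin{aligned}&T_{1}=\cap_1,\quad T_{\mathsf m}=\cap_5\sigma_4\sigma_4\cup_3\,\sigma_2^{-1}\sigma_2^{-1}\cup_3,\quad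 T_{\epsilon}=K^+\cup_1,\quad T_\Delta=K^-\cap_1\cap_5\,\sigma_2\sigma_2\,\sigma_4\sigma_4\,\cup_3,\\ &T_{\Gamma}=\sigma_1\cap_2\sigma_1\cup_2,\quad T_{\Gamma^{-1}}=\cap_2\sigma_1^{-1}\cup_2\sigma_1^{-1},\quad T_{v}=\cap_1\cap_2\sigma_1^{-1}\cup_2,\quad T_{v^{-1}}=\cap_1\cap_2\sigma_1\cup_2,\\ &T_\mu=\cup_1,\quad T_c=\sigma_2\sigma_3\sigma_1\sigma_2,\quad T_{c^{-1}}=T_c^{-1}=\sigma_2^{-1}\sigma_1^{-1}\sigma_3^{-1}\sigma_2^{-1}.\end{aligned}$$ All of these are admissible. Composing and juxtaposing them assigns to each diagram $u$ in the generators of $\mathcal{A}lg$ with $n$ inputs and $m$ outputs an admissible tangle $T_u:n\to m$. **Corollary.** The assignment $u\mapsto[T_u]$ respects every defining relation of $\mathcal{A}lg$: the relation "$[T_u]=[T_{u'}]$ in $\mathcal{T}gl$" on diagrams $u,u'$ is a congruence satisfying all the axioms listed above. Hence there is a unique functor $\mathfrak X:\mathcal{A}lg\to\mathcal{T}gl$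 which is a strict braided tensor functor, maps $A^{\otimes n}$ to $n$, and maps each generator $g$ to $[T_g]$. -/

import Mathlib

open CategoryTheory MonoidalCategory

namespace HopfTangle

/-! ### Diagrams as words of elementary slices -/

/-- Elementary pieces of diagrams with their numbers of upper (`src`) and lower (`tgt`) ends,
among them a crossing of two strands and the opposite crossing. -/
class Signature (G : Type) where
  src : G → ℕ
  tgt : G → ℕ
  cross : G
  crossInv : G
  src_cross : src cross = 2
  tgt_cross : tgt cross = 2
  src_crossInv : src crossInv = 2
  tgt_crossInv : tgt crossInv = 2

open Signature

/-- The elementary piece `gen` with `left` vertical strands on its left and `right` ones on its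
right. -/
structure Slice (G : Type) where
  left : ℕ
  gen : G
  right : ℕ

/-- A diagram, read from top to bottom as a stack of slices. Stacking `u` on top of `v` is
`u ++ v`, and the empty word is a bundle of vertical strands. -/
abbrev Word (G : Type) := List (Slice G)

section Words

variable {G : Type}

/-- Juxtapose `i` vertical strands on the left and `j` on the right of a diagram. -/
def shift (i j : ℕ) (w : Word G) : Word G :=
  w.map fun s => ⟨i + s.left, s.gen, s.right + j⟩

/-- One strand passing from the left to the right of `m` strands. -/
def crossOne (x : G) : ℕ → Word G
  | 0 => []
  | m + 1 => ⟨0, x, m⟩ :: shift 1 0 (crossOne x m)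

/-- The crossing `x` with its strand starting on the left replaced by `n` parallel strands and the
other one by `m` parallel strands. -/
def blockCross (x : G) : ℕ → ℕ → Word G
  | 0, _ => []
  | n + 1, m => shift n 0 (crossOne x m) ++ shift 0 1 (blockCross x n m)

@[simp] theorem shift_nil (i j : ℕ) : shift i j ([] : Word G) = [] := rfl

@[simp] theorem shift_cons (i j : ℕ) (s : Slice G) (w : Word G) :
    shift i j (s :: w) = ⟨i + s.left, s.gen, s.right + j⟩ :: shift i j w := rfl

@[simp] theorem shift_append (i j : ℕ) (u v : Word G) :
    shift i j (u ++ v) = shift i j u ++ shift i j v := by simp [shift]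

@[simp] theorem shift_shift (i j a b : ℕ) (w : Word G) :
    shift i j (shift a b w) = shift (i + a) (j + b) w := by
  induction w with
  | nil => rfl
  | cons s w ih => simp [ih]; omega

@[simp] theorem shift_zero (w : Word G) : shift 0 0 w = w := by
  induction w with
  | nil => rfl
  | cons s w ih => simp [ih]

theorem shift_reverse (i j : ℕ) (w : Word G) :
    shift i j w.reverse = (shift i j w).reverse := by simp [shift]

theorem gen_shift {x : G} {w : Word G} (i j : ℕ) (hw : ∀ s ∈ w, s.gen = x) :
    ∀ s ∈ shift i j w, s.gen = x := by
  intro s hs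
  simp only [shift, List.mem_map] at hs
  obtain ⟨t, ht, rfl⟩ := hs
  exact hw t ht

theorem gen_crossOne (x : G) (m : ℕ) : ∀ s ∈ crossOne x m, s.gen = x := by
  induction m with
  | zero => simp [crossOne]
  | succ m ih =>
    intro s hs
    rcases List.mem_cons.1 hs with rfl | hs
    · rfl
    · exact gen_shift 1 0 ih s hs

theorem gen_blockCross (x : G) (n m : ℕ) : ∀ s ∈ blockCross x n m, s.gen = x := by
  induction n with
  | zero => simp [blockCross]
  | succ n ih =>
    intro s hs
    rcases List.mem_append.1 hs with hs | hs
    · exact gen_shift n 0 (gen_crossOne x m) s hs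
    · exact gen_shift 0 1 ih s hs

theorem blockCross_zero (x : G) (n : ℕ) : blockCross x n 0 = [] := by
  induction n with
  | zero => rfl
  | succ n ih => simp [blockCross, crossOne, ih]

theorem blockCross_one (x : G) (m : ℕ) : blockCross x 1 m = crossOne x m := by
  simp [blockCross]

theorem crossOne_add (x : G) (m k : ℕ) :
    crossOne x (m + k) = shift 0 k (crossOne x m) ++ shift m 0 (crossOne x k) := by
  induction m with
  | zero => simp [crossOne]
  | succ m ih =>
    rw [Nat.add_right_comm m 1 k]
    simp [crossOne, ih, Nat.add_comm 1 m]

theorem blockCross_add_left (x : G) (n n' m : ℕ) :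
    blockCross x (n + n') m = shift n 0 (blockCross x n' m) ++ shift 0 n' (blockCross x n m) := by
  induction n' with
  | zero => simp [blockCross]
  | succ n' ih =>
    rw [← Nat.add_assoc]
    simp [blockCross, ih, Nat.add_comm 1 n']

theorem rel_cast {r : ℕ → ℕ → Word G → Word G → Prop} {n m n' m' : ℕ}
    {u v u' v' : Word G} (h : r n m u v) (hn : n = n') (hm : m = m') (hu : u = u') (hv : v = v') :
    r n' m' u' v' := by subst hn hm hu hv; exact h

variable [Signature G]

def Slice.dom (s : Slice G) : ℕ := s.left + src s.gen + s.right

def Slice.cod (s : Slice G) : ℕ := s.left + tgt s.gen + s.right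

/-- `Typed n w m`: the word `w` is a diagram with `n` upper and `m` lower ends. -/
def Typed : ℕ → Word G → ℕ → Prop
  | n, [], m => n = m
  | n, s :: w, m => n = s.dom ∧ Typed s.cod w m

/-- Congruences, for stacking and juxtaposition, on diagrams with `n` upper and `m` lower ends
which satisfy the axioms of a strict braided tensor category: distant pieces may be moved past each
other vertically, the two crossings are mutually inverse, and a strand can be moved over
and under every elementary piece (for a crossing this is the Artin braid relation). -/
structure IsBraidedCong (r : ℕ → ℕ → Word G → Word G → Prop) : Prop where
  refl : ∀ n m u, Typed n u m → r n m u u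
  symm : ∀ n m u v, r n m u v → r n m v u
  trans : ∀ n m u v w, r n m u v → r n m v w → r n m u w
  comp : ∀ n m k u u' v v', r n m u u' → r m k v v' → r n k (u ++ v) (u' ++ v')
  whisker : ∀ i j n m u v, r n m u v → r (i + n + j) (i + m + j) (shift i j u) (shift i j v)
  interchange : ∀ (g h : G) (a : ℕ), r (src g + a + src h) (tgt g + a + tgt h)
    [⟨0, g, a + src h⟩, ⟨tgt g + a, h, 0⟩] [⟨src g + a, h, 0⟩, ⟨0, g, a + tgt h⟩]
  cross_crossInv : r 2 2 [⟨0, cross, 0⟩, ⟨0, crossInv, 0⟩] []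
  crossInv_cross : r 2 2 [⟨0, crossInv, 0⟩, ⟨0, cross, 0⟩] []
  naturality_left : ∀ g : G, r (src g + 1) (1 + tgt g)
    (⟨0, g, 1⟩ :: blockCross cross (tgt g) 1) (blockCross cross (src g) 1 ++ [⟨1, g, 0⟩])
  naturality_right : ∀ g : G, r (1 + src g) (tgt g + 1)
    (⟨1, g, 0⟩ :: blockCross cross 1 (tgt g)) (blockCross cross 1 (src g) ++ [⟨0, g, 1⟩])

theorem Typed.append {n m k : ℕ} {u v : Word G} (hu : Typed n u m) (hv : Typed m v k) :
    Typed n (u ++ v) k := by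
  induction u generalizing n with
  | nil => cases hu; exact hv
  | cons s u ih => exact ⟨hu.1, ih hu.2⟩

theorem Typed.cast {n m n' m' : ℕ} {u : Word G} (hu : Typed n u m) (hn : n = n') (hm : m = m') :
    Typed n' u m' := by subst hn hm; exact hu

theorem Typed.shift {n m : ℕ} {u : Word G} (i j : ℕ) (hu : Typed n u m) :
    Typed (i + n + j) (shift i j u) (i + m + j) := by
  induction u generalizing n with
  | nil => cases hu; rfl
  | cons s u ih =>
    refine ⟨?_, ?_⟩
    · have := hu.1
      simp only [Slice.dom] at *
      omega
    · have := ih hu.2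
      simp only [Slice.cod] at *
      exact this.cast (by omega) rfl

theorem Typed.tensor {n m n' m' : ℕ} {u v : Word G} (hu : Typed n u m) (hv : Typed n' v m') :
    Typed (n + n') (HopfTangle.shift 0 n' u ++ HopfTangle.shift m 0 v) (m + m') :=
  ((hu.shift 0 n').cast (n' := n + n') (m' := m + n') (by omega) (by omega)).append
    ((hv.shift m 0).cast (by omega) (by omega))

theorem typed_crossOne {x : G} (hs : src x = 2) (ht : tgt x = 2) (m : ℕ) :
    Typed (m + 1) (crossOne x m) (m + 1) := by
  induction m with
  | zero => rfl
  | succ m ih =>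
    have h1 : m + 1 + 1 = (⟨0, x, m⟩ : Slice G).dom := by simp only [Slice.dom, hs]; omega
    have h2 : 1 + (m + 1) + 0 = (⟨0, x, m⟩ : Slice G).cod := by simp only [Slice.cod, ht]; omega
    exact ⟨h1, (ih.shift 1 0).cast h2 (by omega)⟩

theorem typed_blockCross {x : G} (hs : src x = 2) (ht : tgt x = 2) (n m : ℕ) :
    Typed (n + m) (blockCross x n m) (n + m) := by
  induction n with
  | zero => simp [blockCross, Typed]
  | succ n ih =>
    exact (((typed_crossOne hs ht m).shift n 0).cast (by omega) rfl).append
      ((ih.shift 0 1).cast (by omega) (by omega))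

theorem typed_reverse {x : G} (hs : src x = 2) (ht : tgt x = 2) {n m : ℕ} {w : Word G}
    (hw : ∀ s ∈ w, s.gen = x) (h : Typed n w m) : Typed m w.reverse n := by
  induction w generalizing n with
  | nil => exact h.symm
  | cons s w ih =>
    rw [List.reverse_cons]
    have h1 := h.1
    have h2 := hw s (by simp)
    have h3 : s.cod = s.dom := by simp only [Slice.dom, Slice.cod, h2, hs, ht]
    exact (ih (fun t ht => hw t (by simp [ht])) h.2).append ⟨h3, h3.trans h1.symm⟩

namespace IsBraidedCong

variable {r : ℕ → ℕ → Word G → Word G → Prop}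

theorem comp_left (hr : IsBraidedCong r) {n m k : ℕ} {u v v' : Word G} (hu : Typed n u m)
    (h : r m k v v') : r n k (u ++ v) (u ++ v') := hr.comp _ _ _ _ _ _ _ (hr.refl _ _ _ hu) h

theorem comp_right (hr : IsBraidedCong r) {n m k : ℕ} {u u' v : Word G} (h : r n m u u')
    (hv : Typed m v k) : r n k (u ++ v) (u' ++ v) := hr.comp _ _ _ _ _ _ _ h (hr.refl _ _ _ hv)

theorem interchange_gen (hr : IsBraidedCong r) (g : G) {c d : ℕ} {v : Word G} (hv : Typed c v d) :
    r (src g + c) (tgt g + d) (⟨0, g, c⟩ :: shift (tgt g) 0 v)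
      (shift (src g) 0 v ++ [⟨0, g, d⟩]) := by
  induction v generalizing c with
  | nil =>
    obtain rfl : c = d := hv
    exact hr.refl _ _ _ (by simp [Typed, Slice.dom, Slice.cod])
  | cons s v ih =>
    obtain ⟨i, h, j⟩ := s
    obtain ⟨hc, hv⟩ := hv
    simp only [Slice.dom, Slice.cod] at hc hv
    subst hc
    have h1 := hr.whisker 0 j _ _ _ _ (hr.interchange g h i)
    have h2 := ih hv
    have t1 := (hv.shift (tgt g) 0)
    have h3 := hr.comp_right h1 (t1.cast (by omega) rfl)
    have t2 : Typed (src g + (i + src h + j)) [(⟨src g + i, h, j⟩ : Slice G)]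
        (src g + (i + tgt h + j)) := by
      simp only [Typed, Slice.dom, Slice.cod]; omega
    have h4 := hr.comp_left t2 h2
    refine hr.trans _ _ _ _ _ (rel_cast h3 (by omega) (by omega) ?_ rfl) (rel_cast h4 (by omega) rfl ?_ ?_)
    · simp [Nat.add_assoc]
    · simp
    · simp

theorem interchange_word (hr : IsBraidedCong r) {a b c d : ℕ} {u v : Word G} (hu : Typed a u b)
    (hv : Typed c v d) :
    r (a + c) (b + d) (shift 0 c u ++ shift b 0 v)
      (shift a 0 v ++ shift 0 d u) := by
  induction u generalizing a with
  | nil =>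
    obtain rfl : a = b := hu
    simpa using hr.refl _ _ _ (hv.shift a 0)
  | cons s u ih =>
    obtain ⟨i, g, j⟩ := s
    obtain ⟨ha, hu⟩ := hu
    simp only [Slice.dom, Slice.cod] at ha hu
    subst ha
    have h1 := hr.whisker i 0 _ _ _ _ (hr.interchange_gen g ((hv.shift j 0).cast rfl rfl))
    have h2 := ih hu
    have t1 : Typed (i + src g + j + c) [(⟨i, g, j + c⟩ : Slice G)] (i + tgt g + j + c) := by
      simp only [Typed, Slice.dom, Slice.cod]; omega
    have h3 := hr.comp_left t1 h2
    have h4 := hr.comp_right h1 (((hu.shift 0 d).cast (by omega) rfl))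
    refine hr.trans _ _ _ _ _ (rel_cast h3 rfl rfl ?_ rfl) (rel_cast h4 (by omega) (by omega) ?_ ?_)
    · simp
    · simp [Nat.add_assoc]
    · simp [Nat.add_assoc]

theorem blockCross_add_right (hr : IsBraidedCong r) (n m k : ℕ) :
    r (n + (m + k)) (m + k + n) (blockCross (Signature.cross : G) n (m + k))
      (shift 0 k (blockCross Signature.cross n m) ++
        shift m 0 (blockCross Signature.cross n k)) := by
  have tO := fun m => typed_crossOne (G := G) src_cross tgt_cross m
  have tB := fun n m => typed_blockCross (G := G) src_cross tgt_cross n m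
  induction n with
  | zero => exact hr.refl _ _ _ (by simp [blockCross, Typed])
  | succ n ih =>
    have h0 := hr.interchange_word (tB n m) ((tO k))
    have h1 := hr.comp_right (hr.comp_left
      (((tO m).shift n k).cast (n' := n + m + (k + 1)) (m' := n + m + (k + 1))
        (by omega) (by omega)) h0) (((tB n k).shift m 1).cast (by omega) rfl)
    have h2 := hr.comp_left (((tO (m + k)).shift n 0)) ((rel_cast (hr.whisker 0 1 _ _ _ _ ih)
      (n' := n + (m + k + 1) + 0) (by omega) rfl rfl rfl))
    refine hr.trans _ _ _ _ _ (rel_cast h2 (by omega) (by omega) ?_ rfl)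
      (hr.symm _ _ _ _ (rel_cast h1 (by omega) (by omega) ?_ ?_))
    · simp [blockCross]
    · simp [blockCross, Nat.add_comm]
    · simp [crossOne_add, Nat.add_comm]

theorem naturality_gen_right (hr : IsBraidedCong r) (g : G) (n : ℕ) :
    r (n + src g) (tgt g + n) (⟨n, g, 0⟩ :: blockCross Signature.cross n (tgt g))
      (blockCross Signature.cross n (src g) ++ [⟨0, g, n⟩]) := by
  have tO := fun m => typed_crossOne (G := G) src_cross tgt_cross m
  have tB := fun n m => typed_blockCross (G := G) src_cross tgt_cross n m
  induction n with
  | zero => exact hr.refl _ _ _ (by simp [blockCross, Typed, Slice.dom, Slice.cod])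
  | succ n ih =>
    have h1 := hr.whisker n 0 _ _ _ _ (hr.naturality_right g)
    have h2 := hr.comp_right h1 (((tB n (tgt g)).shift 0 1).cast (by omega) rfl)
    have h3 := hr.comp_left ((tO (src g)).shift n 0) (rel_cast (hr.whisker 0 1 _ _ _ _ ih)
      (n' := n + (src g + 1) + 0) (by omega) rfl rfl rfl)
    refine hr.trans _ _ _ _ _ (rel_cast h2 (by omega) (by omega) ?_ rfl)
      (rel_cast h3 (by omega) (by omega) ?_ ?_)
    · simp [blockCross]
    · simp [blockCross]
    · simp [blockCross]

theorem naturality_gen_left (hr : IsBraidedCong r) (g : G) (m : ℕ) :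
    r (src g + m) (m + tgt g) (⟨0, g, m⟩ :: blockCross Signature.cross (tgt g) m)
      (blockCross Signature.cross (src g) m ++ [⟨m, g, 0⟩]) := by
  have tB := fun n m => typed_blockCross (G := G) src_cross tgt_cross n m
  induction m with
  | zero =>
    rw [blockCross_zero, blockCross_zero]
    exact hr.refl _ _ _ (by simp [Typed, Slice.dom, Slice.cod])
  | succ m ih =>
    have t1 : Typed (src g + (m + 1)) [(⟨0, g, m + 1⟩ : Slice G)] (tgt g + (m + 1)) := by
      simp [Typed, Slice.dom, Slice.cod]
    have h1 := hr.comp_left t1 (rel_cast (hr.blockCross_add_right (tgt g) m 1) rfl rfl rfl rfl)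
    have h2 := hr.comp_right (hr.whisker 0 1 _ _ _ _ ih)
      (((tB (tgt g) 1).shift m 0).cast (by omega) rfl)
    have h3 := hr.comp_left ((tB (src g) m).shift 0 1) (rel_cast
      (hr.whisker m 0 _ _ _ _ (hr.naturality_left g)) (n' := 0 + (src g + m) + 1) (by omega)
      rfl rfl rfl)
    have t2 : Typed (m + 1 + src g) [(⟨m + 1, g, 0⟩ : Slice G)] (m + 1 + tgt g) := by
      simp [Typed, Slice.dom, Slice.cod]
    have h4 := hr.comp_right (hr.blockCross_add_right (src g) m 1) t2
    refine hr.trans _ _ _ _ _ (rel_cast h1 rfl (by omega) rfl rfl) ?_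
    refine hr.trans _ _ _ _ _ (rel_cast h2 (by omega) (by omega) ?_ rfl) ?_
    · simp
    refine hr.trans _ _ _ _ _ (rel_cast h3 (by omega) (by omega) ?_ rfl) ?_
    · simp
    refine hr.symm _ _ _ _ (rel_cast h4 rfl (by omega) rfl ?_)
    simp

theorem naturality_word_right (hr : IsBraidedCong r) {a b : ℕ} {f : Word G} (hf : Typed a f b)
    (n : ℕ) :
    r (n + a) (b + n) (shift n 0 f ++ blockCross Signature.cross n b)
      (blockCross Signature.cross n a ++ shift 0 n f) := by
  have tB := fun n m => typed_blockCross (G := G) src_cross tgt_cross n m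
  induction f generalizing a with
  | nil =>
    obtain rfl : a = b := hf
    simpa using hr.refl _ _ _ ((tB n a).cast rfl (Nat.add_comm n a))
  | cons s f ih =>
    obtain ⟨i, g, j⟩ := s
    obtain ⟨ha, hf⟩ := hf
    simp only [Slice.dom, Slice.cod] at ha hf
    subst ha
    -- the slice alone
    have key : r (n + (i + src g + j)) (i + tgt g + j + n)
        (⟨n + i, g, j⟩ :: blockCross Signature.cross n (i + tgt g + j))
        (blockCross Signature.cross n (i + src g + j) ++ [⟨i, g, j + n⟩]) := by
      have split : ∀ t, r (n + (i + t + j)) (i + t + j + n)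
          (blockCross Signature.cross n (i + t + j))
          (shift 0 (t + j) (blockCross Signature.cross n i) ++
            (shift i j (blockCross Signature.cross n t) ++
            shift (i + t) 0 (blockCross Signature.cross n j))) := by
        intro t
        refine hr.trans _ _ _ _ _ (hr.blockCross_add_right n (i + t) j) ?_
        have h := hr.comp_right (hr.whisker 0 j _ _ _ _ (hr.blockCross_add_right n i t))
          (((tB n j).shift (i + t) 0).cast (by omega) rfl)
        refine rel_cast h (by omega) (by omega) rfl ?_
        simp [Nat.add_comm]
      have ts : ∀ x y, Typed (x + src g + y) [(⟨x, g, y⟩ : Slice G)] (x + tgt g + y) := by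
        intro x y; simp [Typed, Slice.dom, Slice.cod]
      have h1 := hr.comp_left ((ts (n + i) j).cast (n' := n + (i + src g + j))
        (m' := n + (i + tgt g + j)) (by omega) (by omega)) (split (tgt g))
      have tg : Typed (src g + j) [(⟨0, g, j⟩ : Slice G)] (tgt g + j) := by
        simp [Typed, Slice.dom, Slice.cod]
      have h2 := hr.symm _ _ _ _ (hr.interchange_word ((tB n i)) tg)
      have h2' := hr.comp_right h2 ((((tB n (tgt g)).shift i j).cast
        (n' := n + i + (tgt g + j)) (by omega) rfl).append
        ((((tB n j).shift (i + tgt g) 0).cast (by omega) rfl)))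
      have h3 := hr.whisker i j _ _ _ _ (hr.naturality_gen_right g n)
      have h3' := hr.comp_right (hr.comp_left (((tB n i).shift 0 (src g + j)).cast rfl
        (m' := i + (n + src g) + j) (by omega)) h3)
        (((tB n j).shift (i + tgt g) 0).cast (by omega) rfl)
      have h4 := hr.interchange_word (ts i 0) (tB n j)
      have h4' := hr.comp_left ((((tB n i).shift 0 (src g + j)).cast rfl
        (m' := i + (n + src g) + j) (by omega)).append (((tB n (src g)).shift i j).cast rfl
        (m' := i + src g + 0 + (n + j)) (by omega))) h4
      have h5 := hr.comp_right (split (src g)) ((ts i (j + n)).cast (by omega) rfl)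
      refine hr.trans _ _ _ _ _ (rel_cast h1 rfl rfl rfl rfl) ?_
      refine hr.trans _ _ _ _ _ (rel_cast h2' (by omega) (by omega) ?_ rfl) ?_
      · simp
      refine hr.trans _ _ _ _ _ (rel_cast h3' (by omega) (by omega) ?_ rfl) ?_
      · simp [Nat.add_comm]
      refine hr.trans _ _ _ _ _ (rel_cast h4' (by omega) (by omega) ?_ rfl) ?_
      · simp [Nat.add_comm]
      refine hr.symm _ _ _ _ (rel_cast h5 rfl (by omega) rfl ?_)
      simp [Nat.add_comm]
    have t1 : Typed (n + (i + src g + j)) [(⟨n + i, g, j⟩ : Slice G)] (n + (i + tgt g + j)) := by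
      simp only [Typed, Slice.dom, Slice.cod]; omega
    have h1 := hr.comp_left t1 (ih hf)
    have h2 := hr.comp_right key ((hf.shift 0 n).cast (by omega) rfl)
    refine hr.trans _ _ _ _ _ (rel_cast h1 rfl rfl (by simp) rfl) ?_
    exact rel_cast h2 rfl (by omega) (by simp) (by simp)

theorem naturality_word_left (hr : IsBraidedCong r) {a b : ℕ} {f : Word G} (hf : Typed a f b)
    (m : ℕ) :
    r (a + m) (m + b) (shift 0 m f ++ blockCross Signature.cross b m)
      (blockCross Signature.cross a m ++ shift m 0 f) := by
  have tB := fun n m => typed_blockCross (G := G) src_cross tgt_cross n m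
  induction f generalizing a with
  | nil =>
    obtain rfl : a = b := hf
    simpa using hr.refl _ _ _ ((tB a m).cast rfl (Nat.add_comm a m))
  | cons s f ih =>
    obtain ⟨i, g, j⟩ := s
    obtain ⟨ha, hf⟩ := hf
    simp only [Slice.dom, Slice.cod] at ha hf
    subst ha
    have key : r (i + src g + j + m) (m + (i + tgt g + j))
        (⟨i, g, j + m⟩ :: blockCross Signature.cross (i + tgt g + j) m)
        (blockCross Signature.cross (i + src g + j) m ++ [⟨m + i, g, j⟩]) := by
      have split : ∀ t, blockCross (Signature.cross : G) (i + t + j) m =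
          shift (i + t) 0 (blockCross Signature.cross j m) ++
            (shift i j (blockCross Signature.cross t m) ++
            shift 0 (t + j) (blockCross Signature.cross i m)) := by
        intro t
        rw [blockCross_add_left, blockCross_add_left]
        simp [Nat.add_comm]
      have ts : ∀ x y, Typed (x + src g + y) [(⟨x, g, y⟩ : Slice G)] (x + tgt g + y) := by
        intro x y; simp [Typed, Slice.dom, Slice.cod]
      have tg : Typed (src g + j) [(⟨0, g, j⟩ : Slice G)] (tgt g + j) := by
        simp [Typed, Slice.dom, Slice.cod]
      have h2 := hr.interchange_word (ts i 0) (tB j m)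
      have h2' := hr.comp_right h2 ((((tB (tgt g) m).shift i j).cast
        (n' := i + tgt g + 0 + (j + m)) (by omega) rfl).append
        ((((tB i m).shift 0 (tgt g + j)).cast (by omega) rfl)))
      have h3 := hr.whisker i j _ _ _ _ (hr.naturality_gen_left g m)
      have h3' := hr.comp_right (hr.comp_left (((tB j m).shift (i + src g) 0).cast rfl
        (m' := i + (src g + m) + j) (by omega)) h3)
        (((tB i m).shift 0 (tgt g + j)).cast (by omega) rfl)
      have h4 := hr.symm _ _ _ _ (hr.interchange_word (tB i m) tg)
      have h4' := hr.comp_left ((((tB j m).shift (i + src g) 0).cast rfl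
        (m' := i + (src g + m) + j) (by omega)).append (((tB (src g) m).shift i j).cast rfl
        (m' := i + m + (src g + j)) (by omega))) h4
      rw [split, split]
      refine hr.trans _ _ _ _ _ (rel_cast h2' (by omega) (by omega) ?_ rfl) ?_
      · simp [Nat.add_comm j m]
      refine hr.trans _ _ _ _ _ (rel_cast h3' (by omega) (by omega) ?_ rfl) ?_
      · simp [Nat.add_comm j m]
      refine rel_cast h4' (by omega) (by omega) ?_ ?_
      · simp [Nat.add_comm]
      · simp [Nat.add_comm]
    have t1 : Typed (i + src g + j + m) [(⟨i, g, j + m⟩ : Slice G)] (i + tgt g + j + m) := by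
      simp only [Typed, Slice.dom, Slice.cod]; omega
    have h1 := hr.comp_left t1 (ih hf)
    have h2 := hr.comp_right key ((hf.shift m 0).cast (by omega) rfl)
    refine hr.trans _ _ _ _ _ (rel_cast h1 rfl rfl (by simp) rfl) ?_
    exact rel_cast h2 rfl (by omega) (by simp) (by simp)

theorem blockCross_inv (hr : IsBraidedCong r) {x y : G} (hsx : src x = 2) (htx : tgt x = 2)
    (hsy : src y = 2) (hty : tgt y = 2)
    (hxy : r 2 2 [⟨0, x, 0⟩, ⟨0, y, 0⟩] []) (n m : ℕ) :
    r (n + m) (n + m) (blockCross x n m ++ (blockCross y n m).reverse) [] := by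
  have one : ∀ m, r (m + 1) (m + 1) (crossOne x m ++ (crossOne y m).reverse) [] := by
    intro m
    induction m with
    | zero => exact hr.refl _ _ _ (by simp [crossOne, Typed])
    | succ m ih =>
      have t1 : Typed (m + 1 + 1) [(⟨0, x, m⟩ : Slice G)] (m + 1 + 1) := by
        simp only [Typed, Slice.dom, Slice.cod, hsx, htx]; omega
      have t2 : Typed (m + 1 + 1) [(⟨0, y, m⟩ : Slice G)] (m + 1 + 1) := by
        simp only [Typed, Slice.dom, Slice.cod, hsy, hty]; omega
      have h1 := hr.comp_right (hr.comp_left t1 (rel_cast (hr.whisker 1 0 _ _ _ _ ih)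
        (n' := m + 1 + 1) (m' := m + 1 + 1) (by omega) (by omega) rfl rfl)) t2
      have h2 := hr.whisker 0 m _ _ _ _ hxy
      refine hr.trans _ _ _ _ _ (rel_cast h1 rfl rfl ?_ rfl) (rel_cast h2 (by omega) (by omega) ?_ ?_)
      · simp [crossOne, shift_reverse]
      · simp
      · simp
  induction n with
  | zero => exact hr.refl _ _ _ (by simp [blockCross, Typed])
  | succ n ih =>
    have tx := (typed_crossOne hsx htx m).shift n 0
    have ty := (typed_reverse hsy hty (gen_crossOne y m) (typed_crossOne hsy hty m)).shift n 0
    have h1 := hr.comp_right (hr.comp_left tx (rel_cast (hr.whisker 0 1 _ _ _ _ ih)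
        (n' := n + (m + 1) + 0) (m' := n + (m + 1) + 0) (by omega) (by omega) rfl rfl)) ty
    have h2 := hr.whisker n 0 _ _ _ _ (one m)
    refine hr.trans _ _ _ _ _ (rel_cast h1 (by omega) (by omega) ?_ rfl)
      (rel_cast h2 (by omega) (by omega) ?_ ?_)
    · simp [blockCross, shift_reverse]
    · simp
    · simp

theorem inv_blockCross (hr : IsBraidedCong r) {x y : G} (hsx : src x = 2) (htx : tgt x = 2)
    (hsy : src y = 2) (hty : tgt y = 2)
    (hyx : r 2 2 [⟨0, y, 0⟩, ⟨0, x, 0⟩] []) (n m : ℕ) :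
    r (n + m) (n + m) ((blockCross y n m).reverse ++ blockCross x n m) [] := by
  have one : ∀ m, r (m + 1) (m + 1) ((crossOne y m).reverse ++ crossOne x m) [] := by
    intro m
    induction m with
    | zero => exact hr.refl _ _ _ (by simp [crossOne, Typed])
    | succ m ih =>
      have t1 := (typed_reverse hsy hty (gen_crossOne y m) (typed_crossOne hsy hty m)).shift 1 0
      have t2 := (typed_crossOne hsx htx m).shift 1 0
      have h1 := hr.comp_right (hr.comp_left t1 (rel_cast (hr.whisker 0 m _ _ _ _ hyx)
        (n' := 1 + (m + 1) + 0) (m' := 1 + (m + 1) + 0) (by omega) (by omega) rfl rfl)) t2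
      have h2 := hr.whisker 1 0 _ _ _ _ ih
      refine hr.trans _ _ _ _ _ (rel_cast h1 (by omega) (by omega) ?_ rfl)
        (rel_cast h2 (by omega) (by omega) ?_ ?_)
      · simp [crossOne, shift_reverse]
      · simp
      · simp
  induction n with
  | zero => exact hr.refl _ _ _ (by simp [blockCross, Typed])
  | succ n ih =>
    have tx := (typed_blockCross hsx htx n m).shift 0 1
    have ty := (typed_reverse hsy hty (gen_blockCross y n m) (typed_blockCross hsy hty n m)).shift
      0 1
    have h1 := hr.comp_right (hr.comp_left ty (rel_cast (hr.whisker n 0 _ _ _ _ (one m))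
        (n' := 0 + (n + m) + 1) (m' := 0 + (n + m) + 1) (by omega) (by omega) rfl rfl)) tx
    have h2 := hr.whisker 0 1 _ _ _ _ ih
    refine hr.trans _ _ _ _ _ (rel_cast h1 (by omega) (by omega) ?_ rfl)
      (rel_cast h2 (by omega) (by omega) ?_ ?_)
    · simp [blockCross, shift_reverse]
    · simp
    · simp

end IsBraidedCong

end Words

/-! ### Strict braided tensor categories of diagrams -/

/-- The data of a strict braided tensor category with objects `0, 1, 2, …` and `n ⊗ m = n + m`:
the object `n` stands for `width * n` ends, a morphism `n ⟶ m` is a class of diagrams satisfying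
`ok n m` under the equivalence relation `rel n m`, and the braiding of `n` and `m` is the crossing
of `width * n` with `width * m` parallel strands. -/
structure Presentation (G : Type) [Signature G] where
  width : ℕ
  ok : ℕ → ℕ → Word G → Prop
  rel : ℕ → ℕ → Word G → Word G → Prop
  typed : ∀ {n m u}, ok n m u → Typed (width * n) u (width * m)
  ok_id : ∀ n, ok n n []
  ok_comp : ∀ {n m k u v}, ok n m u → ok m k v → ok n k (u ++ v)
  ok_tensor : ∀ {n m n' m' u v}, ok n m u → ok n' m' v →
    ok (n + n') (m + m') (shift 0 (width * n') u ++ shift (width * m) 0 v)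
  ok_braiding : ∀ n m, ok (n + m) (m + n) (blockCross cross (width * n) (width * m))
  ok_braidingInv : ∀ n m,
    ok (m + n) (n + m) (blockCross crossInv (width * n) (width * m)).reverse
  rel_refl : ∀ {n m u}, ok n m u → rel n m u u
  rel_symm : ∀ {n m u v}, rel n m u v → rel n m v u
  rel_trans : ∀ {n m u v w}, rel n m u v → rel n m v w → rel n m u w
  rel_comp : ∀ {n m k u u' v v'}, rel n m u u' → rel m k v v' → rel n k (u ++ v) (u' ++ v')
  rel_tensor : ∀ {n m n' m' u u' v v'}, rel n m u u' → rel n' m' v v' →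
    rel (n + n') (m + m') (shift 0 (width * n') u ++ shift (width * m) 0 v)
      (shift 0 (width * n') u' ++ shift (width * m) 0 v')
  base : ℕ → ℕ → Word G → Word G → Prop
  base_cong : IsBraidedCong base
  rel_of_base : ∀ {n m u v}, ok n m u → ok n m v → base (width * n) (width * m) u v → rel n m u v

namespace Presentation

variable {G : Type} [Signature G] (P : Presentation G)

/-- The objects. -/
structure Obj (P : Presentation G) where
  /-- The number of tensor factors. -/
  n : ℕ

instance setoid (n m : ℕ) : Setoid {u : Word G // P.ok n m u} where
  r u v := P.rel n m u.1 v.1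
  iseqv := ⟨fun u => P.rel_refl u.2, fun h => P.rel_symm h, fun h h' => P.rel_trans h h'⟩

/-- The class of a diagram. -/
def cls {a b : P.Obj} (u : Word G) (h : P.ok a.n b.n u) : Quotient (P.setoid a.n b.n) :=
  Quotient.mk _ ⟨u, h⟩

theorem cls_eq {a b : P.Obj} {u v : Word G} (hu : P.ok a.n b.n u) (hv : P.ok a.n b.n v)
    (h : u = v) : P.cls (a := a) (b := b) u hu = P.cls v hv := by subst h; rfl

theorem cls_sound {a b : P.Obj} {u v : Word G} (hu : P.ok a.n b.n u) (hv : P.ok a.n b.n v)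
    (h : P.rel a.n b.n u v) : P.cls (a := a) (b := b) u hu = P.cls v hv := Quotient.sound h

theorem cls_base {a b : P.Obj} {u v : Word G} (hu : P.ok a.n b.n u) (hv : P.ok a.n b.n v)
    {p q : ℕ} (h : P.base p q u v) (hp : p = P.width * a.n) (hq : q = P.width * b.n) :
    P.cls (a := a) (b := b) u hu = P.cls v hv :=
  P.cls_sound hu hv (P.rel_of_base hu hv (by subst hp hq; exact h))

instance : Category P.Obj where
  Hom a b := Quotient (P.setoid a.n b.n)
  id a := P.cls [] (P.ok_id a.n)
  comp := Quotient.map₂ (fun u v => ⟨u.1 ++ v.1, P.ok_comp u.2 v.2⟩)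
    (fun _ _ h _ _ h' => P.rel_comp h h')
  id_comp f := by
    induction f using Quotient.inductionOn
    rfl
  comp_id f := by
    induction f using Quotient.inductionOn
    exact P.cls_eq _ _ (List.append_nil _)
  assoc f g h := by
    induction f using Quotient.inductionOn
    induction g using Quotient.inductionOn
    induction h using Quotient.inductionOn
    exact P.cls_eq _ _ (List.append_assoc _ _ _)

variable {P}

/-- The morphism given by a diagram. -/
def hom {a b : P.Obj} (u : Word G) (h : P.ok a.n b.n u) : a ⟶ b := P.cls u h

theorem hom_ind {a b : P.Obj} {p : (a ⟶ b) → Prop} (h : ∀ u hu, p (hom u hu)) (f : a ⟶ b) : p f :=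
  Quotient.inductionOn f fun u => h u.1 u.2

theorem hom_comp {a b c : P.Obj} {u v : Word G} (hu : P.ok a.n b.n u) (hv : P.ok b.n c.n v) :
    hom u hu ≫ hom v hv = (hom (u ++ v) (P.ok_comp hu hv) : a ⟶ c) := rfl

theorem ok_cast {n m : ℕ} (h : n = m) : P.ok n m [] := by subst h; exact P.ok_id n

/-- The identity diagram as an isomorphism between equal objects. -/
def castIso {a b : P.Obj} (h : a.n = b.n) : a ≅ b where
  hom := hom [] (ok_cast h)
  inv := hom [] (ok_cast h.symm)
  hom_inv_id := rfl
  inv_hom_id := rfl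

/-- Juxtaposition of diagrams. -/
def tensor {a b c d : P.Obj} : (a ⟶ b) → (c ⟶ d) → ((⟨a.n + c.n⟩ : P.Obj) ⟶ ⟨b.n + d.n⟩) :=
  Quotient.map₂ (fun u v => ⟨_, P.ok_tensor u.2 v.2⟩) (fun _ _ h _ _ h' => P.rel_tensor h h')

instance : MonoidalCategoryStruct P.Obj where
  tensorObj a b := ⟨a.n + b.n⟩
  tensorUnit := ⟨0⟩
  tensorHom f g := tensor f g
  whiskerLeft a _ _ f := tensor (𝟙 a) f
  whiskerRight f b := tensor f (𝟙 b)
  associator a b c := castIso (Nat.add_assoc a.n b.n c.n)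
  leftUnitor a := castIso (Nat.zero_add a.n)
  rightUnitor a := castIso (Nat.add_zero a.n)

theorem tensor_n (a b : P.Obj) : (a ⊗ b).n = a.n + b.n := rfl

theorem unit_n : (𝟙_ P.Obj).n = 0 := rfl

instance : MonoidalCategory P.Obj := MonoidalCategory.ofTensorHom
  (id_tensorHom_id := fun _ _ => rfl)
  (id_tensorHom := by intros; rfl)
  (tensorHom_id := by intros; rfl)
  (tensorHom_comp_tensorHom := by
    intro a b c a' b' c' f f' g g'
    induction f using hom_ind with | _ f hf
    induction f' using hom_ind with | _ f' hf'
    induction g using hom_ind with | _ g hg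
    induction g' using hom_ind with | _ g' hg'
    have h0 := P.base_cong.interchange_word (P.typed hg) (P.typed hf')
    have t1 := (P.typed hf).shift 0 (P.width * a'.n)
    have t2 := (P.typed hg').shift (P.width * c.n) 0
    have h1 := P.base_cong.comp_right (P.base_cong.comp_left (t1.cast rfl
      (m' := P.width * b.n + P.width * a'.n) (by omega)) (P.base_cong.symm _ _ _ _ h0))
      (t2.cast (by omega) rfl)
    refine P.cls_base _ _ (rel_cast h1 rfl rfl ?_ ?_) ?_ ?_
    · simp
    · simp
    · simp [tensor_n, Nat.mul_add]
    · simp [tensor_n, Nat.mul_add])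
  (associator_naturality := by
    intro a b c a' b' c' f g h
    induction f using hom_ind with | _ f hf
    induction g using hom_ind with | _ g hg
    induction h using hom_ind with | _ h hh
    exact P.cls_eq _ _ (by
      simp [tensor_n, Nat.mul_add, Nat.add_comm]))
  (leftUnitor_naturality := by
    intro a b f
    induction f using hom_ind with | _ f hf
    exact P.cls_eq _ _ (by simp [unit_n]))
  (rightUnitor_naturality := by
    intro a b f
    induction f using hom_ind with | _ f hf
    exact P.cls_eq _ _ (by simp [unit_n]))
  (pentagon := by intros; rfl)
  (triangle := by intros; rfl)

/-- The crossing of two bundles of parallel strands. -/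
instance : BraidedCategory P.Obj where
  braiding a b :=
    { hom := hom _ (P.ok_braiding a.n b.n)
      inv := hom _ (P.ok_braidingInv a.n b.n)
      hom_inv_id := P.cls_base _ (P.ok_id _)
        (P.base_cong.blockCross_inv src_cross tgt_cross src_crossInv tgt_crossInv
          P.base_cong.cross_crossInv _ _) (Nat.mul_add _ _ _).symm (Nat.mul_add _ _ _).symm
      inv_hom_id := P.cls_base _ (P.ok_id _)
        (P.base_cong.inv_blockCross src_cross tgt_cross src_crossInv tgt_crossInv
          P.base_cong.crossInv_cross _ _) (by rw [tensor_n, Nat.mul_add, Nat.add_comm])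
          (by rw [tensor_n, Nat.mul_add, Nat.add_comm]) }
  braiding_naturality_right a b c f := by
    induction f using hom_ind with | _ f hf
    refine P.cls_base _ _ (rel_cast (P.base_cong.naturality_word_right (P.typed hf)
      (P.width * a.n)) rfl rfl ?_ ?_) (Nat.mul_add _ _ _).symm (Nat.mul_add _ _ _).symm
    · simp
    · simp
  braiding_naturality_left f c := by
    induction f using hom_ind with | _ f hf
    refine P.cls_base _ _ (rel_cast (P.base_cong.naturality_word_left (P.typed hf)
      (P.width * c.n)) rfl rfl ?_ ?_) (Nat.mul_add _ _ _).symm (Nat.mul_add _ _ _).symm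
    · simp
    · simp
  hexagon_forward a b c := by
    refine P.cls_base _ _ (rel_cast (P.base_cong.blockCross_add_right (P.width * a.n)
      (P.width * b.n) (P.width * c.n)) rfl rfl ?_ ?_) ?_ ?_
    · simp [tensor_n, Nat.mul_add]
    · simp
    · simp [tensor_n, Nat.mul_add, Nat.add_assoc]
    · simp [tensor_n, Nat.mul_add, Nat.add_assoc]
  hexagon_reverse a b c := by
    refine P.cls_eq _ _ ?_
    simp [tensor_n, Nat.mul_add, blockCross_add_left]

end Presentation

/-! ### The category `Alg` -/

/-- The generating morphisms of `Alg`. -/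
inductive AlgGen
  | unit
  | mul
  | counit
  | comul
  | antipode
  | antipodeInv
  | ribbon
  | ribbonInv
  | integral
  | braid
  | braidInv

instance : Signature AlgGen where
  src
    | .unit => 0
    | .mul => 2
    | .counit => 1
    | .comul => 1
    | .antipode => 1
    | .antipodeInv => 1
    | .ribbon => 0
    | .ribbonInv => 0
    | .integral => 1
    | .braid => 2
    | .braidInv => 2
  tgt
    | .unit => 1
    | .mul => 1
    | .counit => 0
    | .comul => 2
    | .antipode => 1
    | .antipodeInv => 1
    | .ribbon => 1
    | .ribbonInv => 1
    | .integral => 0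
    | .braid => 2
    | .braidInv => 2
  cross := .braid
  crossInv := .braidInv
  src_cross := rfl
  tgt_cross := rfl
  src_crossInv := rfl
  tgt_crossInv := rfl

/-- The copairing `ω = (V⁻¹ ⊗ V⁻¹) Δ v : 1 ⟶ A ⊗ A`, where `V⁻¹` is multiplication by `v⁻¹`. -/
def pairing : Word AlgGen :=
  [⟨0, .ribbon, 0⟩, ⟨0, .comul, 0⟩, ⟨0, .ribbonInv, 2⟩, ⟨0, .mul, 1⟩, ⟨1, .ribbonInv, 1⟩,
    ⟨1, .mul, 0⟩]

/-- Congruences on diagrams satisfying the axioms of a braided Hopf algebra object with two-sided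
integral `μ` and ribbon element `v` inducing a non-degenerate Hopf pairing. -/
structure IsAlgCong (r : ℕ → ℕ → Word AlgGen → Word AlgGen → Prop) : Prop extends
    IsBraidedCong r where
  mul_assoc : r 3 1 [⟨0, .mul, 1⟩, ⟨0, .mul, 0⟩] [⟨1, .mul, 0⟩, ⟨0, .mul, 0⟩]
  unit_mul : r 1 1 [⟨0, .unit, 1⟩, ⟨0, .mul, 0⟩] []
  mul_unit : r 1 1 [⟨1, .unit, 0⟩, ⟨0, .mul, 0⟩] []
  comul_coassoc : r 1 3 [⟨0, .comul, 0⟩, ⟨0, .comul, 1⟩] [⟨0, .comul, 0⟩, ⟨1, .comul, 0⟩]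
  counit_comul : r 1 1 [⟨0, .comul, 0⟩, ⟨0, .counit, 1⟩] []
  comul_counit : r 1 1 [⟨0, .comul, 0⟩, ⟨1, .counit, 0⟩] []
  comul_mul : r 2 2 [⟨0, .mul, 0⟩, ⟨0, .comul, 0⟩]
    [⟨0, .comul, 1⟩, ⟨2, .comul, 0⟩, ⟨1, .braid, 1⟩, ⟨0, .mul, 2⟩, ⟨1, .mul, 0⟩]
  counit_mul : r 2 0 [⟨0, .mul, 0⟩, ⟨0, .counit, 0⟩] [⟨0, .counit, 1⟩, ⟨0, .counit, 0⟩]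
  comul_unit : r 0 2 [⟨0, .unit, 0⟩, ⟨0, .comul, 0⟩] [⟨0, .unit, 0⟩, ⟨1, .unit, 0⟩]
  antipode_left : r 1 1 [⟨0, .comul, 0⟩, ⟨0, .antipode, 1⟩, ⟨0, .mul, 0⟩]
    [⟨0, .counit, 0⟩, ⟨0, .unit, 0⟩]
  antipode_right : r 1 1 [⟨0, .comul, 0⟩, ⟨1, .antipode, 0⟩, ⟨0, .mul, 0⟩]
    [⟨0, .counit, 0⟩, ⟨0, .unit, 0⟩]
  antipode_antipodeInv : r 1 1 [⟨0, .antipode, 0⟩, ⟨0, .antipodeInv, 0⟩] []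
  antipodeInv_antipode : r 1 1 [⟨0, .antipodeInv, 0⟩, ⟨0, .antipode, 0⟩] []
  integral_left : r 1 1 [⟨0, .comul, 0⟩, ⟨1, .integral, 0⟩] [⟨0, .integral, 0⟩, ⟨0, .unit, 0⟩]
  integral_right : r 1 1 [⟨0, .comul, 0⟩, ⟨0, .integral, 1⟩] [⟨0, .integral, 0⟩, ⟨0, .unit, 0⟩]
  integral_antipode : r 1 0 [⟨0, .antipode, 0⟩, ⟨0, .integral, 0⟩] [⟨0, .integral, 0⟩]
  ribbon_central : r 1 1 [⟨0, .ribbon, 1⟩, ⟨0, .mul, 0⟩] [⟨1, .ribbon, 0⟩, ⟨0, .mul, 0⟩]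
  ribbon_ribbonInv : r 0 1 [⟨0, .ribbon, 0⟩, ⟨1, .ribbonInv, 0⟩, ⟨0, .mul, 0⟩] [⟨0, .unit, 0⟩]
  ribbon_antipode : r 0 1 [⟨0, .ribbon, 0⟩, ⟨0, .antipode, 0⟩] [⟨0, .ribbon, 0⟩]
  /-- `(1 ⊗ Δ) ω = (m ⊗ 1 ⊗ 1) (1 ⊗ ω ⊗ 1) ω` -/
  pairing_comul : r 0 3 (pairing ++ [⟨1, .comul, 0⟩])
    (pairing ++ shift 1 1 pairing ++ [⟨0, .mul, 2⟩])
  /-- `(f ⊗ 1) ω = (g ⊗ 1) ω` implies `f = g`. -/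
  pairing_nondegenerate : ∀ (m : ℕ) (f g : Word AlgGen), Typed 1 f m → Typed 1 g m →
    r 0 (m + 1) (pairing ++ shift 0 1 f) (pairing ++ shift 0 1 g) → r 1 m f g
  unit_counit : r 0 0 [⟨0, .unit, 0⟩, ⟨0, .counit, 0⟩] []
  ribbon_counit : r 0 0 [⟨0, .ribbon, 0⟩, ⟨0, .counit, 0⟩] []
  /-- `μ λ = 1` for `λ = (1 ⊗ μ) ω`. -/
  integral_pairing : r 0 0 (pairing ++ [⟨1, .integral, 0⟩, ⟨0, .integral, 0⟩]) []

/-- Equality of morphisms `A^{⊗n} ⟶ A^{⊗m}` in `Alg`: the smallest congruence satisfying the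
axioms. -/
def AlgRel (n m : ℕ) (u v : Word AlgGen) : Prop :=
  ∀ r : ℕ → ℕ → Word AlgGen → Word AlgGen → Prop, IsAlgCong r → r n m u v

theorem algRel_isAlgCong : IsAlgCong AlgRel where
  refl n m u h _ hr := hr.refl n m u h
  symm _ _ _ _ h _ hr := hr.symm _ _ _ _ (h _ hr)
  trans _ _ _ _ _ h h' _ hr := hr.trans _ _ _ _ _ (h _ hr) (h' _ hr)
  comp _ _ _ _ _ _ _ h h' _ hr := hr.comp _ _ _ _ _ _ _ (h _ hr) (h' _ hr)
  whisker _ _ _ _ _ _ h _ hr := hr.whisker _ _ _ _ _ _ (h _ hr)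
  interchange g h a _ hr := hr.interchange g h a
  cross_crossInv _ hr := hr.cross_crossInv
  crossInv_cross _ hr := hr.crossInv_cross
  naturality_left g _ hr := hr.naturality_left g
  naturality_right g _ hr := hr.naturality_right g
  mul_assoc _ hr := hr.mul_assoc
  unit_mul _ hr := hr.unit_mul
  mul_unit _ hr := hr.mul_unit
  comul_coassoc _ hr := hr.comul_coassoc
  counit_comul _ hr := hr.counit_comul
  comul_counit _ hr := hr.comul_counit
  comul_mul _ hr := hr.comul_mul
  counit_mul _ hr := hr.counit_mul
  comul_unit _ hr := hr.comul_unit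
  antipode_left _ hr := hr.antipode_left
  antipode_right _ hr := hr.antipode_right
  antipode_antipodeInv _ hr := hr.antipode_antipodeInv
  antipodeInv_antipode _ hr := hr.antipodeInv_antipode
  integral_left _ hr := hr.integral_left
  integral_right _ hr := hr.integral_right
  integral_antipode _ hr := hr.integral_antipode
  ribbon_central _ hr := hr.ribbon_central
  ribbon_ribbonInv _ hr := hr.ribbon_ribbonInv
  ribbon_antipode _ hr := hr.ribbon_antipode
  pairing_comul _ hr := hr.pairing_comul
  pairing_nondegenerate m f g hf hg h _ hr := hr.pairing_nondegenerate m f g hf hg (h _ hr)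
  unit_counit _ hr := hr.unit_counit
  ribbon_counit _ hr := hr.ribbon_counit
  integral_pairing _ hr := hr.integral_pairing

/-- Diagrams in the generators of `Alg` modulo the relations. -/
def algPresentation : Presentation AlgGen where
  width := 1
  ok n m u := Typed n u m
  rel := AlgRel
  typed h := by simpa using h
  ok_id _ := rfl
  ok_comp h h' := h.append h'
  ok_tensor h h' := by simpa using h.tensor h'
  ok_braiding n m := by
    simpa using (typed_blockCross (G := AlgGen) src_cross tgt_cross n m).cast rfl (Nat.add_comm n m)
  ok_braidingInv n m := by
    simpa using (typed_reverse (G := AlgGen) src_crossInv tgt_crossInv (gen_blockCross _ n m)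
      (typed_blockCross (G := AlgGen) src_crossInv tgt_crossInv n m)).cast (Nat.add_comm n m) rfl
  rel_refl h := algRel_isAlgCong.refl _ _ _ h
  rel_symm h := algRel_isAlgCong.symm _ _ _ _ h
  rel_trans h h' := algRel_isAlgCong.trans _ _ _ _ _ h h'
  rel_comp h h' := algRel_isAlgCong.comp _ _ _ _ _ _ _ h h'
  rel_tensor {n m n' m' u u' v v'} h h' := algRel_isAlgCong.comp _ _ _ _ _ _ _
    (rel_cast (algRel_isAlgCong.whisker 0 (1 * n') _ _ _ _ h) (n' := n + n') (m' := m + n')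
      (by omega) (by omega) rfl rfl)
    (rel_cast (algRel_isAlgCong.whisker (1 * m) 0 _ _ _ _ h') (by omega) (by omega) rfl rfl)
  base := AlgRel
  base_cong := algRel_isAlgCong.toIsBraidedCong
  rel_of_base _ _ h := by simpa using h

/-- The braided tensor category `Alg`, with objects `A^{⊗n}`. -/
abbrev Alg : Type := algPresentation.Obj

/-- The generating morphisms of `Alg`. -/
def Alg.gen (g : AlgGen) : (⟨src g⟩ : Alg) ⟶ ⟨tgt g⟩ :=
  Presentation.hom [⟨0, g, 0⟩] (by simp [algPresentation, Typed, Slice.dom, Slice.cod])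

/-! ### Framed tangles -/

/-- Elementary pieces of framed tangle diagrams. -/
inductive TangleGen
  /-- A maximum, `0 ⟶ 2`. -/
  | max
  /-- A minimum, `2 ⟶ 0`. -/
  | min
  /-- The crossing at which the strand from the upper left to the lower right passes under the
  other strand. -/
  | pos
  /-- The crossing at which the strand from the upper left to the lower right passes over the
  other strand. -/
  | neg

instance : Signature TangleGen where
  src
    | .max => 0
    | .min => 2
    | .pos => 2
    | .neg => 2
  tgt
    | .max => 2
    | .min => 0
    | .pos => 2
    | .neg => 2
  cross := .pos
  crossInv := .neg
  src_cross := rfl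
  tgt_cross := rfl
  src_crossInv := rfl
  tgt_crossInv := rfl

/-- A curl in a single strand, which changes its framing by `1` if `x = pos` and by `-1` if
`x = neg`. -/
def curl (x : TangleGen) : Word TangleGen := [⟨1, .max, 0⟩, ⟨0, x, 1⟩, ⟨1, .min, 0⟩]

/-- Congruences on diagrams of unoriented framed tangles, with the framing in the plane of
projection, which contain isotopy. Besides the second and third Reidemeister moves and moves of a
strand across a maximum or minimum, which are contained in the axioms of a braided tensor category,
these are the cancellation of a maximum with a minimum and the first Reidemeister
move for framed tangles, by which a curl may be flipped to the other side of its strand. -/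
structure IsIsotopyCong (r : ℕ → ℕ → Word TangleGen → Word TangleGen → Prop) : Prop extends
    IsBraidedCong r where
  zigzag_left : r 1 1 [⟨0, .max, 1⟩, ⟨1, .min, 0⟩] []
  zigzag_right : r 1 1 [⟨1, .max, 0⟩, ⟨0, .min, 1⟩] []
  reidemeister_one : r 1 1 (curl .pos) [⟨0, .max, 1⟩, ⟨1, .pos, 0⟩, ⟨0, .min, 1⟩]

/-- Isotopy of framed tangles with `n` upper and `m` lower ends. -/
def Isotopic (n m : ℕ) (u v : Word TangleGen) : Prop :=
  ∀ r : ℕ → ℕ → Word TangleGen → Word TangleGen → Prop, IsIsotopyCong r → r n m u v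

theorem isotopic_isIsotopyCong : IsIsotopyCong Isotopic where
  refl n m u h _ hr := hr.refl n m u h
  symm _ _ _ _ h _ hr := hr.symm _ _ _ _ (h _ hr)
  trans _ _ _ _ _ h h' _ hr := hr.trans _ _ _ _ _ (h _ hr) (h' _ hr)
  comp _ _ _ _ _ _ _ h h' _ hr := hr.comp _ _ _ _ _ _ _ (h _ hr) (h' _ hr)
  whisker _ _ _ _ _ _ h _ hr := hr.whisker _ _ _ _ _ _ (h _ hr)
  interchange g h a _ hr := hr.interchange g h a
  cross_crossInv _ hr := hr.cross_crossInv
  crossInv_cross _ hr := hr.crossInv_cross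
  naturality_left g _ hr := hr.naturality_left g
  naturality_right g _ hr := hr.naturality_right g
  zigzag_left _ hr := hr.zigzag_left
  zigzag_right _ hr := hr.zigzag_right
  reidemeister_one _ hr := hr.reidemeister_one

/-! ### Components and admissible tangles -/

/-- The points at which a diagram meets the horizontal lines separating its slices: `(t, i)` is
the `i`-th point from the left above the slice number `t`, which is also the point below the slice
number `t - 1`. `Joins t s p q` says that a piece of strand of the slice `s`, of number `t`, joins
`p` and `q`. -/
def Joins (t : ℕ) (s : Slice TangleGen) (p q : ℕ × ℕ) : Prop :=
  (∃ i, i < s.left ∧ p = (t, i) ∧ q = (t + 1, i)) ∨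
  (∃ i, i < s.right ∧
    p = (t, s.left + src s.gen + i) ∧ q = (t + 1, s.left + tgt s.gen + i)) ∨
  match s.gen with
  | .max => p = (t + 1, s.left) ∧ q = (t + 1, s.left + 1)
  | .min => p = (t, s.left) ∧ q = (t, s.left + 1)
  | .pos => p = (t, s.left) ∧ q = (t + 1, s.left + 1) ∨ p = (t, s.left + 1) ∧ q = (t + 1, s.left)
  | .neg => p = (t, s.left) ∧ q = (t + 1, s.left + 1) ∨ p = (t, s.left + 1) ∧ q = (t + 1, s.left)

/-- Two points of a diagram lie on the same component of the tangle. -/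
def Connected (w : Word TangleGen) : ℕ × ℕ → ℕ × ℕ → Prop :=
  Relation.EqvGen fun p q => ∃ t s, w[t]? = some s ∧ Joins t s p q

/-- The upper end points `j⁺` and `j⁻` of the pair number `j` (counted from zero) are the points
number `2 * j` and `2 * j + 1` on the top line. -/
def TopStrand (w : Word TangleGen) (j : ℕ) : Prop := Connected w (0, 2 * j) (0, 2 * j + 1)

def BottomStrand (w : Word TangleGen) (j : ℕ) : Prop :=
  Connected w (w.length, 2 * j) (w.length, 2 * j + 1)

/-- Two strands join the pair `i` on the top line to the pair `j` on the bottom line. -/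
def ThroughStrand (w : Word TangleGen) (i j : ℕ) : Prop :=
  (Connected w (0, 2 * i) (w.length, 2 * j) ∧ Connected w (0, 2 * i + 1) (w.length, 2 * j + 1)) ∨
  (Connected w (0, 2 * i) (w.length, 2 * j + 1) ∧ Connected w (0, 2 * i + 1) (w.length, 2 * j))

/-- Admissible tangles `k ⟶ l`: every end point belongs to a top, bottom or through strand.
(All other components are closed.) -/
structure Admissible (k l : ℕ) (w : Word TangleGen) : Prop where
  typed : Typed (2 * k) w (2 * l)
  top : ∀ i < k, TopStrand w i ∨ ∃ j < l, ThroughStrand w i j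
  bottom : ∀ j < l, BottomStrand w j ∨ ∃ i < k, ThroughStrand w i j

/-! ### Doubling a closed component -/

/-- Elementary pieces of diagrams some of whose strands are marked (`true`). For a crossing, the
first mark is that of the strand starting on the left. -/
inductive MarkedGen
  | max (a : Bool)
  | min (a : Bool)
  | pos (a b : Bool)
  | neg (a b : Bool)

structure MarkedSlice where
  left : List Bool
  gen : MarkedGen
  right : List Bool

namespace MarkedGen

def src : MarkedGen → List Bool
  | max _ => []
  | min a => [a, a]
  | pos a b => [a, b]
  | neg a b => [a, b]

def tgt : MarkedGen → List Bool
  | max a => [a, a]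
  | min _ => []
  | pos a b => [b, a]
  | neg a b => [b, a]

def forget : MarkedGen → TangleGen
  | max _ => .max
  | min _ => .min
  | pos _ _ => .pos
  | neg _ _ => .neg

/-- The number of parallel strands replacing a strand. -/
def mult (a : Bool) : ℕ := if a then 2 else 1

/-- Replace every marked strand by two parallel strands. -/
def double : MarkedGen → Word TangleGen
  | max false => [⟨0, .max, 0⟩]
  | max true => [⟨0, .max, 0⟩, ⟨1, .max, 1⟩]
  | min false => [⟨0, .min, 0⟩]
  | min true => [⟨1, .min, 1⟩, ⟨0, .min, 0⟩]
  | pos a b => blockCross .pos (mult a) (mult b)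
  | neg a b => blockCross .neg (mult a) (mult b)

end MarkedGen

/-- The number of strands after doubling the marked ones. -/
def doubledWidth (l : List Bool) : ℕ := (l.map MarkedGen.mult).sum

namespace MarkedSlice

def dom (s : MarkedSlice) : List Bool := s.left ++ s.gen.src ++ s.right

def cod (s : MarkedSlice) : List Bool := s.left ++ s.gen.tgt ++ s.right

def forget (s : MarkedSlice) : Slice TangleGen := ⟨s.left.length, s.gen.forget, s.right.length⟩

def double (s : MarkedSlice) : Word TangleGen :=
  shift (doubledWidth s.left) (doubledWidth s.right) s.gen.double

end MarkedSlice

/-- The word `w` is a diagram with upper and lower ends marked as in the given lists. -/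
def MarkedTyped : List Bool → List MarkedSlice → List Bool → Prop
  | p, [], q => p = q
  | p, s :: w, q => p = s.dom ∧ MarkedTyped s.cod w q

def forgetMarks (w : List MarkedSlice) : Word TangleGen := w.map MarkedSlice.forget

/-- The diagram in which the marked strands are replaced by two parallel ones. -/
def doubleMarked (w : List MarkedSlice) : Word TangleGen := w.flatMap MarkedSlice.double

def MarkedPoint (w : List MarkedSlice) (p : ℕ × ℕ) : Prop :=
  ∃ s, w[p.1]? = some s ∧ s.dom[p.2]? = some true

/-- All marked strands belong to the same component. -/
def MarksOneComponent (w : List MarkedSlice) : Prop :=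
  ∀ p q, MarkedPoint w p → MarkedPoint w q → Connected (forgetMarks w) p q

/-! ### The moves -/

/-- The part of a diagram in which a strand coming down from the first upper end and returning to
the second one is clasped with a strand connecting the two lower ends. -/
def clasp (x : TangleGen) : Word TangleGen :=
  [⟨2, .max, 0⟩, ⟨1, x, 1⟩, ⟨1, x, 1⟩, ⟨0, .min, 2⟩]

/-- A Hopf link with two `0`-framed components. -/
def hopfLink : Word TangleGen := [⟨0, .max, 0⟩] ++ clasp .pos ++ [⟨0, .min, 0⟩]

/-- A Hopf link with a `1`-framed and a `0`-framed component. -/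
def hopfLinkOne : Word TangleGen :=
  [⟨0, .max, 0⟩] ++ shift 0 1 (curl .pos) ++ clasp .pos ++ [⟨0, .min, 0⟩]

/-- An arc at the top connecting the two upper ends, a `0`-framed annulus clasped with it, and an
arc at the bottom connecting the two lower ends and passing through the annulus in the same
direction. -/
def boundaryTangle : Word TangleGen := clasp .pos ++ clasp .neg

/-- Equivalence relations on admissible tangles, compatible with composition and tensor product,
which contain isotopy and the moves: addition of an isolated Hopf link, two-handle
slides over a closed component, and the boundary move. -/
structure IsMoveCong (r : ℕ → ℕ → Word TangleGen → Word TangleGen → Prop) : Prop where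
  refl : ∀ k l u, Admissible k l u → r k l u u
  symm : ∀ k l u v, r k l u v → r k l v u
  trans : ∀ k l u v w, r k l u v → r k l v w → r k l u w
  comp : ∀ k l m u u' v v', r k l u u' → r l m v v' → r k m (u ++ v) (u' ++ v')
  tensor : ∀ k l k' l' u u' v v', r k l u u' → r k' l' v v' →
    r (k + k') (l + l') (shift 0 (2 * k') u ++ shift (2 * l) 0 v)
      (shift 0 (2 * k') u' ++ shift (2 * l) 0 v')
  isotopy : ∀ k l u v, Admissible k l u → Admissible k l v → Isotopic (2 * k) (2 * l) u v →
    r k l u v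
  hopf : r 0 0 hopfLink []
  hopf_one : r 0 0 hopfLinkOne []
  /-- At the place where `u` is stacked on `v`, an unmarked strand runs to the left of and parallel
  to a strand of the marked closed component. The unmarked strand is replaced by its band sum with
  a parallel copy of that component. -/
  slide : ∀ (k l : ℕ) (p q : List Bool) (u v : List MarkedSlice),
    MarkedTyped (List.replicate (2 * k) false) u (p ++ [false, true] ++ q) →
    MarkedTyped (p ++ [false, true] ++ q) v (List.replicate (2 * l) false) →
    MarksOneComponent (u ++ v) →
    Admissible k l (forgetMarks (u ++ v)) →
    Admissible k l (doubleMarked u ++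
      shift (doubledWidth p) (doubledWidth q) [⟨0, .min, 1⟩, ⟨0, .max, 1⟩] ++ doubleMarked v) →
    r k l (forgetMarks (u ++ v))
      (doubleMarked u ++
        shift (doubledWidth p) (doubledWidth q) [⟨0, .min, 1⟩, ⟨0, .max, 1⟩] ++ doubleMarked v)
  boundary : r 1 1 [] boundaryTangle

/-- Equality of morphisms `k ⟶ l` in `Tgl`: the smallest such relation. -/
def TglRel (k l : ℕ) (u v : Word TangleGen) : Prop :=
  ∀ r : ℕ → ℕ → Word TangleGen → Word TangleGen → Prop, IsMoveCong r → r k l u v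

/-! ### The tangles assigned to the generators of `Alg` -/

/-- The tangle assigned to a generator.
* `unit`: an arc.
* `mul`: the first pair of strands runs through; an arc connects the ends of the second upper pair,
  and a `0`-framed annulus links it with the neighbouring strand of the first pair.
* `counit`: an arc with a `0`-framed annulus around it.
* `comul`: an arc at the top and the two arcs at the bottom, all passing through one `0`-framed
  annulus.
* `antipode`: a pair of strands with a half twist, and a curl in one strand.
* `ribbon`: an arc with a curl.
* `integral`: an arc.
* `braid`: the crossing of two pairs of strands. -/
def genTangle : AlgGen → Word TangleGen
  | .unit => [⟨0, .max, 0⟩]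
  | .mul => shift 2 0 (clasp .pos) ++ [⟨1, .neg, 1⟩, ⟨1, .neg, 1⟩, ⟨2, .min, 0⟩]
  | .counit => clasp .pos ++ [⟨0, .min, 0⟩]
  | .comul => clasp .neg ++ [⟨0, .max, 2⟩, ⟨4, .max, 0⟩, ⟨1, .pos, 3⟩, ⟨1, .pos, 3⟩,
      ⟨3, .pos, 1⟩, ⟨3, .pos, 1⟩, ⟨2, .min, 2⟩]
  | .antipode => ⟨0, .pos, 0⟩ :: shift 0 1 (curl .pos)
  | .antipodeInv => shift 0 1 (curl .neg) ++ [⟨0, .neg, 0⟩]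
  | .ribbon => ⟨0, .max, 0⟩ :: shift 0 1 (curl .neg)
  | .ribbonInv => ⟨0, .max, 0⟩ :: shift 0 1 (curl .pos)
  | .integral => [⟨0, .min, 0⟩]
  | .braid => blockCross .pos 2 2
  | .braidInv => (blockCross .neg 2 2).reverse

/-- The tangle assigned to a diagram in the generators of `Alg`. -/
def tangleOf (w : Word AlgGen) : Word TangleGen :=
  w.flatMap fun s => shift (2 * s.left) (2 * s.right) (genTangle s.gen)

/-! ### Composites and juxtapositions of admissible tangles are admissible -/

instance (t : ℕ) (s : Slice TangleGen) (p q : ℕ × ℕ) : Decidable (Joins t s p q) := by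
  obtain ⟨i, g, j⟩ := s
  cases g <;> (unfold Joins; infer_instance)

def adjacent (w : Word TangleGen) (p q : ℕ × ℕ) : Bool :=
  [p.1, p.1 - 1].any fun t =>
    match w[t]? with
    | some s => decide (Joins t s p q) || decide (Joins t s q p)
    | none => false

def neighbours (p : ℕ × ℕ) : List (ℕ × ℕ) :=
  [(p.1, p.2 + 1), (p.1, p.2 - 1)] ++ (List.range 5).map (fun d => (p.1 + 1, p.2 + d - 2)) ++
    (List.range 5).map (fun d => (p.1 - 1, p.2 + d - 2))

/-- Follow a component from `p`, having come from `o`, for at most the given number of steps. -/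
def follow (w : Word TangleGen) : ℕ → ℕ × ℕ → ℕ × ℕ → ℕ × ℕ → Bool
  | 0, _, p, q => p == q
  | n + 1, o, p, q => p == q || (neighbours p).any fun a =>
      a != o && adjacent w p a && follow w n p a q

namespace Connected

variable {w u v : Word TangleGen} {p q r : ℕ × ℕ}

theorem refl : Connected w p p := Relation.EqvGen.refl _

theorem symm (h : Connected w p q) : Connected w q p := Relation.EqvGen.symm _ _ h

theorem trans (h : Connected w p q) (h' : Connected w q r) : Connected w p r :=
  Relation.EqvGen.trans _ _ _ h h'

theorem of_joins {t : ℕ} {s : Slice TangleGen} (h : w[t]? = some s) (h' : Joins t s p q) :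
    Connected w p q := Relation.EqvGen.rel _ _ ⟨t, s, h, h'⟩

theorem of_adjacent (h : adjacent w p q = true) : Connected w p q := by
  simp only [adjacent, List.any_eq_true] at h
  obtain ⟨t, -, h⟩ := h
  split at h
  · rename_i s hs
    rcases Bool.or_eq_true_iff.1 h with h | h
    · exact of_joins hs (of_decide_eq_true h)
    · exact (of_joins hs (of_decide_eq_true h)).symm
  · exact absurd h (by simp)

theorem of_follow {n : ℕ} {o : ℕ × ℕ} (h : follow w n o p q = true) : Connected w p q := by
  induction n generalizing o p with
  | zero =>
    simp only [follow, beq_iff_eq] at h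
    subst h
    exact refl
  | succ n ih =>
    simp only [follow, Bool.or_eq_true, beq_iff_eq, List.any_eq_true, Bool.and_eq_true] at h
    rcases h with rfl | ⟨a, -, ⟨-, ha⟩, h⟩
    · exact refl
    · exact (of_adjacent ha).trans (ih h)

theorem map {f : ℕ × ℕ → ℕ × ℕ}
    (hf : ∀ t s p q, w[t]? = some s → Joins t s p q → Connected u (f p) (f q))
    (h : Connected w p q) : Connected u (f p) (f q) := by
  induction h with
  | rel p q h => obtain ⟨t, s, h, h'⟩ := h; exact hf t s p q h h'
  | refl p => exact refl
  | symm p q _ ih => exact ih.symm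
  | trans p q r _ _ ih ih' => exact ih.trans ih'

theorem append_left (v : Word TangleGen) (h : Connected u p q) : Connected (u ++ v) p q := by
  refine map (f := id) (fun t s p q h h' => of_joins ?_ h') h
  rw [List.getElem?_append_left (List.getElem?_eq_some_iff.1 h).1, h]

theorem append_right (u : Word TangleGen) (h : Connected v p q) :
    Connected (u ++ v) (u.length + p.1, p.2) (u.length + q.1, q.2) := by
  refine map (f := fun p => (u.length + p.1, p.2))
    (fun t s p q h h' => of_joins (t := u.length + t) (s := s) ?_ ?_) h
  · rw [List.getElem?_append_right (by omega), Nat.add_sub_cancel_left, h]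
  · obtain ⟨i, g, j⟩ := s
    obtain ⟨p, p'⟩ := p
    obtain ⟨q, q'⟩ := q
    simp only [Joins, Prod.mk.injEq] at h' ⊢
    rcases h' with ⟨k, hk, h1, h2⟩ | ⟨k, hk, h1, h2⟩ | h'
    · exact .inl ⟨k, hk, by omega, by omega⟩
    · exact .inr (.inl ⟨k, hk, by omega, by omega⟩)
    · refine .inr (.inr ?_)
      cases g <;> simp only at h' ⊢ <;> omega

theorem shift (a b : ℕ) (h : Connected w p q) :
    Connected (HopfTangle.shift a b w) (p.1, a + p.2) (q.1, a + q.2) := by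
  refine map (f := fun p => (p.1, a + p.2)) (fun t s p q h h' => of_joins (t := t)
    (s := ⟨a + s.left, s.gen, s.right + b⟩) ?_ ?_) h
  · simp [HopfTangle.shift, h]
  · obtain ⟨i, g, j⟩ := s
    obtain ⟨p, p'⟩ := p
    obtain ⟨q, q'⟩ := q
    simp only [Joins, Prod.mk.injEq] at h' ⊢
    rcases h' with ⟨k, hk, h1, h2⟩ | ⟨k, hk, h1, h2⟩ | h'
    · exact .inl ⟨a + k, by omega, by omega, by omega⟩
    · exact .inr (.inl ⟨k, by omega, by omega, by omega⟩)
    · refine .inr (.inr ?_)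
      cases g <;> simp only at h' ⊢ <;> omega

theorem vertical_left {a i : ℕ} (b : ℕ) (hi : i < a) (w : Word TangleGen) :
    Connected (HopfTangle.shift a b w) (0, i) (w.length, i) := by
  induction w with
  | nil => exact refl
  | cons s w ih =>
    have h1 : Connected (HopfTangle.shift a b (s :: w)) (0, i) (1, i) :=
      of_joins (t := 0) (s := ⟨a + s.left, s.gen, s.right + b⟩) rfl
        (.inl ⟨i, by simp only; omega, rfl, rfl⟩)
    have h2 := append_right [⟨a + s.left, s.gen, s.right + b⟩] ih
    simp only [List.length_singleton, Nat.add_comm 1] at h2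
    exact h1.trans h2

theorem vertical_right {b i n m : ℕ} (a : ℕ) (hi : i < b) {w : Word TangleGen}
    (hw : Typed n w m) :
    Connected (HopfTangle.shift a b w) (0, a + n + i) (w.length, a + m + i) := by
  induction w generalizing n with
  | nil => cases hw; exact refl
  | cons s w ih =>
    obtain ⟨rfl, hw⟩ := hw
    have h1 : Connected (HopfTangle.shift a b (s :: w)) (0, a + s.dom + i) (1, a + s.cod + i) :=
      of_joins (t := 0) (s := ⟨a + s.left, s.gen, s.right + b⟩) rfl
        (.inr (.inl ⟨s.right + i, by simp only; omega, by simp only [Slice.dom]; congr 1; omega,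
          by simp only [Slice.cod]; congr 1; omega⟩))
    have h2 := append_right [⟨a + s.left, s.gen, s.right + b⟩] (ih hw)
    simp only [List.length_singleton, Nat.add_comm 1] at h2
    exact h1.trans h2

end Connected

theorem shift_length {G : Type} (i j : ℕ) (w : Word G) : (shift i j w).length = w.length := by
  simp [shift]

theorem Connected.append {u v : Word TangleGen} {p : ℕ × ℕ} {i j : ℕ}
    (h : Connected u p (u.length, i)) (h' : Connected v (0, i) (v.length, j)) :
    Connected (u ++ v) p ((u ++ v).length, j) := by
  have := Connected.append_right u h'
  rw [List.length_append]
  exact (h.append_left v).trans this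

theorem Admissible.nil (n : ℕ) : Admissible n n [] :=
  ⟨rfl, fun i hi => .inr ⟨i, hi, .inl ⟨Connected.refl, Connected.refl⟩⟩,
    fun i hi => .inr ⟨i, hi, .inl ⟨Connected.refl, Connected.refl⟩⟩⟩

theorem ThroughStrand.append {u v : Word TangleGen} {i j k : ℕ} (h : ThroughStrand u i j)
    (h' : ThroughStrand v j k) : ThroughStrand (u ++ v) i k := by
  rcases h with ⟨h1, h2⟩ | ⟨h1, h2⟩ <;> rcases h' with ⟨h3, h4⟩ | ⟨h3, h4⟩
  · exact .inl ⟨h1.append h3, h2.append h4⟩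
  · exact .inr ⟨h1.append h3, h2.append h4⟩
  · exact .inr ⟨h1.append h4, h2.append h3⟩
  · exact .inl ⟨h1.append h4, h2.append h3⟩

theorem Admissible.append {k l m : ℕ} {u v : Word TangleGen} (hu : Admissible k l u)
    (hv : Admissible l m v) : Admissible k m (u ++ v) := by
  refine ⟨hu.typed.append hv.typed, fun i hi => ?_, fun j hj => ?_⟩
  · rcases hu.top i hi with h | ⟨j, hj, h⟩
    · exact .inl (h.append_left v)
    rcases hv.top j hj with h' | ⟨m, hm, h'⟩
    · left
      have h' := Connected.append_right u h'
      rcases h with ⟨h1, h2⟩ | ⟨h1, h2⟩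
      · exact ((h1.append_left v).trans h').trans (h2.append_left v).symm
      · exact ((h1.append_left v).trans h'.symm).trans (h2.append_left v).symm
    · exact .inr ⟨m, hm, h.append h'⟩
  · rcases hv.bottom j hj with h | ⟨i, hi, h⟩
    · left
      have := Connected.append_right u h
      rw [BottomStrand, List.length_append]
      exact this
    rcases hu.bottom i hi with h' | ⟨k, hk, h'⟩
    · left
      have h' := Connected.append_left v h'
      rw [BottomStrand, List.length_append]
      rcases h with ⟨h1, h2⟩ | ⟨h1, h2⟩
      · exact ((Connected.append_right u h1).symm.trans h').trans (Connected.append_right u h2)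
      · exact ((Connected.append_right u h2).symm.trans h'.symm).trans
          (Connected.append_right u h1)
    · exact .inr ⟨k, hk, h'.append h⟩

theorem ThroughStrand.shift {w : Word TangleGen} {i j : ℕ} (a b : ℕ) (h : ThroughStrand w i j) :
    ThroughStrand (HopfTangle.shift (2 * a) b w) (a + i) (a + j) := by
  simp only [ThroughStrand, shift_length, Nat.mul_add, Nat.add_assoc]
  rcases h with ⟨h1, h2⟩ | ⟨h1, h2⟩
  · exact .inl ⟨h1.shift (2 * a) b, h2.shift (2 * a) b⟩
  · exact .inr ⟨h1.shift (2 * a) b, h2.shift (2 * a) b⟩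

theorem Admissible.shift {k l : ℕ} {w : Word TangleGen} (a b : ℕ) (h : Admissible k l w) :
    Admissible (a + k + b) (a + l + b) (HopfTangle.shift (2 * a) (2 * b) w) := by
  have hl : ∀ i < a, ThroughStrand (HopfTangle.shift (2 * a) (2 * b) w) i i := by
    intro i hi
    simp only [ThroughStrand, shift_length]
    exact .inl ⟨Connected.vertical_left _ (by omega) w, Connected.vertical_left _ (by omega) w⟩
  have hr : ∀ i < b, ThroughStrand (HopfTangle.shift (2 * a) (2 * b) w) (a + k + i)
      (a + l + i) := by
    intro i hi
    simp only [ThroughStrand, shift_length, Nat.mul_add]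
    exact .inl ⟨Connected.vertical_right _ (by omega) h.typed,
      Connected.vertical_right (i := 2 * i + 1) _ (by omega) h.typed⟩
  refine ⟨(h.typed.shift (2 * a) (2 * b)).cast (by omega) (by omega), fun i hi => ?_,
    fun i hi => ?_⟩
  · rcases Nat.lt_or_ge i a with h1 | h1
    · exact .inr ⟨i, by omega, hl i h1⟩
    obtain ⟨i, rfl⟩ := Nat.exists_eq_add_of_le h1
    rcases Nat.lt_or_ge i k with h2 | h2
    · rcases h.top i h2 with h3 | ⟨j, hj, h3⟩
      · left
        have := Connected.shift (2 * a) (2 * b) h3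
        simpa only [TopStrand, Nat.mul_add, Nat.add_assoc] using this
      · exact .inr ⟨a + j, by omega, h3.shift a (2 * b)⟩
    obtain ⟨i, rfl⟩ := Nat.exists_eq_add_of_le h2
    exact .inr ⟨a + l + i, by omega, by rw [← Nat.add_assoc]; exact hr i (by omega)⟩
  · rcases Nat.lt_or_ge i a with h1 | h1
    · exact .inr ⟨i, by omega, hl i h1⟩
    obtain ⟨i, rfl⟩ := Nat.exists_eq_add_of_le h1
    rcases Nat.lt_or_ge i l with h2 | h2
    · rcases h.bottom i h2 with h3 | ⟨j, hj, h3⟩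
      · left
        have := Connected.shift (2 * a) (2 * b) h3
        simpa only [BottomStrand, shift_length, Nat.mul_add, Nat.add_assoc] using this
      · exact .inr ⟨a + j, by omega, h3.shift a (2 * b)⟩
    obtain ⟨i, rfl⟩ := Nat.exists_eq_add_of_le h2
    exact .inr ⟨a + k + i, by omega, by rw [← Nat.add_assoc]; exact hr i (by omega)⟩

theorem Admissible.cast {k l k' l' : ℕ} {w : Word TangleGen} (h : Admissible k l w) (hk : k = k')
    (hl : l = l') : Admissible k' l' w := by subst hk hl; exact h

theorem Admissible.tensor {k l k' l' : ℕ} {u v : Word TangleGen} (hu : Admissible k l u)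
    (hv : Admissible k' l' v) :
    Admissible (k + k') (l + l')
      (HopfTangle.shift 0 (2 * k') u ++ HopfTangle.shift (2 * l) 0 v) :=
  ((hu.shift 0 k').cast (k' := k + k') (l' := l + k') (by omega) (by omega)).append
    ((hv.shift l 0).cast (by omega) (by omega))

section Crossings

variable {x : TangleGen}

theorem connected_crossing (hx : x = .pos ∨ x = .neg) (i j : ℕ) :
    Connected [⟨i, x, j⟩] (0, i) (1, i + 1) ∧ Connected [⟨i, x, j⟩] (0, i + 1) (1, i) := by
  constructor
  · refine Connected.of_joins (t := 0) rfl (.inr (.inr ?_))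
    rcases hx with rfl | rfl <;> exact .inl ⟨rfl, rfl⟩
  · refine Connected.of_joins (t := 0) rfl (.inr (.inr ?_))
    rcases hx with rfl | rfl <;> exact .inr ⟨rfl, rfl⟩

theorem typed_cross (hx : x = .pos ∨ x = .neg) : src x = 2 ∧ tgt x = 2 := by
  rcases hx with rfl | rfl <;> exact ⟨rfl, rfl⟩

theorem connected_crossOne (hx : x = .pos ∨ x = .neg) (m : ℕ) :
    Connected (crossOne x m) (0, 0) ((crossOne x m).length, m) ∧
    ∀ j < m, Connected (crossOne x m) (0, j + 1) ((crossOne x m).length, j) := by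
  induction m with
  | zero => exact ⟨Connected.refl, fun j hj => absurd hj (by omega)⟩
  | succ m ih =>
    have h0 := connected_crossing hx 0 m
    have e : crossOne x (m + 1) = [⟨0, x, m⟩] ++ shift 1 0 (crossOne x m) := rfl
    rw [e]
    refine ⟨Connected.append h0.1 ?_, fun j hj => ?_⟩
    · have := Connected.shift 1 0 ih.1
      rw [shift_length]
      simpa [Nat.add_comm] using this
    · rcases j with _ | j
      · refine Connected.append h0.2 ?_
        rw [shift_length]
        exact Connected.vertical_left 0 (by omega) _
      · refine Connected.append (i := j + 2) ?_ ?_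
        · exact Connected.of_joins (t := 0) rfl (.inr (.inl ⟨j, by simp only; omega, by
            simp only [(typed_cross hx).1]; congr 1; omega, by
            simp only [(typed_cross hx).2]; congr 1; omega⟩))
        · have := Connected.shift 1 0 (ih.2 j (by omega))
          rw [shift_length]
          simpa [Nat.add_comm, Nat.add_left_comm] using this

theorem connected_blockCross (hx : x = .pos ∨ x = .neg) (n m : ℕ) :
    (∀ i < n, Connected (blockCross x n m) (0, i) ((blockCross x n m).length, m + i)) ∧
    ∀ j < m, Connected (blockCross x n m) (0, n + j) ((blockCross x n m).length, j) := by
  have ht := typed_cross hx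
  induction n with
  | zero =>
    exact ⟨fun i hi => absurd hi (by omega), fun j hj => by
      simpa [blockCross] using Connected.refl⟩
  | succ n ih =>
    have h1 := connected_crossOne hx m
    have e : blockCross x (n + 1) m = shift n 0 (crossOne x m) ++ shift 0 1 (blockCross x n m) :=
      rfl
    rw [e]
    refine ⟨fun i hi => ?_, fun j hj => ?_⟩
    · rcases Nat.lt_or_ge i n with h | h
      · refine Connected.append (i := i) ?_ ?_
        · rw [shift_length]; exact Connected.vertical_left 0 h _
        · rw [shift_length]; simpa using Connected.shift 0 1 (ih.1 i h)
      · obtain rfl : i = n := by omega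
        refine Connected.append (i := i + m) ?_ ?_
        · rw [shift_length]; simpa using Connected.shift i 0 h1.1
        · rw [shift_length]
          have := Connected.vertical_right (i := 0) 0 Nat.one_pos
            (typed_blockCross ht.1 ht.2 i m)
          simpa [Nat.add_comm] using this
    · refine Connected.append (i := n + j) ?_ ?_
      · rw [shift_length]
        simpa [Nat.add_comm, Nat.add_left_comm] using Connected.shift n 0 (h1.2 j hj)
      · rw [shift_length]; simpa using Connected.shift 0 1 (ih.2 j hj)

theorem Connected.reverse (hx : x = .pos ∨ x = .neg) {w : Word TangleGen}
    (hw : ∀ s ∈ w, s.gen = x) {p q : ℕ × ℕ} (h : Connected w p q) :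
    Connected w.reverse (w.length - p.1, p.2) (w.length - q.1, q.2) := by
  refine Connected.map (f := fun p => (w.length - p.1, p.2)) (fun t s p q h h' => ?_) h
  have hs := hw s (List.mem_of_getElem? h)
  have ht := (List.getElem?_eq_some_iff.1 h).1
  refine (Connected.of_joins (t := w.length - 1 - t) (s := s) ?_ ?_).symm
  · rw [List.getElem?_reverse (by omega), ← h]
    congr 1
    omega
  · obtain ⟨i, g, j⟩ := s
    obtain ⟨p, p'⟩ := p
    obtain ⟨q, q'⟩ := q
    simp only at hs
    subst hs
    have h2 := typed_cross hx
    simp only [Joins, Prod.mk.injEq, h2.1, h2.2] at h' ⊢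
    rcases h' with ⟨k, hk, h1, h2⟩ | ⟨k, hk, h1, h2⟩ | h'
    · exact .inl ⟨k, hk, by omega, by omega⟩
    · exact .inr (.inl ⟨k, hk, by omega, by omega⟩)
    · refine .inr (.inr ?_)
      rcases hx with rfl | rfl <;> simp only at h' ⊢ <;> omega

theorem admissible_blockCross (hx : x = .pos ∨ x = .neg) (n m : ℕ) :
    Admissible (n + m) (m + n) (blockCross x (2 * n) (2 * m)) ∧
    Admissible (m + n) (n + m) (blockCross x (2 * n) (2 * m)).reverse := by
  have ht := typed_cross hx
  have t := typed_blockCross ht.1 ht.2 (2 * n) (2 * m)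
  have hc := connected_blockCross hx (2 * n) (2 * m)
  have a1 : ∀ i < n, ThroughStrand (blockCross x (2 * n) (2 * m)) i (m + i) := fun i hi =>
    .inl ⟨by simpa only [Nat.mul_add, Nat.add_assoc] using hc.1 (2 * i) (by omega),
      by simpa only [Nat.mul_add, Nat.add_assoc] using hc.1 (2 * i + 1) (by omega)⟩
  have a2 : ∀ i < m, ThroughStrand (blockCross x (2 * n) (2 * m)) (n + i) i := fun i hi =>
    .inl ⟨by simpa only [Nat.mul_add, Nat.add_assoc] using hc.2 (2 * i) (by omega),
      by simpa only [Nat.mul_add, Nat.add_assoc] using hc.2 (2 * i + 1) (by omega)⟩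
  have rev : ∀ i j, ThroughStrand (blockCross x (2 * n) (2 * m)) i j →
      ThroughStrand (blockCross x (2 * n) (2 * m)).reverse j i := by
    intro i j h
    have r := fun p q h => Connected.reverse (p := p) (q := q) hx (gen_blockCross x (2 * n) (2 * m)) h
    simp only [ThroughStrand, List.length_reverse]
    rcases h with ⟨h1, h2⟩ | ⟨h1, h2⟩
    · exact .inl ⟨by simpa using (r _ _ h1).symm, by simpa using (r _ _ h2).symm⟩
    · exact .inr ⟨by simpa using (r _ _ h2).symm, by simpa using (r _ _ h1).symm⟩
  have b1 : ∀ i < n + m, ∃ j < m + n, ThroughStrand (blockCross x (2 * n) (2 * m)) i j := by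
    intro i hi
    rcases Nat.lt_or_ge i n with h | h
    · exact ⟨m + i, by omega, a1 i h⟩
    · obtain ⟨i, rfl⟩ := Nat.exists_eq_add_of_le h
      exact ⟨i, by omega, a2 i (by omega)⟩
  have b2 : ∀ i < m + n, ∃ j < n + m, ThroughStrand (blockCross x (2 * n) (2 * m)) j i := by
    intro i hi
    rcases Nat.lt_or_ge i m with h | h
    · exact ⟨n + i, by omega, a2 i h⟩
    · obtain ⟨i, rfl⟩ := Nat.exists_eq_add_of_le h
      exact ⟨i, by omega, a1 i (by omega)⟩
  refine ⟨⟨t.cast (by omega) (by omega), fun i hi => .inr (b1 i hi), fun i hi => .inr (b2 i hi)⟩,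
    ⟨(typed_reverse ht.1 ht.2 (gen_blockCross x _ _) t).cast (by omega) (by omega),
      fun i hi => ?_, fun i hi => ?_⟩⟩
  · obtain ⟨j, hj, h⟩ := b2 i hi
    exact .inr ⟨j, hj, rev _ _ h⟩
  · obtain ⟨j, hj, h⟩ := b1 i hi
    exact .inr ⟨j, hj, rev _ _ h⟩

end Crossings

theorem topStrand_of {w : Word TangleGen} {j : ℕ}
    (h : follow w 20 (0, 2 * j) (0, 2 * j) (0, 2 * j + 1) = true) : TopStrand w j :=
  Connected.of_follow h

theorem bottomStrand_of {w : Word TangleGen} {j : ℕ}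
    (h : follow w 20 (w.length, 2 * j) (w.length, 2 * j) (w.length, 2 * j + 1) = true) :
    BottomStrand w j := Connected.of_follow h

theorem admissible_genTangle (g : AlgGen) : Admissible (src g) (tgt g) (genTangle g) := by
  cases g
  case braid => exact (admissible_blockCross (.inl rfl) 1 1).1
  case braidInv => exact (admissible_blockCross (.inr rfl) 1 1).2
  case unit | ribbon | ribbonInv =>
    refine ⟨by simp [genTangle, curl, Typed, Slice.dom, Slice.cod, src, tgt],
      fun i hi => absurd hi (Nat.not_lt_zero i), fun i hi => .inl ?_⟩
    obtain rfl := Nat.lt_one_iff.1 hi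
    exact bottomStrand_of (by decide)
  case counit | integral =>
    refine ⟨by simp [genTangle, clasp, Typed, Slice.dom, Slice.cod, src, tgt],
      fun i hi => .inl ?_, fun i hi => absurd hi (Nat.not_lt_zero i)⟩
    obtain rfl := Nat.lt_one_iff.1 hi
    exact topStrand_of (by decide)
  case antipode | antipodeInv =>
    all_goals
      refine ⟨by simp [genTangle, curl, Typed, Slice.dom, Slice.cod, src, tgt],
        fun i hi => .inr ⟨0, Nat.one_pos, ?_⟩, fun i hi => .inr ⟨0, Nat.one_pos, ?_⟩⟩
      all_goals
        obtain rfl := Nat.lt_one_iff.1 hi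
        exact .inr ⟨Connected.of_follow (n := 20) (o := (0, 0)) (by decide),
          Connected.of_follow (n := 20) (o := (0, 1)) (by decide)⟩
  case mul =>
    have h : ThroughStrand (genTangle .mul) 0 0 :=
      .inl ⟨Connected.of_follow (n := 20) (o := (0, 0)) (by decide),
        Connected.of_follow (n := 20) (o := (0, 1)) (by decide)⟩
    refine ⟨by simp [genTangle, clasp, Typed, Slice.dom, Slice.cod, src, tgt],
      fun i hi => ?_, fun i hi => .inr ⟨0, Nat.two_pos, ?_⟩⟩
    · have hi : i < 2 := hi
      interval_cases i
      · exact .inr ⟨0, Nat.one_pos, h⟩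
      · exact .inl (topStrand_of (by decide))
    · obtain rfl := Nat.lt_one_iff.1 hi
      exact h
  case comul =>
    refine ⟨by simp [genTangle, clasp, Typed, Slice.dom, Slice.cod, src, tgt],
      fun i hi => .inl ?_, fun i hi => .inl ?_⟩
    · obtain rfl := Nat.lt_one_iff.1 hi
      exact topStrand_of (by decide)
    · have hi : i < 2 := hi
      interval_cases i
      · exact bottomStrand_of (by decide)
      · exact bottomStrand_of (by decide)

/-! ### The category `Tgl` -/

theorem tglRel_isMoveCong : IsMoveCong TglRel where
  refl k l u h _ hr := hr.refl k l u h
  symm _ _ _ _ h _ hr := hr.symm _ _ _ _ (h _ hr)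
  trans _ _ _ _ _ h h' _ hr := hr.trans _ _ _ _ _ (h _ hr) (h' _ hr)
  comp _ _ _ _ _ _ _ h h' _ hr := hr.comp _ _ _ _ _ _ _ (h _ hr) (h' _ hr)
  tensor _ _ _ _ _ _ _ _ h h' _ hr := hr.tensor _ _ _ _ _ _ _ _ (h _ hr) (h' _ hr)
  isotopy k l u v hu hv h _ hr := hr.isotopy k l u v hu hv h
  hopf _ hr := hr.hopf
  hopf_one _ hr := hr.hopf_one
  slide k l p q u v hu hv h hA hA' _ hr := hr.slide k l p q u v hu hv h hA hA'
  boundary _ hr := hr.boundary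

/-- Admissible tangles modulo isotopy and the moves. -/
def tglPresentation : Presentation TangleGen where
  width := 2
  ok := Admissible
  rel := TglRel
  typed h := h.typed
  ok_id := Admissible.nil
  ok_comp h h' := h.append h'
  ok_tensor h h' := h.tensor h'
  ok_braiding n m := (admissible_blockCross (.inl rfl) n m).1
  ok_braidingInv n m := (admissible_blockCross (.inr rfl) n m).2
  rel_refl h := tglRel_isMoveCong.refl _ _ _ h
  rel_symm h := tglRel_isMoveCong.symm _ _ _ _ h
  rel_trans h h' := tglRel_isMoveCong.trans _ _ _ _ _ h h'
  rel_comp h h' := tglRel_isMoveCong.comp _ _ _ _ _ _ _ h h'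
  rel_tensor h h' := tglRel_isMoveCong.tensor _ _ _ _ _ _ _ _ h h'
  base := Isotopic
  base_cong := isotopic_isIsotopyCong.toIsBraidedCong
  rel_of_base hu hv h := tglRel_isMoveCong.isotopy _ _ _ _ hu hv h

/-- The braided tensor category `Tgl`, with objects `0, 1, 2, …`. -/
abbrev Tgl : Type := tglPresentation.Obj

/-- The morphisms of `Tgl` assigned to the generators of `Alg`. -/
def Tgl.gen (g : AlgGen) : (⟨src g⟩ : Tgl) ⟶ ⟨tgt g⟩ :=
  Presentation.hom (genTangle g) (admissible_genTangle g)

end HopfTangle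

/-!
Equality of tangles is checked by calculation with diagrams, written as words of elementary pieces.
A change of a part of a diagram which does not change how the end points of this part are connected
turns admissible tangles into admissible ones. A `LocalMove` is such a change which does not change
the class in `Tgl` of any admissible tangle containing it. Isotopies, removal of isolated Hopf links
and slides are local moves (`LocalMove.of_isotopic`, `LocalMove.of_closed`, `LocalMove.slide`), and
local moves can be composed in parts of a diagram whose ends are not grouped in pairs. Hence a
relation can be proved by a list of moves and of the places where they are applied
(`Moves.calculate`); performing it is a finite computation.

The main tool is an annulus around some strands (`ring`). If a strand next to the annulus is slid
over it, it makes a full turn around the strands inside (`full_ring_one` and its analogues). Hence a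
crossing of this strand with the strands inside may be switched: `ring_switch_one` and its
analogues. An annulus around parallel strands, one of which is closed to a circle, can be removed
together with the circle: the circle is itself an annulus around a strand of the first one, so that
the crossings of this strand with the others may be switched until the others are free, and a Hopf
link remains (`absorb_one`, `absorb_two`). If the circle has framing `-1`, removing it leaves curls
and a full twist in the remaining strands (`absorb_loop_one`, `absorb_loop_two`). The
multiplication, the counit and the comultiplication are annuli around two, one and three strands
(`mul_ring`, `counit_ring`, `comul_ring`). This gives associativity, multiplicativity of the counit,
comultiplicativity of the unit and the antipode laws.

The boundary move applies only to a pair of strands of an admissible tangle, and therefore not in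
calculations with local moves. Unit and multiplication form a boundary tangle, so that the unit law
is the boundary move. Since a boundary tangle may be inserted into a pair of strands,

* it does not matter which of the two pairs of strands is closed in the multiplication
  (`equal_mul_mulRing'`),
* a curl may be moved between the two strands of a pair (`equal_loop_neg`), so that the ribbon
  element, which acts as a curl, is central,
* the copairing `ω`, which consists of two arcs hooked into each other (`equal_pairing`), is
  non-degenerate: together with `evaluation` it forms a boundary tangle
  (`copairing_snake_left`, `Equal.of_copairing`),
* two tangles are equal if they become so after hooking a single strand into a pair of upper ends
  (`Equal.of_hook`).

Through a hooked strand, the comultiplication becomes the doubling of the hooked arc (`hook_comul`)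
and the multiplication becomes a full turn (`hook_ring_two`). In this way coassociativity, the
counit law, the properties of the integral and the compatibility of multiplication and
comultiplication follow from calculations with hooked arcs, and so does
`(1 ⊗ Δ)ω = (m ⊗ 1 ⊗ 1)(1 ⊗ ω ⊗ 1)ω` (`copairing_comul`).

The axioms of a braided category hold by isotopy, since the tangle of a block crossing is the
crossing of twice as many strands (`isotopic_tangleOf_blockCross`). The functor is obtained by
passing to quotients. It is unique, since every diagram is a composite of generators with vertical
strands on both sides (`eq_tangleFunctor`).
-/

namespace HopfTangle

open Signature

/-! ### Colourings of diagrams by two colours -/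

/-- The colourings of the lower ends of an elementary piece which extend a given colouring of its
upper ends, when colours are constant along strands. -/
def genColours : TangleGen → List Bool → List (List Bool)
  | .max, _ => [[true, true], [false, false]]
  | .min, [a, b] => if a = b then [[]] else []
  | .pos, [a, b] => [[b, a]]
  | .neg, [a, b] => [[b, a]]
  | _, _ => []

/-- The colourings of the points below a slice which extend a given colouring of the points
above it. -/
def sliceColours (s : Slice TangleGen) (p : List Bool) : List (List Bool) :=
  (genColours s.gen ((p.drop s.left).take (src s.gen))).map fun o =>
    p.take s.left ++ o ++ p.drop (s.left + src s.gen)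

/-- The colourings of the lower ends of a diagram which, together with a given colouring of its
upper ends, extend to the strands. -/
def colours : Word TangleGen → List Bool → List (List Bool)
  | [], p => [p]
  | s :: w, p => (sliceColours s p).flatMap (colours w)

/-- Two diagrams with `n` upper ends which connect their end points in the same way. -/
def SameColours (n : ℕ) (u v : Word TangleGen) : Prop :=
  ∀ p : List Bool, p.length = n → ∀ q, q ∈ colours u p ↔ q ∈ colours v p

theorem sliceColours_append {g : TangleGen} {j : ℕ} {A x B : List Bool} (hx : x.length = src g) :
    sliceColours ⟨A.length, g, j⟩ (A ++ x ++ B) =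
      (genColours g x).map fun o => A ++ o ++ B := by
  simp [sliceColours, ← hx, List.drop_append]

theorem exists_split {s : Slice TangleGen} {p : List Bool} (hp : p.length = s.dom) :
    ∃ A x B : List Bool, p = A ++ x ++ B ∧ A.length = s.left ∧ x.length = src s.gen ∧
      B.length = s.right := by
  refine ⟨p.take s.left, (p.drop s.left).take (src s.gen), p.drop (s.left + src s.gen), ?_, ?_, ?_,
    ?_⟩
  · simp [← List.drop_drop]
  all_goals simp [hp, Slice.dom]; try omega

theorem length_of_mem_genColours {g : TangleGen} {x o : List Bool} (h : o ∈ genColours g x) :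
    o.length = tgt g := by
  unfold genColours at h
  split at h
  · simp only [List.mem_cons, List.not_mem_nil, or_false] at h
    rcases h with rfl | rfl <;> rfl
  · split at h
    · simp only [List.mem_cons, List.not_mem_nil, or_false] at h
      subst h; rfl
    · simp at h
  · simp only [List.mem_cons, List.not_mem_nil, or_false] at h
    subst h; rfl
  · simp only [List.mem_cons, List.not_mem_nil, or_false] at h
    subst h; rfl
  · simp at h

theorem mem_sliceColours {s : Slice TangleGen} {p q : List Bool} (hp : p.length = s.dom) :
    q ∈ sliceColours s p ↔ ∃ A x o B : List Bool, p = A ++ x ++ B ∧ q = A ++ o ++ B ∧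
      A.length = s.left ∧ x.length = src s.gen ∧ B.length = s.right ∧ o ∈ genColours s.gen x := by
  constructor
  · obtain ⟨A, x, B, rfl, hA, hx, hB⟩ := exists_split hp
    obtain ⟨l, g, r⟩ := s
    simp only at hA hx hB
    subst hA
    rw [sliceColours_append hx]
    simp only [List.mem_map]
    rintro ⟨o, ho, rfl⟩
    exact ⟨A, x, o, B, rfl, rfl, rfl, hx, hB, ho⟩
  · rintro ⟨A, x, o, B, rfl, rfl, hA, hx, hB, ho⟩
    obtain ⟨l, g, r⟩ := s
    simp only at hA hx hB
    subst hA
    rw [sliceColours_append hx]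
    exact List.mem_map_of_mem ho

theorem length_of_mem_sliceColours {s : Slice TangleGen} {p q : List Bool}
    (hp : p.length = s.dom) (h : q ∈ sliceColours s p) : q.length = s.cod := by
  obtain ⟨A, x, o, B, rfl, rfl, hA, hx, hB, ho⟩ := (mem_sliceColours hp).1 h
  simp [Slice.cod, hA, hB, length_of_mem_genColours ho, Nat.add_assoc]

theorem length_of_mem_colours {n m : ℕ} {w : Word TangleGen} (hw : Typed n w m) {p q : List Bool}
    (hp : p.length = n) (h : q ∈ colours w p) : q.length = m := by
  induction w generalizing n p with
  | nil => cases hw; simp only [colours, List.mem_singleton] at h; rw [h, hp]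
  | cons s w ih =>
    obtain ⟨rfl, hw⟩ := hw
    obtain ⟨x, hx, h⟩ := List.mem_flatMap.1 h
    exact ih hw (length_of_mem_sliceColours hp hx) h

theorem mem_colours_append {u v : Word TangleGen} {p q : List Bool} :
    q ∈ colours (u ++ v) p ↔ ∃ x ∈ colours u p, q ∈ colours v x := by
  induction u generalizing p with
  | nil => simp [colours]
  | cons s u ih =>
    simp only [List.cons_append, colours, List.mem_flatMap, ih]
    constructor
    · rintro ⟨a, ha, b, hb, h⟩; exact ⟨b, ⟨a, ha, hb⟩, h⟩
    · rintro ⟨b, ⟨a, ha, hb⟩, h⟩; exact ⟨a, ha, b, hb, h⟩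

theorem sliceColours_shift {s : Slice TangleGen} {a p b : List Bool} (hp : p.length = s.dom)
    (j : ℕ) : sliceColours ⟨a.length + s.left, s.gen, s.right + j⟩ (a ++ p ++ b) =
      (sliceColours s p).map fun q => a ++ q ++ b := by
  obtain ⟨A, x, B, rfl, hA, hx, hB⟩ := exists_split hp
  obtain ⟨l, g, r⟩ := s
  simp only at hA hx hB
  subst hA
  rw [sliceColours_append hx]
  have := sliceColours_append (A := a ++ A) (B := B ++ b) (j := r + j) hx
  simpa [Function.comp_def] using this

theorem colours_shift {n m : ℕ} {w : Word TangleGen} (hw : Typed n w m) {a p b : List Bool}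
    (hp : p.length = n) (j : ℕ) :
    colours (shift a.length j w) (a ++ p ++ b) = (colours w p).map fun q => a ++ q ++ b := by
  induction w generalizing n p with
  | nil => rfl
  | cons s w ih =>
    obtain ⟨rfl, hw⟩ := hw
    simp only [shift_cons, colours, sliceColours_shift hp, List.flatMap_map, List.map_flatMap]
    refine List.flatMap_congr fun x hx => ih hw (length_of_mem_sliceColours hp hx)

namespace SameColours

variable {n m k : ℕ} {u v w u' v' : Word TangleGen}

theorem refl (n : ℕ) (u : Word TangleGen) : SameColours n u u := fun _ _ _ => Iff.rfl

theorem symm (h : SameColours n u v) : SameColours n v u := fun p hp q => (h p hp q).symm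

theorem trans (h : SameColours n u v) (h' : SameColours n v w) : SameColours n u w :=
  fun p hp q => (h p hp q).trans (h' p hp q)

theorem append (hu : Typed n u m) (h : SameColours n u u') (h' : SameColours m v v') :
    SameColours n (u ++ v) (u' ++ v') := by
  intro p hp q
  simp only [mem_colours_append]
  constructor
  · rintro ⟨x, hx, hq⟩
    exact ⟨x, (h p hp x).1 hx, (h' x (length_of_mem_colours hu hp hx) q).1 hq⟩
  · rintro ⟨x, hx, hq⟩
    have hx := (h p hp x).2 hx
    exact ⟨x, hx, (h' x (length_of_mem_colours hu hp hx) q).2 hq⟩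

theorem shift (hu : Typed n u m) (hv : Typed n v m) (h : SameColours n u v) (i j : ℕ) :
    SameColours (i + n + j) (HopfTangle.shift i j u) (HopfTangle.shift i j v) := by
  intro p hp q
  obtain ⟨a, x, b, rfl, rfl, hx⟩ : ∃ a x b : List Bool, p = a ++ x ++ b ∧ a.length = i ∧
      x.length = n := by
    refine ⟨p.take i, (p.drop i).take n, p.drop (i + n), by simp [← List.drop_drop], ?_, ?_⟩ <;>
      simp [hp] <;> omega
  rw [colours_shift hu hx, colours_shift hv hx]
  simp only [List.mem_map, h x hx]

end SameColours

/-- All colourings of `n` points. -/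
def allColours : ℕ → List (List Bool)
  | 0 => [[]]
  | n + 1 => (allColours n).flatMap fun p => [true :: p, false :: p]

theorem mem_allColours (p : List Bool) : p ∈ allColours p.length := by
  induction p with
  | nil => simp [allColours]
  | cons a p ih =>
    simp only [List.length_cons, allColours, List.mem_flatMap]
    exact ⟨p, ih, by cases a <;> simp⟩

/-- A test for `SameColours`. -/
def sameColours (n : ℕ) (u v : Word TangleGen) : Bool :=
  (allColours n).all fun p =>
    (colours u p).all (fun q => (colours v p).contains q) &&
      (colours v p).all (fun q => (colours u p).contains q)

theorem SameColours.of_test {n : ℕ} {u v : Word TangleGen} (h : sameColours n u v = true) :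
    SameColours n u v := by
  rintro p rfl q
  simp only [sameColours, List.all_eq_true, Bool.and_eq_true, List.contains_iff_mem] at h
  have := h p (mem_allColours p)
  exact ⟨this.1 q, this.2 q⟩

instance Typed.instDecidable {G : Type} [Signature G] :
    ∀ (n : ℕ) (w : Word G) (m : ℕ), Decidable (Typed n w m)
  | n, [], m => inferInstanceAs (Decidable (n = m))
  | n, s :: w, m =>
    have := Typed.instDecidable s.cod w m
    inferInstanceAs (Decidable (n = s.dom ∧ Typed s.cod w m))

theorem SameColours.interchange (g h : TangleGen) (a : ℕ) :
    SameColours (src g + a + src h) [⟨0, g, a + src h⟩, ⟨tgt g + a, h, 0⟩]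
      [⟨src g + a, h, 0⟩, ⟨0, g, a + tgt h⟩] := by
  intro p hp q
  obtain ⟨x, y, z, rfl, hx, rfl, hz⟩ : ∃ x y z : List Bool, p = x ++ y ++ z ∧ x.length = src g ∧
      y.length = a ∧ z.length = src h := by
    refine ⟨p.take (src g), (p.drop (src g)).take a, p.drop (src g + a),
      by simp [← List.drop_drop], ?_, ?_, ?_⟩ <;> simp [hp] <;> omega
  have h1 : ∀ j, sliceColours ⟨0, g, j⟩ (x ++ y ++ z) =
      (genColours g x).map fun o => o ++ y ++ z := fun j => by
    simpa using sliceColours_append (A := []) (B := y ++ z) (j := j) hx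
  have h2 : sliceColours ⟨src g + y.length, h, 0⟩ (x ++ y ++ z) =
      (genColours h z).map fun o => x ++ y ++ o := by
    simpa [hx] using sliceColours_append (A := x ++ y) (B := []) (j := 0) hz
  have h3 : ∀ o ∈ genColours g x, sliceColours ⟨tgt g + y.length, h, 0⟩ (o ++ y ++ z) =
      (genColours h z).map fun o' => o ++ y ++ o' := fun o ho => by
    simpa [length_of_mem_genColours ho] using
      sliceColours_append (A := o ++ y) (B := []) (j := 0) hz
  have h4 : ∀ (o' : List Bool) j, sliceColours ⟨0, g, j⟩ (x ++ y ++ o') =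
      (genColours g x).map fun o => o ++ y ++ o' := fun o' j => by
    simpa using sliceColours_append (A := []) (B := y ++ o') (j := j) hx
  simp only [colours, h1, h2, List.flatMap_map, h4, List.mem_flatMap, List.mem_map,
    List.flatMap_singleton']
  constructor
  · rintro ⟨o, ho, hr⟩
    rw [h3 o ho] at hr
    obtain ⟨o', ho', rfl⟩ := List.mem_map.1 hr
    exact ⟨o', ho', o, ho, rfl⟩
  · rintro ⟨o', ho', o, ho, rfl⟩
    exact ⟨o, ho, by rw [h3 o ho]; exact List.mem_map_of_mem ho'⟩

/-- Isotopic tangles connect their end points in the same way. -/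
theorem isIsotopyCong_sameColours :
    IsIsotopyCong fun n m u v => Typed n u m ∧ Typed n v m ∧ SameColours n u v where
  refl n m u h := ⟨h, h, .refl n u⟩
  symm _ _ _ _ h := ⟨h.2.1, h.1, h.2.2.symm⟩
  trans _ _ _ _ _ h h' := ⟨h.1, h'.2.1, h.2.2.trans h'.2.2⟩
  comp _ _ _ _ _ _ _ h h' :=
    ⟨h.1.append h'.1, h.2.1.append h'.2.1, .append h.1 h.2.2 h'.2.2⟩
  whisker i j _ _ _ _ h := ⟨h.1.shift i j, h.2.1.shift i j, .shift h.1 h.2.1 h.2.2 i j⟩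
  interchange g h a := by
    refine ⟨?_, ?_, SameColours.interchange g h a⟩ <;>
      simp only [Typed, Slice.dom, Slice.cod] <;> omega
  cross_crossInv := ⟨by decide, by decide, .of_test (by decide)⟩
  crossInv_cross := ⟨by decide, by decide, .of_test (by decide)⟩
  naturality_left g := by
    cases g <;> exact ⟨by decide, by decide, .of_test (by decide)⟩
  naturality_right g := by
    cases g <;> exact ⟨by decide, by decide, .of_test (by decide)⟩
  zigzag_left := ⟨by decide, by decide, .of_test (by decide)⟩
  zigzag_right := ⟨by decide, by decide, .of_test (by decide)⟩
  reidemeister_one := ⟨by decide, by decide, .of_test (by decide)⟩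

/-- The condition on colourings `α` and `β` of the points above and below a slice to be constant
along its strands. -/
def SliceColouring (s : Slice TangleGen) (α β : ℕ → Bool) : Prop :=
  (∀ i < s.left, α i = β i) ∧
  (∀ i < s.right, α (s.left + src s.gen + i) = β (s.left + tgt s.gen + i)) ∧
  match s.gen with
  | .max => β s.left = β (s.left + 1)
  | .min => α s.left = α (s.left + 1)
  | .pos => α s.left = β (s.left + 1) ∧ α (s.left + 1) = β s.left
  | .neg => α s.left = β (s.left + 1) ∧ α (s.left + 1) = β s.left

/-- `f t i` is the colour of the point number `i` on the line number `t`. -/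
def Colouring : Word TangleGen → (ℕ → ℕ → Bool) → Prop
  | [], _ => True
  | s :: w, f => SliceColouring s (f 0) (f 1) ∧ Colouring w fun t => f (t + 1)

theorem colouring_iff {w : Word TangleGen} {f : ℕ → ℕ → Bool} :
    Colouring w f ↔ ∀ t s, w[t]? = some s → SliceColouring s (f t) (f (t + 1)) := by
  induction w generalizing f with
  | nil => simp [Colouring]
  | cons s w ih =>
    simp only [Colouring, ih]
    constructor
    · rintro ⟨h, h'⟩ (_ | t) x hx
      · simp only [List.length_cons, Nat.zero_lt_succ, List.getElem?_eq_getElem,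
          List.getElem_cons_zero, Option.some.injEq] at hx
        subst hx; exact h
      · exact h' t x (by simpa using hx)
    · intro h
      exact ⟨h 0 s rfl, fun t x hx => h (t + 1) x (by simpa using hx)⟩

theorem sliceColouring_iff {s : Slice TangleGen} {t : ℕ} {f : ℕ → ℕ → Bool} :
    SliceColouring s (f t) (f (t + 1)) ↔ ∀ p q, Joins t s p q → f p.1 p.2 = f q.1 q.2 := by
  obtain ⟨l, g, r⟩ := s
  constructor
  · rintro ⟨h1, h2, h3⟩ p q (⟨i, hi, rfl, rfl⟩ | ⟨i, hi, rfl, rfl⟩ | h)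
    · exact h1 i hi
    · exact h2 i hi
    · cases g
      · obtain ⟨rfl, rfl⟩ := h; exact h3
      · obtain ⟨rfl, rfl⟩ := h; exact h3
      · rcases h with ⟨rfl, rfl⟩ | ⟨rfl, rfl⟩
        · exact h3.1
        · exact h3.2
      · rcases h with ⟨rfl, rfl⟩ | ⟨rfl, rfl⟩
        · exact h3.1
        · exact h3.2
  · intro h
    refine ⟨fun i hi => h (t, i) (t + 1, i) (.inl ⟨i, hi, rfl, rfl⟩),
      fun i hi => h (t, _) (t + 1, _) (.inr (.inl ⟨i, hi, rfl, rfl⟩)), ?_⟩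
    cases g
    · exact h (t + 1, l) (t + 1, l + 1) (.inr (.inr ⟨rfl, rfl⟩))
    · exact h (t, l) (t, l + 1) (.inr (.inr ⟨rfl, rfl⟩))
    · exact ⟨h (t, l) (t + 1, l + 1) (.inr (.inr (.inl ⟨rfl, rfl⟩))),
        h (t, l + 1) (t + 1, l) (.inr (.inr (.inr ⟨rfl, rfl⟩)))⟩
    · exact ⟨h (t, l) (t + 1, l + 1) (.inr (.inr (.inl ⟨rfl, rfl⟩))),
        h (t, l + 1) (t + 1, l) (.inr (.inr (.inr ⟨rfl, rfl⟩)))⟩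

/-- Two points lie on the same component if and only if all colourings agree on them. -/
theorem connected_iff_colouring {w : Word TangleGen} {p q : ℕ × ℕ} :
    Connected w p q ↔ ∀ f, Colouring w f → f p.1 p.2 = f q.1 q.2 := by
  constructor
  · intro h f hf
    rw [colouring_iff] at hf
    induction h with
    | rel p q h => obtain ⟨t, s, h, h'⟩ := h; exact sliceColouring_iff.1 (hf t s h) p q h'
    | refl p => rfl
    | symm p q _ ih => exact ih.symm
    | trans p q r _ _ ih ih' => exact ih.trans ih'
  · intro h
    classical
    have hf : Colouring w fun t i => decide (Connected w p (t, i)) := by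
      rw [colouring_iff]
      intro t s hs
      refine (sliceColouring_iff (f := fun t i => decide (Connected w p (t, i)))).2
        fun a b hab => ?_
      have hab := Connected.of_joins hs hab
      exact decide_eq_decide.2 ⟨fun h => Connected.trans h hab,
        fun h => Connected.trans h hab.symm⟩
    have := h _ hf
    simpa [Connected.refl] using this

/-- The colours of the first `n` points. -/
def row (n : ℕ) (α : ℕ → Bool) : List Bool := (List.range n).map α

theorem row_add (n m : ℕ) (α : ℕ → Bool) :
    row (n + m) α = row n α ++ row m fun i => α (n + i) := by
  simp [row, List.range_add]

theorem length_row (n : ℕ) (α : ℕ → Bool) : (row n α).length = n := by simp [row]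

theorem row_congr {n : ℕ} {α β : ℕ → Bool} (h : ∀ i < n, α i = β i) : row n α = row n β :=
  List.map_congr_left fun i hi => h i (List.mem_range.1 hi)

theorem row_mem_sliceColours {s : Slice TangleGen} {α β : ℕ → Bool} (h : SliceColouring s α β) :
    row s.cod β ∈ sliceColours s (row s.dom α) := by
  rw [mem_sliceColours (length_row _ _)]
  obtain ⟨l, g, r⟩ := s
  obtain ⟨h1, h2, h3⟩ := h
  simp only at h1 h2 h3
  refine ⟨_, _, row (tgt g) fun i => β (l + i), _, by rw [Slice.dom, row_add, row_add], ?_,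
    length_row _ _, length_row _ _, length_row _ _, ?_⟩
  · rw [Slice.cod, row_add, row_add, row_congr h1, row_congr h2]
  · cases g
    · simp only [row, tgt, genColours]
      cases hb : β l <;> simp [List.range_succ, hb, ← h3]
    · simp [row, src, tgt, genColours, List.range_succ, h3]
    · simp [row, src, tgt, genColours, List.range_succ, h3.1, h3.2]
    · simp [row, src, tgt, genColours, List.range_succ, h3.1, h3.2]

theorem row_mem_colours {n m : ℕ} {w : Word TangleGen} (hw : Typed n w m) {f : ℕ → ℕ → Bool}
    (hf : Colouring w f) : row m (f w.length) ∈ colours w (row n (f 0)) := by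
  induction w generalizing n f with
  | nil => cases hw; simp [colours]
  | cons s w ih =>
    obtain ⟨rfl, hw⟩ := hw
    exact List.mem_flatMap.2 ⟨_, row_mem_sliceColours hf.1, ih hw hf.2⟩

/-- The colour of the point number `i` (`false` if there is none). -/
def colourAt (p : List Bool) (i : ℕ) : Bool := p.getD i false

theorem sliceColouring_of_mem {s : Slice TangleGen} {p q : List Bool} (hp : p.length = s.dom)
    (h : q ∈ sliceColours s p) : SliceColouring s (colourAt p) (colourAt q) := by
  obtain ⟨A, x, o, B, rfl, rfl, hA, hx, hB, ho⟩ := (mem_sliceColours hp).1 h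
  have ho' := length_of_mem_genColours ho
  obtain ⟨l, g, r⟩ := s
  simp only at hA hx hB ho ho'
  subst hA hB
  have e1 : ∀ (y C : List Bool) (i : ℕ), i < A.length →
      colourAt (A ++ y ++ C) i = colourAt A i := by
    intro y C i hi
    simp [colourAt, List.getD_eq_getElem?_getD, List.getElem?_append, hi]
  have e2 : ∀ (y : List Bool) (i : ℕ),
      colourAt (A ++ y ++ B) (A.length + y.length + i) = colourAt B i := by
    intro y i
    rw [colourAt, List.getD_eq_getElem?_getD, List.getElem?_append_right (by simp)]
    simp [colourAt]
  have e3 : ∀ (y : List Bool) (i : ℕ), i < y.length →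
      colourAt (A ++ y ++ B) (A.length + i) = colourAt y i := by
    intro y i hi
    rw [colourAt, List.getD_eq_getElem?_getD, List.getElem?_append_left (by simp; omega),
      List.getElem?_append_right (by omega)]
    simp [colourAt]
  refine ⟨fun i hi => by rw [e1 _ _ _ hi, e1 _ _ _ hi], fun i hi => ?_, ?_⟩
  · simp only
    rw [← hx, ← ho', e2, e2]
  · have e0 : ∀ y : List Bool, 0 < y.length → colourAt (A ++ y ++ B) A.length = colourAt y 0 :=
      fun y hy => e3 y 0 hy
    cases g
    · have h : o.length = 2 := ho'
      simp only
      rw [e0 o (by omega), e3 o 1 (by omega)]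
      simp only [genColours, List.mem_cons, List.not_mem_nil, or_false] at ho
      rcases ho with rfl | rfl <;> rfl
    · have h : x.length = 2 := hx
      obtain ⟨a, b, rfl⟩ := List.length_eq_two.1 h
      simp only
      rw [e0 _ (by simp), e3 _ 1 (by simp)]
      simp only [genColours] at ho
      split at ho
      · subst a; rfl
      · simp at ho
    all_goals
      have h : x.length = 2 := hx
      obtain ⟨a, b, rfl⟩ := List.length_eq_two.1 h
      simp only [genColours, List.mem_singleton] at ho
      subst ho
      simp only
      rw [e0 _ (by simp), e3 _ 1 (by simp), e0 _ (by simp), e3 _ 1 (by simp)]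
      exact ⟨rfl, rfl⟩

theorem exists_colouring {n m : ℕ} {w : Word TangleGen} (hw : Typed n w m) {p q : List Bool}
    (hp : p.length = n) (h : q ∈ colours w p) :
    ∃ f, Colouring w f ∧ f 0 = colourAt p ∧ f w.length = colourAt q := by
  induction w generalizing n p with
  | nil =>
    simp only [colours, List.mem_singleton] at h
    exact ⟨fun _ => colourAt p, trivial, rfl, by rw [h]⟩
  | cons s w ih =>
    obtain ⟨rfl, hw⟩ := hw
    obtain ⟨x, hx, h⟩ := List.mem_flatMap.1 h
    obtain ⟨f, hf, h0, h1⟩ := ih hw (length_of_mem_sliceColours hp hx) h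
    refine ⟨fun t => Nat.casesOn t (colourAt p) f, ⟨?_, hf⟩, rfl, h1⟩
    change SliceColouring s (colourAt p) (f 0)
    rw [h0]
    exact sliceColouring_of_mem hp hx

theorem colourAt_row {n i : ℕ} (hi : i < n) (α : ℕ → Bool) : colourAt (row n α) i = α i := by
  simp [colourAt, row, hi]

/-- The end points of a diagram: `(true, i)` is the `i`-th upper and `(false, i)` the `i`-th lower
one. -/
def endPoint (w : Word TangleGen) (e : Bool × ℕ) : ℕ × ℕ := (if e.1 then 0 else w.length, e.2)

theorem SameColours.connected {n m : ℕ} {u v : Word TangleGen} (hu : Typed n u m)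
    (hv : Typed n v m) (h : SameColours n u v) {a b : Bool × ℕ} (ha : a.2 < if a.1 then n else m)
    (hb : b.2 < if b.1 then n else m) (hc : Connected u (endPoint u a) (endPoint u b)) :
    Connected v (endPoint v a) (endPoint v b) := by
  rw [connected_iff_colouring] at hc ⊢
  intro f hf
  obtain ⟨f', hf', h0, h1⟩ := exists_colouring hu (length_row _ _)
    ((h _ (length_row _ _) _).2 (row_mem_colours hv hf))
  have key : ∀ e : Bool × ℕ, (e.2 < if e.1 then n else m) →
      f' (endPoint u e).1 (endPoint u e).2 = f (endPoint v e).1 (endPoint v e).2 := by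
    rintro ⟨_ | _, i⟩ hi
    · simp only [endPoint, Bool.false_eq_true, if_false] at hi ⊢
      rw [h1, colourAt_row hi]
    · simp only [endPoint, if_true] at hi ⊢
      rw [h0, colourAt_row hi]
  rw [← key a ha, ← key b hb]
  exact hc f' hf'

/-- Admissibility only depends on how the end points are connected. -/
theorem Admissible.of_sameColours {k l : ℕ} {u v : Word TangleGen} (hu : Admissible k l u)
    (hv : Typed (2 * k) v (2 * l)) (h : SameColours (2 * k) u v) : Admissible k l v := by
  have key := fun a b => h.connected hu.typed hv (a := a) (b := b)
  have thr : ∀ i < k, ∀ j < l, ThroughStrand u i j → ThroughStrand v i j := by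
    intro i hi j hj ht
    refine ht.imp (fun ⟨h1, h2⟩ => ?_) (fun ⟨h1, h2⟩ => ?_)
    · exact ⟨key (true, 2 * i) (false, 2 * j) (by simp; omega) (by simp; omega) h1,
        key (true, 2 * i + 1) (false, 2 * j + 1) (by simp; omega) (by simp; omega) h2⟩
    · exact ⟨key (true, 2 * i) (false, 2 * j + 1) (by simp; omega) (by simp; omega) h1,
        key (true, 2 * i + 1) (false, 2 * j) (by simp; omega) (by simp; omega) h2⟩
  refine ⟨hv, fun i hi => ?_, fun j hj => ?_⟩
  · rcases hu.top i hi with ht | ⟨j, hj, ht⟩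
    · exact .inl (key (true, 2 * i) (true, 2 * i + 1) (by simp; omega) (by simp; omega) ht)
    · exact .inr ⟨j, hj, thr i hi j hj ht⟩
  · rcases hu.bottom j hj with ht | ⟨i, hi, ht⟩
    · exact .inl (key (false, 2 * j) (false, 2 * j + 1) (by simp; omega) (by simp; omega) ht)
    · exact .inr ⟨i, hi, thr i hi j hj ht⟩

/-! ### Local moves -/

/-- The diagrams `u` and `v` with `n` upper and `m` lower ends connect their end points in the same
way, and replacing `u` by `v` anywhere inside an admissible tangle does not change its class in
`Tgl`. The ends of `u` and `v` need not be grouped in pairs. -/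
structure LocalMove (n m : ℕ) (u v : Word TangleGen) : Prop where
  left : Typed n u m
  right : Typed n v m
  sameColours : SameColours n u v
  replace : ∀ (k l i j : ℕ) (A B : Word TangleGen), Typed (2 * k) A (i + n + j) →
    Typed (i + m + j) B (2 * l) → Admissible k l (A ++ shift i j u ++ B) →
    TglRel k l (A ++ shift i j u ++ B) (A ++ shift i j v ++ B)

namespace LocalMove

variable {n m k l : ℕ} {u v w u' v' : Word TangleGen}

theorem admissible_context {k l i j : ℕ} {A B : Word TangleGen} (hu : Typed n u m)
    (hv : Typed n v m) (h : SameColours n u v) (hA : Typed (2 * k) A (i + n + j))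
    (hB : Typed (i + m + j) B (2 * l)) (had : Admissible k l (A ++ shift i j u ++ B)) :
    Admissible k l (A ++ shift i j v ++ B) :=
  had.of_sameColours ((hA.append (hv.shift i j)).append hB)
    (.append (hA.append (hu.shift i j)) (.append hA (.refl _ _) (h.shift hu hv i j)) (.refl _ _))

theorem refl (h : Typed n u m) : LocalMove n m u u :=
  ⟨h, h, .refl _ _, fun _ _ _ _ _ _ _ _ had => tglRel_isMoveCong.refl _ _ _ had⟩

theorem symm (h : LocalMove n m u v) : LocalMove n m v u :=
  ⟨h.right, h.left, h.sameColours.symm, fun _ _ _ _ _ _ hA hB had =>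
    tglRel_isMoveCong.symm _ _ _ _ (h.replace _ _ _ _ _ _ hA hB
      (admissible_context h.right h.left h.sameColours.symm hA hB had))⟩

theorem trans (h : LocalMove n m u v) (h' : LocalMove n m v w) : LocalMove n m u w :=
  ⟨h.left, h'.right, h.sameColours.trans h'.sameColours, fun _ _ _ _ _ _ hA hB had =>
    tglRel_isMoveCong.trans _ _ _ _ _ (h.replace _ _ _ _ _ _ hA hB had)
      (h'.replace _ _ _ _ _ _ hA hB
        (admissible_context h.left h.right h.sameColours hA hB had))⟩

theorem comp_right (h : LocalMove n m u u') (hv : Typed m v k) :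
    LocalMove n k (u ++ v) (u' ++ v) where
  left := h.left.append hv
  right := h.right.append hv
  sameColours := .append h.left h.sameColours (.refl _ _)
  replace a b i j A B hA hB had := by
    have := h.replace a b i j A (shift i j v ++ B) hA ((hv.shift i j).append hB)
      (by simpa using had)
    simpa using this

theorem comp_left (hu : Typed n u m) (h : LocalMove m k v v') :
    LocalMove n k (u ++ v) (u ++ v') where
  left := hu.append h.left
  right := hu.append h.right
  sameColours := .append hu (.refl _ _) h.sameColours
  replace a b i j A B hA hB had := by
    have := h.replace a b i j (A ++ shift i j u) B (hA.append (hu.shift i j)) hB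
      (by simpa using had)
    simpa using this

theorem whisker (i j : ℕ) (h : LocalMove n m u v) :
    LocalMove (i + n + j) (i + m + j) (shift i j u) (shift i j v) where
  left := h.left.shift i j
  right := h.right.shift i j
  sameColours := h.sameColours.shift h.left h.right i j
  replace a b i' j' A B hA hB had := by
    have := h.replace a b (i' + i) (j' + j) A B (hA.cast rfl (by omega))
      (hB.cast (by omega) rfl) (by simpa using had)
    simpa using this

theorem of_isotopic (h : Isotopic n m u v) : LocalMove n m u v := by
  obtain ⟨hu, hv, hc⟩ := h _ isIsotopyCong_sameColours
  refine ⟨hu, hv, hc, fun k l i j A B hA hB had => ?_⟩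
  have hI := isotopic_isIsotopyCong.toIsBraidedCong
  exact tglRel_isMoveCong.isotopy _ _ _ _ had (admissible_context hu hv hc hA hB had)
    (hI.comp_right (hI.comp_left hA (hI.whisker i j _ _ _ _ h)) hB)

/-- A local move between the diagrams of two admissible tangles. -/
theorem tglRel (h : LocalMove (2 * k) (2 * l) u v) (hu : Admissible k l u) : TglRel k l u v := by
  have := h.replace k l 0 0 [] [] (by simp [Typed]) (by simp [Typed]) (by simpa using hu)
  simpa using this

theorem admissible (h : LocalMove (2 * k) (2 * l) u v) (hu : Admissible k l u) :
    Admissible k l v := hu.of_sameColours h.right h.sameColours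

theorem isIsotopyCong : IsIsotopyCong LocalMove where
  refl _ _ _ h := .refl h
  symm _ _ _ _ h := h.symm
  trans _ _ _ _ _ h h' := h.trans h'
  comp _ _ _ _ _ _ _ h h' := (h.comp_right h'.left).trans (.comp_left h.right h')
  whisker i j _ _ _ _ h := h.whisker i j
  interchange g h a := of_isotopic (isotopic_isIsotopyCong.interchange g h a)
  cross_crossInv := of_isotopic isotopic_isIsotopyCong.cross_crossInv
  crossInv_cross := of_isotopic isotopic_isIsotopyCong.crossInv_cross
  naturality_left g := of_isotopic (isotopic_isIsotopyCong.naturality_left g)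
  naturality_right g := of_isotopic (isotopic_isIsotopyCong.naturality_right g)
  zigzag_left := of_isotopic isotopic_isIsotopyCong.zigzag_left
  zigzag_right := of_isotopic isotopic_isIsotopyCong.zigzag_right
  reidemeister_one := of_isotopic isotopic_isIsotopyCong.reidemeister_one

end LocalMove

/-! ### Sliding over a closed component inside a diagram -/

/-- The elementary piece with unmarked strands. -/
def unmarkedGen : TangleGen → MarkedGen
  | .max => .max false
  | .min => .min false
  | .pos => .pos false false
  | .neg => .neg false false

/-- A diagram with unmarked strands. -/
def unmarked (w : Word TangleGen) : List MarkedSlice :=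
  w.map fun s => ⟨List.replicate s.left false, unmarkedGen s.gen, List.replicate s.right false⟩

/-- Juxtapose `i` unmarked vertical strands on the left and `j` on the right. -/
def markedShift (i j : ℕ) (w : List MarkedSlice) : List MarkedSlice :=
  w.map fun s => ⟨List.replicate i false ++ s.left, s.gen, s.right ++ List.replicate j false⟩

theorem doubledWidth_append (p q : List Bool) :
    doubledWidth (p ++ q) = doubledWidth p + doubledWidth q := by simp [doubledWidth]

theorem doubledWidth_replicate (n : ℕ) : doubledWidth (List.replicate n false) = n := by
  simp [doubledWidth, MarkedGen.mult]

theorem forget_unmarked (w : Word TangleGen) : forgetMarks (unmarked w) = w := by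
  induction w with
  | nil => rfl
  | cons s w ih =>
    obtain ⟨l, g, r⟩ := s
    have : forgetMarks (unmarked w) = w := ih
    simp only [forgetMarks, unmarked, List.map_cons, List.map_map] at this ⊢
    rw [this]
    cases g <;> simp [MarkedSlice.forget, MarkedGen.forget, unmarkedGen]

theorem double_unmarkedGen (g : TangleGen) : (unmarkedGen g).double = [⟨0, g, 0⟩] := by
  cases g <;> rfl

theorem double_unmarked (w : Word TangleGen) : doubleMarked (unmarked w) = w := by
  induction w with
  | nil => rfl
  | cons s w ih =>
    have : doubleMarked (unmarked w) = w := ih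
    simp only [doubleMarked, unmarked, List.map_cons, List.flatMap_cons] at this ⊢
    rw [this]
    simp [MarkedSlice.double, double_unmarkedGen, doubledWidth_replicate]

theorem typed_unmarked {n m : ℕ} {w : Word TangleGen} (h : Typed n w m) :
    MarkedTyped (List.replicate n false) (unmarked w) (List.replicate m false) := by
  induction w generalizing n with
  | nil => cases h; rfl
  | cons s w ih =>
    obtain ⟨rfl, h⟩ := h
    obtain ⟨l, g, r⟩ := s
    have hs : (unmarkedGen g).src = List.replicate (src g) false := by cases g <;> rfl
    have ht : (unmarkedGen g).tgt = List.replicate (tgt g) false := by cases g <;> rfl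
    refine ⟨?_, ?_⟩
    · simp [MarkedSlice.dom, Slice.dom, hs]
    · have := ih h
      simp only [MarkedSlice.cod, ht, List.replicate_append_replicate]
      exact this

theorem forget_markedShift (i j : ℕ) (w : List MarkedSlice) :
    forgetMarks (markedShift i j w) = shift i j (forgetMarks w) := by
  simp [forgetMarks, markedShift, shift, MarkedSlice.forget, Function.comp_def]

theorem double_markedShift (i j : ℕ) (w : List MarkedSlice) :
    doubleMarked (markedShift i j w) = shift i j (doubleMarked w) := by
  induction w with
  | nil => rfl
  | cons s w ih =>
    have ih : doubleMarked (markedShift i j w) = shift i j (doubleMarked w) := ih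
    simp only [doubleMarked, markedShift, List.map_cons, List.flatMap_cons, shift_append]
      at ih ⊢
    rw [ih]
    simp [MarkedSlice.double, doubledWidth_append, doubledWidth_replicate, Nat.add_comm j]

theorem typed_markedShift {p q : List Bool} {w : List MarkedSlice} (i j : ℕ)
    (h : MarkedTyped p w q) :
    MarkedTyped (List.replicate i false ++ p ++ List.replicate j false) (markedShift i j w)
      (List.replicate i false ++ q ++ List.replicate j false) := by
  induction w generalizing p with
  | nil => cases h; rfl
  | cons s w ih =>
    obtain ⟨rfl, h⟩ := h
    refine ⟨by simp [MarkedSlice.dom], ?_⟩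
    have := ih h
    simpa [MarkedSlice.cod, markedShift] using this

theorem MarkedTyped.append {p q r : List Bool} {u v : List MarkedSlice} (hu : MarkedTyped p u q)
    (hv : MarkedTyped q v r) : MarkedTyped p (u ++ v) r := by
  induction u generalizing p with
  | nil => cases hu; exact hv
  | cons s u ih => exact ⟨hu.1, ih hu.2⟩

theorem MarkedTyped.cast {p q p' q' : List Bool} {u : List MarkedSlice} (hu : MarkedTyped p u q)
    (hp : p = p') (hq : q = q') : MarkedTyped p' u q' := by subst hp hq; exact hu

theorem forgetMarks_append (u v : List MarkedSlice) :
    forgetMarks (u ++ v) = forgetMarks u ++ forgetMarks v := List.map_append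

theorem doubleMarked_append (u v : List MarkedSlice) :
    doubleMarked (u ++ v) = doubleMarked u ++ doubleMarked v := List.flatMap_append

theorem MarkedTyped.typed {p q : List Bool} {u : List MarkedSlice} (h : MarkedTyped p u q) :
    Typed p.length (forgetMarks u) q.length := by
  induction u generalizing p with
  | nil => cases h; rfl
  | cons s u ih =>
    obtain ⟨rfl, h⟩ := h
    have := ih h
    refine ⟨?_, this.cast ?_ rfl⟩ <;>
    · simp only [MarkedSlice.forget, MarkedSlice.dom, MarkedSlice.cod, Slice.dom, Slice.cod,
        List.length_append]
      cases s.gen <;> rfl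

theorem not_markedPoint_unmarked {w : Word TangleGen} {p : ℕ × ℕ} :
    ¬ MarkedPoint (unmarked w) p := by
  rintro ⟨s, hs, h⟩
  simp only [unmarked, List.getElem?_map, Option.map_eq_some_iff] at hs
  obtain ⟨⟨l, g, r⟩, -, rfl⟩ := hs
  have : (unmarkedGen g).src = List.replicate (src g) false := by cases g <;> rfl
  simp only [MarkedSlice.dom, this, List.replicate_append_replicate] at h
  have := List.mem_of_getElem? h
  simp at this

/-- In a diagram with marked strands placed between unmarked ones, marked points come from the
inner diagram. -/
theorem MarkedPoint.of_context {A B : Word TangleGen} {w : List MarkedSlice} {i j : ℕ}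
    {p : ℕ × ℕ} (h : MarkedPoint (unmarked A ++ markedShift i j w ++ unmarked B) p) :
    ∃ q, MarkedPoint w q ∧ p = (A.length + q.1, i + q.2) := by
  obtain ⟨t, x⟩ := p
  obtain ⟨s, hs, hx⟩ := h
  simp only at hs hx
  rw [List.append_assoc] at hs
  have hA : (unmarked A).length = A.length := by simp [unmarked]
  have hW : (markedShift i j w).length = w.length := by simp [markedShift]
  rcases Nat.lt_or_ge t A.length with h1 | h1
  · rw [List.getElem?_append_left (by omega)] at hs
    exact absurd ⟨s, hs, hx⟩ (not_markedPoint_unmarked (p := (t, x)))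
  obtain ⟨t, rfl⟩ := Nat.exists_eq_add_of_le h1
  rw [List.getElem?_append_right (by omega), hA, Nat.add_sub_cancel_left] at hs
  rcases Nat.lt_or_ge t w.length with h2 | h2
  · rw [List.getElem?_append_left (by omega)] at hs
    simp only [markedShift, List.getElem?_map, Option.map_eq_some_iff] at hs
    obtain ⟨s, hs, rfl⟩ := hs
    simp only [MarkedSlice.dom, List.append_assoc] at hx
    rcases Nat.lt_or_ge x i with h3 | h3
    · rw [List.getElem?_append_left (by simpa using h3)] at hx
      have := List.mem_of_getElem? hx
      simp at this
    obtain ⟨x, rfl⟩ := Nat.exists_eq_add_of_le h3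
    rw [List.getElem?_append_right (by simp)] at hx
    simp only [List.length_replicate, Nat.add_sub_cancel_left, ← List.append_assoc] at hx
    refine ⟨(t, x), ⟨s, hs, ?_⟩, rfl⟩
    rcases Nat.lt_or_ge x s.dom.length with h4 | h4
    · rwa [List.getElem?_append_left (by simpa [MarkedSlice.dom] using h4)] at hx
    · rw [List.getElem?_append_right (by simpa [MarkedSlice.dom] using h4)] at hx
      have := List.mem_of_getElem? hx
      simp at this
  · rw [List.getElem?_append_right (by omega), hW] at hs
    exact absurd ⟨s, hs, hx⟩ (not_markedPoint_unmarked (p := (t - w.length, x)))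

theorem marksOneComponent_context {A B : Word TangleGen} {w : List MarkedSlice} {i j : ℕ}
    (h : MarksOneComponent w) :
    MarksOneComponent (unmarked A ++ markedShift i j w ++ unmarked B) := by
  intro p q hp hq
  obtain ⟨p, hp', rfl⟩ := hp.of_context
  obtain ⟨q, hq', rfl⟩ := hq.of_context
  have := ((h p q hp' hq').shift i j).append_right A
  rw [forgetMarks_append, forgetMarks_append, forget_unmarked, forget_unmarked,
    forget_markedShift]
  exact this.append_left B

/-- A strand may be slid over a closed component contained in a part of a diagram. -/
theorem LocalMove.slide {n m : ℕ} {p q : List Bool} {u v : List MarkedSlice}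
    (hu : MarkedTyped (List.replicate n false) u (p ++ [false, true] ++ q))
    (hv : MarkedTyped (p ++ [false, true] ++ q) v (List.replicate m false))
    (hone : MarksOneComponent (u ++ v))
    (hD : Typed n (doubleMarked u ++
      shift (doubledWidth p) (doubledWidth q) [⟨0, .min, 1⟩, ⟨0, .max, 1⟩] ++ doubleMarked v) m)
    (hc : SameColours n (forgetMarks (u ++ v)) (doubleMarked u ++
      shift (doubledWidth p) (doubledWidth q) [⟨0, .min, 1⟩, ⟨0, .max, 1⟩] ++ doubleMarked v)) :
    LocalMove n m (forgetMarks (u ++ v)) (doubleMarked u ++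
      shift (doubledWidth p) (doubledWidth q) [⟨0, .min, 1⟩, ⟨0, .max, 1⟩] ++
        doubleMarked v) := by
  have ht : Typed n (forgetMarks (u ++ v)) m := by simpa using (hu.append hv).typed
  refine ⟨ht, hD, hc, fun k l i j A B hA hB had => ?_⟩
  have had' := admissible_context ht hD hc hA hB had
  have e1 : A ++ shift i j (forgetMarks (u ++ v)) ++ B =
      forgetMarks ((unmarked A ++ markedShift i j u) ++ (markedShift i j v ++ unmarked B)) := by
    simp [forgetMarks_append, forget_unmarked, forget_markedShift]
  have e2 : A ++ shift i j (doubleMarked u ++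
      shift (doubledWidth p) (doubledWidth q) [⟨0, .min, 1⟩, ⟨0, .max, 1⟩] ++ doubleMarked v) ++ B =
      doubleMarked (unmarked A ++ markedShift i j u) ++
        shift (doubledWidth (List.replicate i false ++ p))
          (doubledWidth (q ++ List.replicate j false)) [⟨0, .min, 1⟩, ⟨0, .max, 1⟩] ++
        doubleMarked (markedShift i j v ++ unmarked B) := by
    simp only [doubleMarked_append, double_unmarked, double_markedShift, doubledWidth_append,
      doubledWidth_replicate, shift_append, shift_shift, List.append_assoc, Nat.add_comm j]
  rw [e1] at had ⊢
  rw [e2] at had' ⊢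
  refine tglRel_isMoveCong.slide k l _ _ _ _ ?_ ?_ ?_ had had'
  · refine (typed_unmarked hA).append ((typed_markedShift i j hu).cast ?_ ?_) <;> simp
  · refine ((typed_markedShift i j hv).cast ?_ ?_).append (typed_unmarked hB) <;> simp
  · have : unmarked A ++ markedShift i j u ++ (markedShift i j v ++ unmarked B) =
        unmarked A ++ markedShift i j (u ++ v) ++ unmarked B := by simp [markedShift]
    rw [this]
    exact marksOneComponent_context hone

/-! ### Recognizing that marked strands form one component -/

/-- All marked points have the given colour. -/
def marksColoured (marks colours : List Bool) (c : Bool) : Bool :=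
  (marks.zip colours).all fun x => !x.1 || x.2 == c

/-- In every colouring extending `p`, either all marked points have the colour `true` (and `a`
holds) or all of them have the colour `false` (and `b` holds). -/
def marksMonochromatic : List MarkedSlice → List Bool → Bool → Bool → Bool
  | [], _, a, b => a || b
  | s :: w, p, a, b => (sliceColours s.forget p).all fun q =>
      marksMonochromatic w q (a && marksColoured s.dom p true) (b && marksColoured s.dom p false)

theorem of_marksColoured {n i : ℕ} {marks : List Bool} (hn : marks.length = n) {α : ℕ → Bool}
    {c : Bool} (h : marksColoured marks (row n α) c = true) (hi : marks[i]? = some true) :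
    α i = c := by
  simp only [marksColoured, List.all_eq_true] at h
  have hlt : i < marks.length := (List.getElem?_eq_some_iff.1 hi).1
  have := h (true, α i) (List.mem_of_getElem? (i := i) (by
    rw [List.getElem?_zip_eq_some]
    exact ⟨hi, by simp [row, ← hn, hlt]⟩))
  simpa using this

theorem MarkedSlice.length_dom (s : MarkedSlice) : s.dom.length = s.forget.dom := by
  simp only [MarkedSlice.forget, MarkedSlice.dom, Slice.dom, List.length_append]
  cases s.gen <;> rfl

theorem MarkedSlice.length_cod (s : MarkedSlice) : s.cod.length = s.forget.cod := by
  simp only [MarkedSlice.forget, MarkedSlice.cod, Slice.cod, List.length_append]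
  cases s.gen <;> rfl

theorem marked_of_monochromatic {p q : List Bool} {w : List MarkedSlice} (hw : MarkedTyped p w q)
    {f : ℕ → ℕ → Bool} (hf : Colouring (forgetMarks w) f) {a b : Bool}
    (h : marksMonochromatic w (row p.length (f 0)) a b = true) :
    ∃ c, (if c then a else b) = true ∧ ∀ x, MarkedPoint w x → f x.1 x.2 = c := by
  induction w generalizing p f a b with
  | nil =>
    simp only [marksMonochromatic, Bool.or_eq_true] at h
    rcases h with h | h
    · exact ⟨true, h, fun x ⟨s, hs, _⟩ => by simp at hs⟩
    · exact ⟨false, h, fun x ⟨s, hs, _⟩ => by simp at hs⟩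
  | cons s w ih =>
    obtain ⟨rfl, hw⟩ := hw
    simp only [marksMonochromatic, List.all_eq_true] at h
    have hmem := row_mem_sliceColours hf.1
    rw [← s.length_dom] at hmem
    have h1 := h _ hmem
    rw [← s.length_cod] at h1
    obtain ⟨c, hc, hx⟩ := ih hw hf.2 h1
    refine ⟨c, by cases c <;> simp_all, ?_⟩
    rintro ⟨_ | t, i⟩ ⟨s', hs', hi⟩
    · simp only [List.length_cons, Nat.zero_lt_succ, List.getElem?_eq_getElem,
        List.getElem_cons_zero, Option.some.injEq] at hs'
      subst hs'
      refine of_marksColoured rfl (c := c) ?_ hi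
      cases c <;> simp_all
    · exact hx (t, i) ⟨s', by simpa using hs', hi⟩

theorem marksOneComponent_of_test {p q : List Bool} {w : List MarkedSlice}
    (hw : MarkedTyped p w q)
    (h : ((allColours p.length).all fun x => marksMonochromatic w x true true) = true) :
    MarksOneComponent w := by
  intro x y hx hy
  rw [connected_iff_colouring]
  intro f hf
  rw [List.all_eq_true] at h
  have h0 := h (row p.length (f 0)) (by
    simpa [length_row] using mem_allColours (row p.length (f 0)))
  obtain ⟨c, -, hc⟩ := marked_of_monochromatic hw hf h0
  rw [hc x hx, hc y hy]

/-! ### Computing with local moves -/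

instance : DecidableEq TangleGen := fun a b =>
  match a, b with
  | .max, .max => isTrue rfl
  | .min, .min => isTrue rfl
  | .pos, .pos => isTrue rfl
  | .neg, .neg => isTrue rfl
  | .max, .min => isFalse nofun
  | .max, .pos => isFalse nofun
  | .max, .neg => isFalse nofun
  | .min, .max => isFalse nofun
  | .min, .pos => isFalse nofun
  | .min, .neg => isFalse nofun
  | .pos, .max => isFalse nofun
  | .pos, .min => isFalse nofun
  | .pos, .neg => isFalse nofun
  | .neg, .max => isFalse nofun
  | .neg, .min => isFalse nofun
  | .neg, .pos => isFalse nofun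

/-- A word of slices without the numbers of vertical strands on their right, which are determined
by the number of upper ends of the diagram. -/
abbrev Bare := List (ℕ × TangleGen)

namespace Bare

/-- The number of lower ends of a diagram with `n` upper ends. -/
def width : ℕ → Bare → ℕ
  | n, [] => n
  | n, s :: w => width (n - src s.2 + tgt s.2) w

/-- The word describes a diagram with `n` upper ends. -/
def fits : ℕ → Bare → Bool
  | _, [] => true
  | n, s :: w => Nat.ble (s.1 + src s.2) n && fits (n - src s.2 + tgt s.2) w

/-- The diagram with `n` upper ends described by a word. -/
def fill : ℕ → Bare → Word TangleGen
  | _, [] => []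
  | n, s :: w => ⟨s.1, s.2, n - s.1 - src s.2⟩ :: fill (n - src s.2 + tgt s.2) w

/-- Forget the numbers of strands on the right. -/
def strip (w : Word TangleGen) : Bare := w.map fun s => (s.left, s.gen)

/-- Juxtapose `i` vertical strands on the left. -/
def shift (i : ℕ) (w : Bare) : Bare := w.map fun s => (i + s.1, s.2)

variable {n a i : ℕ} {u v w : Bare}

theorem width_append : width n (u ++ v) = width (width n u) v := by
  induction u generalizing n with
  | nil => rfl
  | cons s u ih => exact ih

theorem fits_append : fits n (u ++ v) = (fits n u && fits (width n u) v) := by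
  induction u generalizing n with
  | nil => rfl
  | cons s u ih => simp only [List.cons_append, fits, width, ih, Bool.and_assoc]

theorem fill_append : fill n (u ++ v) = fill n u ++ fill (width n u) v := by
  induction u generalizing n with
  | nil => rfl
  | cons s u ih => simp only [List.cons_append, fill, width, ih]

theorem fits_cons {s : ℕ × TangleGen} :
    fits n (s :: w) = true ↔ s.1 + src s.2 ≤ n ∧ fits (n - src s.2 + tgt s.2) w = true := by
  simp only [fits, Bool.and_eq_true, Nat.ble_eq]

theorem typed_fill (h : fits n w = true) : Typed n (fill n w) (width n w) := by
  induction w generalizing n with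
  | nil => rfl
  | cons s w ih =>
    rw [fits_cons] at h
    exact ⟨by simp only [Slice.dom]; omega,
      (ih h.2).cast (by simp only [Slice.cod]; omega) rfl⟩

theorem fill_strip {m : ℕ} {w : Word TangleGen} (h : Typed n w m) :
    fits n (strip w) = true ∧ width n (strip w) = m ∧ fill n (strip w) = w := by
  induction w generalizing n with
  | nil => exact ⟨rfl, h, rfl⟩
  | cons s w ih =>
    obtain ⟨rfl, h⟩ := h
    obtain ⟨l, g, r⟩ := s
    have e : Slice.dom ⟨l, g, r⟩ - src g + tgt g = Slice.cod ⟨l, g, r⟩ := by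
      simp only [Slice.dom, Slice.cod]; omega
    obtain ⟨h1, h2, h3⟩ := ih h
    refine ⟨fits_cons.2 ⟨by simp only [Slice.dom]; omega, ?_⟩, ?_, ?_⟩
    · simp only [e]; exact h1
    · change width (Slice.dom ⟨l, g, r⟩ - src g + tgt g) (strip w) = m
      rw [e, h2]
    · change (⟨l, g, Slice.dom ⟨l, g, r⟩ - l - src g⟩ : Slice TangleGen) ::
        fill (Slice.dom ⟨l, g, r⟩ - src g + tgt g) (strip w) = _
      rw [e, h3]
      simp only [Slice.dom, List.cons.injEq, Slice.mk.injEq, true_and, and_true]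
      omega

theorem shift_spec (b : ℕ) (h : fits a w = true) :
    fits (i + a + b) (shift i w) = true ∧ width (i + a + b) (shift i w) = i + width a w + b ∧
      fill (i + a + b) (shift i w) = HopfTangle.shift i b (fill a w) := by
  have := fill_strip ((typed_fill h).shift i b)
  have e : strip (HopfTangle.shift i b (fill a w)) = shift i w := by
    clear this h
    induction w generalizing a with
    | nil => rfl
    | cons s w ih =>
      have : strip (HopfTangle.shift i b (fill (a - src s.2 + tgt s.2) w)) = shift i w := ih
      simp only [strip, shift, fill, shift_cons, List.map_cons] at this ⊢
      rw [this]
  rwa [e] at this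

end Bare

open Bare

/-- Local moves between diagrams with `n` upper ends. -/
structure Moves (n : ℕ) (u v : Bare) : Prop where
  fits_left : fits n u = true
  fits_right : fits n v = true
  width_eq : width n u = width n v
  localMove : LocalMove n (width n u) (fill n u) (fill n v)

namespace Moves

variable {n m a i : ℕ} {u v w A B : Bare}

theorem refl (h : fits n u = true) : Moves n u u := ⟨h, h, rfl, .refl (typed_fill h)⟩

theorem symm (h : Moves n u v) : Moves n v u :=
  ⟨h.fits_right, h.fits_left, h.width_eq.symm, h.width_eq ▸ h.localMove.symm⟩

theorem trans (h : Moves n u v) (h' : Moves n v w) : Moves n u w :=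
  ⟨h.fits_left, h'.fits_right, h.width_eq.trans h'.width_eq,
    h.localMove.trans (h.width_eq ▸ h'.localMove)⟩

theorem append_left (hA : fits n A = true) (h : Moves (width n A) u v) :
    Moves n (A ++ u) (A ++ v) := by
  refine ⟨?_, ?_, ?_, ?_⟩
  · rw [fits_append, hA, h.fits_left]; rfl
  · rw [fits_append, hA, h.fits_right]; rfl
  · rw [width_append, width_append, h.width_eq]
  · rw [fill_append, fill_append, width_append]
    exact .comp_left (typed_fill hA) h.localMove

theorem append_right (h : Moves n u v) (hB : fits (width n u) B = true) :
    Moves n (u ++ B) (v ++ B) := by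
  have hB' := hB
  rw [h.width_eq] at hB'
  refine ⟨?_, ?_, ?_, ?_⟩
  · rw [fits_append, h.fits_left, hB]; rfl
  · rw [fits_append, h.fits_right, hB']; rfl
  · rw [width_append, width_append, h.width_eq]
  · rw [fill_append, fill_append, width_append, ← h.width_eq]
    exact h.localMove.comp_right (typed_fill hB)

theorem shift (h : Moves a u v) (hn : i + a ≤ n) : Moves n (Bare.shift i u) (Bare.shift i v) := by
  obtain ⟨b, rfl⟩ := Nat.exists_eq_add_of_le hn
  obtain ⟨h1, h2, h3⟩ := shift_spec (i := i) b h.fits_left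
  obtain ⟨h4, h5, h6⟩ := shift_spec (i := i) b h.fits_right
  refine ⟨h1, h4, by rw [h2, h5, h.width_eq], ?_⟩
  rw [h2, h3, h6]
  exact h.localMove.whisker i b

theorem of_localMove {u v : Word TangleGen} (h : LocalMove n m u v) :
    Moves n (strip u) (strip v) := by
  obtain ⟨h1, h2, h3⟩ := fill_strip h.left
  obtain ⟨h4, h5, h6⟩ := fill_strip h.right
  refine ⟨h1, h4, h2.trans h5.symm, ?_⟩
  rwa [h2, h3, h6]

theorem interchange {l l' : ℕ} {g g' : TangleGen} (h : fits n [(l, g), (l', g')] = true)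
    (hl : l + tgt g ≤ l') :
    Moves n [(l, g), (l', g')] [(l' - tgt g + src g, g'), (l, g)] := by
  obtain ⟨b, rfl⟩ := Nat.exists_eq_add_of_le hl
  rw [fits_cons, fits_cons] at h
  obtain ⟨h1, h2, -⟩ := h
  simp only at h1 h2
  obtain ⟨c, rfl⟩ : ∃ c, n = l + (src g + b + src g') + c :=
    Nat.exists_eq_add_of_le (by omega)
  have h3 := of_localMove (LocalMove.isIsotopyCong.interchange g g' b)
  have h4 := shift (i := l) (n := l + (src g + b + src g') + c) h3 (by omega)
  simp only [strip, Bare.shift, List.map_cons, List.map_nil] at h4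
  have e1 : l + 0 = l := rfl
  have e2 : l + (tgt g + b) = l + tgt g + b := by omega
  have e3 : l + (src g + b) = l + tgt g + b - tgt g + src g := by omega
  rwa [e1, e2, e3] at h4

end Moves

/-- A local move together with its two diagrams. -/
structure Move where
  n : ℕ
  lhs : Bare
  rhs : Bare
  valid : Moves n lhs rhs

theorem Moves.cons {n : ℕ} {s : ℕ × TangleGen} {u v : Bare} (hs : s.1 + src s.2 ≤ n)
    (h : Moves (n - src s.2 + tgt s.2) u v) : Moves n (s :: u) (s :: v) :=
  Moves.append_left (A := [s]) (fits_cons.2 ⟨hs, rfl⟩) h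

/-- A local move as an element of a table of moves. -/
abbrev Moves.move {n : ℕ} {u v : Bare} (h : Moves n u v) : Move := ⟨n, u, v, h⟩

/-- Interchange two consecutive pieces lying next to each other. If the second one can be regarded
both as lying on the right and on the left of the first one, `d` selects the right. -/
def swapPair (d : Bool) (x y : ℕ × TangleGen) : Option (List (ℕ × TangleGen)) :=
  let right := Nat.ble (x.1 + tgt x.2) y.1
  let left := Nat.ble (y.1 + src y.2) x.1
  if right && (d || !left) then some [(y.1 - tgt x.2 + src x.2, y.2), x]
  else if left then some [y, (x.1 - src y.2 + tgt y.2, x.2)]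
  else none

/-- Interchange the pieces number `k` and `k + 1`. -/
def swapAt (d : Bool) : ℕ → Bare → Option Bare
  | 0, x :: y :: w => (swapPair d x y).map (· ++ w)
  | k + 1, x :: w => (swapAt d k w).map (x :: ·)
  | _, _ => none

/-- Move the piece number `k` up past `b` pieces. -/
def moveUp (d : Bool) : ℕ → ℕ → Bare → Option Bare
  | _, 0, w => some w
  | k, b + 1, w => (swapAt d (k - 1) w).bind (moveUp d (k - 1) b)

/-- Move the piece number `k` down past `b` pieces. -/
def moveDown : ℕ → ℕ → Bare → Option Bare
  | _, 0, w => some w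
  | k, b + 1, w => (swapAt true k w).bind (moveDown (k + 1) b)

/-- Replace an occurrence of `lhs` with `n` upper ends, starting with the piece number `k` and with
`i` strands on its left, by `rhs`. -/
def replaceAt (n : ℕ) (lhs rhs : Bare) (i : ℕ) : ℕ → ℕ → Bare → Option Bare
  | 0, N, w =>
    if Nat.ble (i + n) N && decide (w.take lhs.length = Bare.shift i lhs) then
      some (Bare.shift i rhs ++ w.drop lhs.length)
    else none
  | k + 1, N, x :: w =>
    (replaceAt n lhs rhs i k (N - src x.2 + tgt x.2) w).map (x :: ·)
  | _, _, _ => none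

/-- The steps of a calculation with local moves. -/
inductive Step
  /-- Move the piece number `k` up past `b` pieces. -/
  | up (k b : ℕ)
  /-- The same, with preference for the left. -/
  | upLeft (k b : ℕ)
  /-- Move the piece number `k` down past `b` pieces. -/
  | down (k b : ℕ)
  /-- Apply the move number `r` of a table, starting with the piece number `k`, with `i` strands on
  the left. -/
  | use (r k i : ℕ)
  /-- Apply a move in the opposite direction. -/
  | back (r k i : ℕ)

/-- Perform a step in a diagram with `N` upper ends. -/
def Step.perform (T : List Move) (N : ℕ) (w : Bare) : Step → Option Bare
  | .up k b => moveUp true k b w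
  | .upLeft k b => moveUp false k b w
  | .down k b => moveDown k b w
  | .use r k i => T[r]?.bind fun M => replaceAt M.n M.lhs M.rhs i k N w
  | .back r k i => T[r]?.bind fun M => replaceAt M.n M.rhs M.lhs i k N w

/-- Perform a list of steps in a diagram with `N` upper ends. -/
def perform (T : List Move) (N : ℕ) : List Step → Bare → Option Bare
  | [], w => some w
  | s :: l, w => (s.perform T N w).bind (perform T N l)

/-- The steps lead from `u` to `v`. -/
def leadsTo (T : List Move) (N : ℕ) (l : List Step) (u v : Bare) : Bool :=
  fits N u && decide (perform T N l u = some v)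

namespace Moves

theorem of_swapPair {n : ℕ} {d : Bool} {x y : ℕ × TangleGen} {v : Bare}
    (hf : fits n [x, y] = true) (h : swapPair d x y = some v) : Moves n [x, y] v := by
  simp only [swapPair] at h
  split at h
  · rename_i h'
    simp only [Bool.and_eq_true, Nat.ble_eq] at h'
    obtain rfl := Option.some.inj h
    exact interchange hf h'.1
  · split at h
    · rename_i h'
      rw [Nat.ble_eq] at h'
      obtain rfl := Option.some.inj h
      obtain ⟨l, g⟩ := x
      obtain ⟨l', g'⟩ := y
      simp only at h' ⊢
      rw [fits_cons, fits_cons] at hf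
      obtain ⟨h1, h2, -⟩ := hf
      simp only at h1 h2
      have := interchange (n := n) (l := l') (g := g') (l' := l - src g' + tgt g') (g' := g) (by
        rw [fits_cons, fits_cons]
        refine ⟨?_, ?_, rfl⟩ <;> simp only <;> omega) (by omega)
      have e : l - src g' + tgt g' - tgt g' + src g' = l := by omega
      rw [e] at this
      exact this.symm
    · simp at h

theorem of_swapAt {n k : ℕ} {d : Bool} {u v : Bare} (hf : fits n u = true)
    (h : swapAt d k u = some v) : Moves n u v := by
  induction k generalizing n u v with
  | zero =>
    match u, h with
    | x :: y :: w, h =>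
      simp only [swapAt, Option.map_eq_some_iff] at h
      obtain ⟨z, hz, rfl⟩ := h
      have hf' : (fits n [x, y] && fits (width n [x, y]) w) = true := by
        rw [← fits_append]; exact hf
      rw [Bool.and_eq_true] at hf'
      exact append_right (of_swapPair hf'.1 hz) hf'.2
  | succ k ih =>
    match u, h with
    | x :: w, h =>
      simp only [swapAt, Option.map_eq_some_iff] at h
      obtain ⟨z, hz, rfl⟩ := h
      rw [fits_cons] at hf
      exact .cons hf.1 (ih hf.2 hz)

theorem of_moveUp {n k b : ℕ} {d : Bool} {u v : Bare} (hf : fits n u = true)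
    (h : moveUp d k b u = some v) : Moves n u v := by
  induction b generalizing k u with
  | zero => obtain rfl := Option.some.inj h; exact .refl hf
  | succ b ih =>
    simp only [moveUp, Option.bind_eq_some_iff] at h
    obtain ⟨z, hz, h⟩ := h
    have h1 := of_swapAt hf hz
    exact h1.trans (ih h1.fits_right h)

theorem of_moveDown {n k b : ℕ} {u v : Bare} (hf : fits n u = true)
    (h : moveDown k b u = some v) : Moves n u v := by
  induction b generalizing k u with
  | zero => obtain rfl := Option.some.inj h; exact .refl hf
  | succ b ih =>
    simp only [moveDown, Option.bind_eq_some_iff] at h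
    obtain ⟨z, hz, h⟩ := h
    have h1 := of_swapAt hf hz
    exact h1.trans (ih h1.fits_right h)

theorem of_replaceAt {n i k N : ℕ} {lhs rhs u v : Bare} (hM : Moves n lhs rhs)
    (hf : fits N u = true) (h : replaceAt n lhs rhs i k N u = some v) : Moves N u v := by
  induction k generalizing N u v with
  | zero =>
    simp only [replaceAt] at h
    split at h
    · rename_i h'
      simp only [Bool.and_eq_true, Nat.ble_eq, decide_eq_true_eq] at h'
      obtain rfl := Option.some.inj h
      have h1 := hM.shift h'.1
      rw [← List.take_append_drop lhs.length u, h'.2, fits_append, Bool.and_eq_true] at hf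
      have h2 := h1.append_right hf.2
      rwa [← h'.2, List.take_append_drop] at h2
    · simp at h
  | succ k ih =>
    match u, h with
    | x :: w, h =>
      simp only [replaceAt, Option.map_eq_some_iff] at h
      obtain ⟨z, hz, rfl⟩ := h
      rw [fits_cons] at hf
      exact .cons hf.1 (ih hf.2 hz)

theorem of_step {T : List Move} {N : ℕ} {s : Step} {u v : Bare} (hf : fits N u = true)
    (h : s.perform T N u = some v) : Moves N u v := by
  cases s with
  | up k b => exact of_moveUp hf h
  | upLeft k b => exact of_moveUp hf h
  | down k b => exact of_moveDown hf h
  | use r k i =>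
    simp only [Step.perform, Option.bind_eq_some_iff] at h
    obtain ⟨M, -, h⟩ := h
    exact of_replaceAt M.valid hf h
  | back r k i =>
    simp only [Step.perform, Option.bind_eq_some_iff] at h
    obtain ⟨M, -, h⟩ := h
    exact of_replaceAt M.valid.symm hf h

theorem of_perform {T : List Move} {N : ℕ} {l : List Step} {u v : Bare} (hf : fits N u = true)
    (h : perform T N l u = some v) : Moves N u v := by
  induction l generalizing u with
  | nil => obtain rfl := Option.some.inj h; exact .refl hf
  | cons s l ih =>
    simp only [perform, Option.bind_eq_some_iff] at h
    obtain ⟨z, hz, h⟩ := h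
    have h1 := of_step hf hz
    exact h1.trans (ih h1.fits_right h)

/-- A calculation with the moves of a table. -/
theorem calculate {N : ℕ} {u v : Bare} (T : List Move) (l : List Step)
    (h : leadsTo T N l u v = true) : Moves N u v := by
  simp only [leadsTo, Bool.and_eq_true, decide_eq_true_eq] at h
  exact of_perform h.1 h.2

end Moves

/-! ### Isotopies -/

/-- A maximum whose legs become the strands number `i` and `i + 1`. -/
abbrev cap (i : ℕ) : ℕ × TangleGen := (i, .max)

/-- A minimum joining the strands number `i` and `i + 1`. -/
abbrev cup (i : ℕ) : ℕ × TangleGen := (i, .min)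

/-- The positive crossing of the strands number `i` and `i + 1`. -/
abbrev pos (i : ℕ) : ℕ × TangleGen := (i, .pos)

/-- The negative crossing of the strands number `i` and `i + 1`. -/
abbrev neg (i : ℕ) : ℕ × TangleGen := (i, .neg)

/-- The defining moves of isotopy. -/
def isotopyAxioms : List Move :=
  have h := LocalMove.isIsotopyCong
  [⟨2, [pos 0, neg 0], [], .of_localMove h.cross_crossInv⟩,
   ⟨2, [neg 0, pos 0], [], .of_localMove h.crossInv_cross⟩,
   ⟨1, [cap 0, cup 1], [], .of_localMove h.zigzag_left⟩,
   ⟨1, [cap 1, cup 0], [], .of_localMove h.zigzag_right⟩,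
   ⟨1, [cap 1, pos 0, cup 1], [cap 0, pos 1, cup 0], .of_localMove h.reidemeister_one⟩,
   ⟨1, [cap 0, pos 1, pos 0], [cap 1], .of_localMove (h.naturality_left .max)⟩,
   ⟨3, [cup 0], [pos 1, pos 0, cup 1], .of_localMove (h.naturality_left .min)⟩,
   ⟨3, [pos 0, pos 1, pos 0], [pos 1, pos 0, pos 1], .of_localMove (h.naturality_left .pos)⟩,
   ⟨3, [neg 0, pos 1, pos 0], [pos 1, pos 0, neg 1], .of_localMove (h.naturality_left .neg)⟩,
   ⟨1, [cap 1, pos 0, pos 1], [cap 0], .of_localMove (h.naturality_right .max)⟩,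
   ⟨3, [cup 1], [pos 0, pos 1, cup 0], .of_localMove (h.naturality_right .min)⟩,
   ⟨3, [neg 1, pos 0, pos 1], [pos 0, pos 1, neg 0], .of_localMove (h.naturality_right .neg)⟩]

/-! ### Closed components as local moves -/

/-- An isolated closed diagram which may be removed from the empty tangle may be removed
anywhere. -/
theorem LocalMove.of_closed {u : Word TangleGen} (hu : Typed 0 u 0) (hc : SameColours 0 u [])
    (h : TglRel 0 0 u []) : LocalMove 0 0 u [] := by
  refine ⟨hu, rfl, hc, fun k l i j A B hA hB had => ?_⟩
  have hM := tglRel_isMoveCong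
  have hI := isotopic_isIsotopyCong.toIsBraidedCong
  have had' := admissible_context hu (show Typed 0 [] 0 from rfl) hc hA hB had
  simp only [shift_nil, List.append_nil] at had' ⊢
  -- the closed diagram is moved to the right and then up along the other strands
  have h1 : Isotopic (i + j) (i + j) (shift i j u) (shift 0 (i + j) u) := by
    have := hI.whisker 0 j _ _ _ _ (hI.naturality_word_right hu i)
    simpa [blockCross_zero, Nat.add_comm j] using this
  have hA' : Typed (2 * k) A (i + j) := hA
  have h2 : Isotopic (2 * k) (2 * l) (A ++ shift i j u ++ B) (shift (2 * k) 0 u ++ (A ++ B)) := by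
    refine hI.trans _ _ _ _ _ (hI.comp_right (hI.comp_left hA' h1) hB) ?_
    have h3 := hI.interchange_word hA' hu
    have h4 : Isotopic (i + j) (i + j) (shift 0 (i + j) u) (shift (i + j) 0 u) := by
      have := hI.naturality_word_left hu (i + j)
      simpa [blockCross_zero, blockCross] using this
    have h5 := hI.comp_right (hI.comp_left hA' h4) hB
    refine hI.trans _ _ _ _ _ h5 ?_
    have h6 := hI.comp_right (v := B) (k := 2 * l) h3 (hB.cast (by omega) rfl)
    simpa using h6
  have hsh : TglRel k k (shift (2 * k) 0 u) [] := by
    have := hM.tensor _ _ _ _ _ _ _ _ (hM.refl k k [] (.nil k)) h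
    simpa using this
  have hadu : Admissible 0 0 u := ⟨hu, by simp, by simp⟩
  have h7 := hM.comp _ _ _ _ _ _ _ hsh (hM.refl k l (A ++ B) had')
  refine hM.trans _ _ _ _ _ (hM.isotopy _ _ _ _ had ?_ h2) h7
  exact ((hadu.shift k 0).cast (by omega) (by omega)).append had'

theorem LocalMove.hopf : LocalMove 0 0 hopfLink [] :=
  .of_closed (by decide) (.of_test (by decide)) tglRel_isMoveCong.hopf

theorem LocalMove.hopf_one : LocalMove 0 0 hopfLinkOne [] :=
  .of_closed (by decide) (.of_test (by decide)) tglRel_isMoveCong.hopf_one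

/-! ### Slides for words -/

instance MarkedTyped.instDecidable :
    ∀ (p : List Bool) (w : List MarkedSlice) (q : List Bool), Decidable (MarkedTyped p w q)
  | p, [], q => inferInstanceAs (Decidable (p = q))
  | p, s :: w, q =>
    have := MarkedTyped.instDecidable s.cod w q
    inferInstanceAs (Decidable (p = s.dom ∧ MarkedTyped s.cod w q))

namespace Bare

/-- Mark the strands of a diagram whose upper ends have the given marks. The list `ms` says which
maxima to mark, in the order of their occurrence; later ones are not marked. -/
def mark : List Bool → List Bool → Bare → List MarkedSlice
  | _, _, [] => []
  | p, ms, (l, .max) :: w =>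
    let c := ms.headD false
    ⟨p.take l, .max c, p.drop l⟩ :: mark (p.take l ++ [c, c] ++ p.drop l) ms.tail w
  | p, ms, (l, .min) :: w =>
    ⟨p.take l, .min (p.getD l false), p.drop (l + 2)⟩ :: mark (p.take l ++ p.drop (l + 2)) ms w
  | p, ms, (l, .pos) :: w =>
    ⟨p.take l, .pos (p.getD l false) (p.getD (l + 1) false), p.drop (l + 2)⟩ ::
      mark (p.take l ++ [p.getD (l + 1) false, p.getD l false] ++ p.drop (l + 2)) ms w
  | p, ms, (l, .neg) :: w =>
    ⟨p.take l, .neg (p.getD l false) (p.getD (l + 1) false), p.drop (l + 2)⟩ ::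
      mark (p.take l ++ [p.getD (l + 1) false, p.getD l false] ++ p.drop (l + 2)) ms w

end Bare

/-- The result of sliding the strand following `p` over the marked component. -/
def slid (p q : List Bool) (u v : List MarkedSlice) : Word TangleGen :=
  doubleMarked u ++
    shift (doubledWidth p) (doubledWidth q) [⟨0, .min, 1⟩, ⟨0, .max, 1⟩] ++ doubleMarked v

/-- A test that `w'` arises from `w` by sliding a strand over a component, which has a maximum
`cap i` as first piece, at a place just below this maximum. The ends of `w` are not marked. -/
def isSlide (n : ℕ) (p q : List Bool) (i : ℕ) (ms : List Bool) (v w w' : Bare) : Bool :=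
  let U := mark (List.replicate n false) [true] [cap i]
  let V := mark (p ++ [false, true] ++ q) ms v
  let m := width n w
  decide (MarkedTyped (List.replicate n false) U (p ++ [false, true] ++ q)) &&
  decide (MarkedTyped (p ++ [false, true] ++ q) V (List.replicate m false)) &&
  ((allColours n).all fun x => marksMonochromatic (U ++ V) x true true) &&
  decide (Typed n (slid p q U V) m) &&
  sameColours n (forgetMarks (U ++ V)) (slid p q U V) &&
  decide (strip (forgetMarks (U ++ V)) = w) && decide (strip (slid p q U V) = w')

theorem Moves.slide {n : ℕ} {w w' : Bare} (p q : List Bool) (i : ℕ) (ms : List Bool) (v : Bare)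
    (h : isSlide n p q i ms v w w' = true) : Moves n w w' := by
  simp only [isSlide, Bool.and_eq_true, decide_eq_true_eq] at h
  obtain ⟨⟨⟨⟨⟨⟨h1, h2⟩, h3⟩, h4⟩, h5⟩, h6⟩, h7⟩ := h
  have := Moves.of_localMove (LocalMove.slide h1 h2
    (marksOneComponent_of_test (h1.append h2) (by simpa using h3)) h4 (.of_test h5))
  rw [h6] at this
  exact h7 ▸ this

/-! ### Named diagrams -/

namespace Bare

/-- The crossing `x` of `n` with `m` parallel strands. -/
abbrev block (x : TangleGen) (n m : ℕ) : Bare := strip (blockCross x n m)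

/-- The first of `n + 1` strands makes a full turn around the others. -/
def full (n : ℕ) : Bare := block .pos 1 n ++ block .pos n 1

/-- An annulus around `n` strands, which starts with a maximum on the left. The strands pass through
it, and the first crossings are of the kind `x`. -/
def ring (x : TangleGen) (n : ℕ) : Bare :=
  [cap 0] ++ shift 1 (block x 1 n ++ block x n 1) ++ [cup 0]

/-- An annulus around `n` strands which starts with a maximum on the right. -/
def ringRight (n : ℕ) : Bare := [cap n] ++ (block .pos n 1 ++ block .pos 1 n) ++ [cup n]

/-- A curl in a strand. -/
abbrev loop (x : TangleGen) : Bare := strip (curl x)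

/-- Two arcs, an upper and a lower one, hooked into each other. -/
abbrev hooking (x : TangleGen) : Bare := strip (clasp x)

/-- The tangle which the boundary move identifies with a pair of vertical strands. -/
abbrev boundary : Bare := strip boundaryTangle

/-- Rotation of a diagram with `n` upper ends about a vertical axis, with all crossings
preserved. -/
def reflect : ℕ → Bare → Bare
  | _, [] => []
  | n, s :: w => (n - s.1 - src s.2, s.2) :: reflect (n - src s.2 + tgt s.2) w

/-- The tangle of a generator. -/
abbrev tangle (g : AlgGen) : Bare := strip (genTangle g)

/-- The multiplication: the strands number `1` and `2` pass through a ring, and the second pair of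
strands is closed. -/
def mulRing : Bare := shift 1 (ring .pos 2) ++ [cup 2]

/-- The other form of the multiplication, in which the first pair of strands is closed. -/
def mulRing' : Bare := shift 1 (ring .pos 2) ++ [cup 0]

/-- The comultiplication, with a ring around three strands. -/
def comulRing : Bare :=
  [cap 2, cap 3] ++ shift 1 (ring .pos 3) ++ [cup 0] ++ shift 1 (block .pos 2 1)

/-- An arc hooked into a strand on its left. -/
def hook : Bare := [cap 1, pos 0, pos 0]

/-- Two arcs hooked into each other, which represent the copairing `ω`. -/
def copairing : Bare := [cap 0] ++ shift 1 hook

end Bare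

/-! ### Isotopies of curls, crossings and arcs -/

namespace Bare

theorem braid_ppp : Moves 3 [pos 0, pos 1, pos 0] [pos 1, pos 0, pos 1] :=
  .calculate isotopyAxioms [.use 7 0 0] (by decide +kernel)

theorem braid_ppn : Moves 3 [pos 0, pos 1, neg 0] [neg 1, pos 0, pos 1] :=
  .calculate isotopyAxioms [.back 11 0 0] (by decide +kernel)

theorem braid_npp : Moves 3 [neg 0, pos 1, pos 0] [pos 1, pos 0, neg 1] :=
  .calculate isotopyAxioms [.use 8 0 0] (by decide +kernel)

theorem braid_pnn : Moves 3 [pos 0, neg 1, neg 0] [neg 1, neg 0, pos 1] :=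
  .calculate isotopyAxioms [.back 1 0 1, .back 8 1 0, .use 0 3 0] (by decide +kernel)

theorem braid_nnp : Moves 3 [neg 0, neg 1, pos 0] [pos 1, neg 0, neg 1] :=
  .calculate isotopyAxioms [.back 0 3 1, .use 11 1 0, .use 1 0 0] (by decide +kernel)

theorem braid_nnn : Moves 3 [neg 0, neg 1, neg 0] [neg 1, neg 0, neg 1] :=
  .calculate isotopyAxioms
    [.back 1 0 1, .back 1 1 0, .back 11 2 0, .use 0 4 1, .use 0 3 0]
    (by decide +kernel)

theorem cap_pos : Moves 1 [cap 0, pos 1] [cap 1, neg 0] :=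
  .calculate isotopyAxioms [.back 0 2 0, .use 5 0 0] (by decide +kernel)

theorem cap_neg : Moves 1 [cap 0, neg 1] [cap 1, pos 0] :=
  .calculate isotopyAxioms [.back 9 0 0, .use 0 2 1] (by decide +kernel)

theorem pos_cup : Moves 3 [pos 1, cup 0] [neg 0, cup 1] :=
  .calculate isotopyAxioms [.back 1 0 0, .back 10 1 0] (by decide +kernel)

theorem neg_cup : Moves 3 [neg 1, cup 0] [pos 0, cup 1] :=
  .calculate isotopyAxioms [.use 6 1 0, .use 1 0 1] (by decide +kernel)

theorem loop_pos_flip : Moves 1 (loop .pos) [cap 0, pos 1, cup 0] :=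
  .calculate isotopyAxioms [.use 4 0 0] (by decide +kernel)

/-- The Whitney trick: two curls with opposite framings and opposite rotation numbers cancel. -/
theorem loop_pos_cancel : Moves 1 (loop .pos ++ [cap 0, neg 1, cup 0]) [] :=
  .calculate (isotopyAxioms ++ [cap_pos.move, cap_neg.move])
    [.up 3 3, .back 13 1 2, .up 4 2, .up 5 2, .back 12 1 1, .up 3 1, .use 3 1 0, .back 1 1 1,
    .back 8 2 0, .back 6 3 0, .use 13 0 0, .use 0 1 0, .use 3 0 0]
    (by decide +kernel)

theorem loop_neg_cancel : Moves 1 (loop .neg ++ [cap 0, pos 1, cup 0]) [] :=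
  .calculate (isotopyAxioms ++ [braid_pnn.move, cap_pos.move, cap_neg.move, pos_cup.move])
    [.up 3 3, .back 13 1 2, .up 4 2, .up 5 2, .back 14 1 1, .up 3 1, .use 3 1 0, .back 0 1 1,
    .back 12 2 0, .use 5 0 0, .back 15 2 0, .use 1 1 1, .use 3 0 0]
    (by decide +kernel)

theorem loop_neg_flip : Moves 1 (loop .neg) [cap 0, neg 1, cup 0] :=
  .calculate (isotopyAxioms ++ [loop_pos_cancel.move, loop_neg_cancel.move])
    [.back 12 2 0, .up 8 6, .use 4 3 0, .use 13 0 0]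
    (by decide +kernel)

theorem loop_pos_loop_neg : Moves 1 (loop .pos ++ loop .neg) [] :=
  .calculate (isotopyAxioms ++ [loop_neg_flip.move, loop_pos_cancel.move])
    [.use 12 3 0, .use 13 0 0]
    (by decide +kernel)

theorem loop_neg_loop_pos : Moves 1 (loop .neg ++ loop .pos) [] :=
  .calculate (isotopyAxioms ++ [loop_neg_cancel.move]) [.use 4 3 0, .use 12 0 0] (by decide +kernel)

/-- A half twist in an arc is a curl in one of its legs. -/
theorem twisted_cap_pos : Moves 0 [cap 0, pos 0] (tangle .ribbon) :=
  .calculate (isotopyAxioms ++ [cap_pos.move, loop_neg_flip.move])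
    [.back 3 1 0, .up 3 1, .use 12 1 1, .up 1 1, .back 13 1 0]
    (by decide +kernel)

theorem twisted_cap_neg : Moves 0 [cap 0, neg 0] (tangle .ribbonInv) :=
  .calculate (isotopyAxioms ++ [cap_neg.move])
    [.back 3 1 0, .up 3 1, .use 12 1 1, .up 1 1, .back 4 1 0]
    (by decide +kernel)

theorem twisted_cap_pos_right : Moves 0 [cap 0, pos 0] ([cap 0] ++ shift 1 (loop .neg)) :=
  .calculate (isotopyAxioms ++ [cap_neg.move])
    [.back 2 1 1, .up 3 1, .back 12 1 0, .up 1 1]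
    (by decide +kernel)

theorem twisted_cap_neg_right : Moves 0 [cap 0, neg 0] ([cap 0] ++ shift 1 (loop .pos)) :=
  .calculate (isotopyAxioms ++ [cap_pos.move])
    [.back 2 1 1, .up 3 1, .back 12 1 0, .up 1 1]
    (by decide +kernel)

/-- The isotopies used in calculations. -/
def isotopies : List Move :=
  isotopyAxioms.take 2 ++
  [braid_ppp.move, braid_ppn.move, braid_npp.move, braid_pnn.move, braid_nnp.move,
   braid_nnn.move] ++
  (isotopyAxioms.drop 2).take 2 ++
  [cap_pos.move, cap_neg.move, pos_cup.move, neg_cup.move, loop_pos_flip.move, loop_neg_flip.move,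
   loop_pos_loop_neg.move, loop_neg_loop_pos.move, twisted_cap_pos.move, twisted_cap_neg.move,
   twisted_cap_pos_right.move, twisted_cap_neg_right.move]

/-! ### Annuli around strands -/

/-- All four crossings of an annulus around a strand may be reversed: it is turned about the strand
by half a turn. -/
theorem ring_flip_one : Moves 1 (ring .pos 1) (ring .neg 1) :=
  .calculate isotopies
    [.back 16 1 0, .up 7 3, .up 8 3, .back 19 0 0, .use 15 4 0, .use 11 4 0, .up 7 2,
    .use 8 4 1, .back 0 5 1, .back 2 3 0, .back 2 2 0, .use 1 1 0, .use 10 0 0, .use 1 1 0,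
    .back 11 0 0]
    (by decide +kernel)

/-- An annulus around a strand may be turned so that it starts on the other side. -/
theorem ring_turn_one : Moves 1 (ring .pos 1) (ringRight 1) :=
  .calculate (isotopies ++ [ring_flip_one.move])
    [.use 22 0 0, .use 13 2 0, .use 11 0 0]
    (by decide +kernel)

/-! ### Switching crossings by means of an annulus -/

/-- The strand to the left of an annulus is slid over the annulus. -/
theorem slide_ring_one : Moves 2 (shift 1 (ring .pos 1))
    [cap 1, cap 2, cup 0, cap 0, pos 4, pos 3, pos 3, pos 4, cup 2, cup 1] :=
  .slide [] [true, false] 1 []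
    [pos 2, pos 2, cup 1] (by decide +kernel)

/-- The parallel copy of the annulus is contracted, so that the strand makes a full turn around the
strand inside the annulus. -/
theorem slide_ring_one_isotopy : Moves 2
    [cap 1, cap 2, cup 0, cap 0, pos 4, pos 3, pos 3, pos 4, cup 2, cup 1]
    ([pos 0, pos 0] ++ shift 1 (ring .pos 1)) :=
  .calculate isotopies
    [.up 2 1, .up 4 2, .down 4 2, .up 8 2, .up 8 1, .use 8 8 0, .use 9 0 0, .back 0 3 2,
    .up 7 1, .back 3 4 1, .use 2 2 1, .up 2 1, .use 13 6 0, .up 6 2, .use 10 2 0, .use 1 3 0]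
    (by decide +kernel)

/-- A strand on the left of an annulus may make a full turn around the strand inside it. -/
theorem full_ring_one : Moves 2 (shift 1 (ring .pos 1)) ([pos 0, pos 0] ++ shift 1 (ring .pos 1)) :=
  slide_ring_one.trans slide_ring_one_isotopy

theorem slide_ring_two : Moves 3 (shift 1 (ring .pos 2))
    ([cap 1, cap 2, cup 0, cap 0, pos 4, pos 3, pos 5, pos 4] ++ shift 3 (block .pos 2 2) ++
      [cup 2, cup 1]) :=
  .slide [] [true, false, false] 1 []
    (shift 2 (full 2) ++ [cup 1]) (by decide +kernel)

theorem slide_ring_two_isotopy : Moves 3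
    ([cap 1, cap 2, cup 0, cap 0, pos 4, pos 3, pos 5, pos 4] ++ shift 3 (block .pos 2 2) ++
      [cup 2, cup 1])
    (full 2 ++ shift 1 (ring .pos 2)) :=
  .calculate isotopies
    [.up 2 1, .up 4 2, .up 6 3, .down 5 3, .up 10 2, .up 12 3, .down 10 2, .use 8 12 0,
    .use 9 0 0, .use 10 2 0, .back 0 5 3, .up 10 2, .back 3 6 2, .use 2 4 2, .up 4 2, .up 11 1,
    .back 3 8 1, .up 8 2, .use 13 10 0, .up 5 1, .up 10 3, .use 10 3 1, .back 5 4 0, .up 4 1,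
    .use 1 6 0, .back 10 4 1]
    (by decide +kernel)

/-- A strand on the left of an annulus may make a full turn around the strands inside it. -/
theorem full_ring_two : Moves 3 (shift 1 (ring .pos 2)) (full 2 ++ shift 1 (ring .pos 2)) :=
  slide_ring_two.trans slide_ring_two_isotopy

theorem slide_ring_three : Moves 4 (shift 1 (ring .pos 3))
    ([cap 1, cap 2, cup 0, cap 0, pos 4, pos 3, pos 5, pos 4, pos 6, pos 5] ++
      shift 3 (block .pos 3 2) ++ [cup 2, cup 1]) :=
  .slide [] [true, false, false, false] 1 []
    (shift 2 (full 3) ++ [cup 1]) (by decide +kernel)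

theorem slide_ring_three_isotopy : Moves 4
    ([cap 1, cap 2, cup 0, cap 0, pos 4, pos 3, pos 5, pos 4, pos 6, pos 5] ++
      shift 3 (block .pos 3 2) ++ [cup 2, cup 1])
    (full 3 ++ shift 1 (ring .pos 3)) :=
  .calculate isotopies
    [.up 2 1, .up 4 2, .up 6 3, .up 8 4, .down 6 4, .up 12 2, .up 14 3, .up 16 4, .down 13 3,
    .use 8 16 0, .use 9 0 0, .use 10 3 0, .back 0 7 4, .up 13 3, .back 3 8 3, .use 2 6 3,
    .up 6 3, .up 14 2, .back 3 10 2, .up 10 2, .use 2 6 2, .up 6 2, .up 15 1, .back 3 12 1,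
    .up 12 4, .use 13 14 0, .up 7 1, .up 14 5, .use 10 5 1, .back 5 6 0, .up 6 1, .use 1 8 0,
    .back 10 6 1]
    (by decide +kernel)

theorem full_ring_three : Moves 4 (shift 1 (ring .pos 3)) (full 3 ++ shift 1 (ring .pos 3)) :=
  slide_ring_three.trans slide_ring_three_isotopy

/-- An annulus may be moved along the strands inside it past a crossing. -/
theorem ring_past_pos_one : Moves 2 (shift 1 (ring .pos 1) ++ [pos 0]) ([pos 0] ++ ring .pos 1) :=
  .calculate isotopies
    [.use 10 0 1, .back 0 2 0, .up 4 1, .back 12 4 0, .up 6 1, .back 2 3 1, .back 3 1 0,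
    .up 1 1, .back 11 1 1, .up 3 1, .use 1 3 2, .back 10 1 0]
    (by decide +kernel)

theorem ring_past_block_pos_one : Moves 2 (ring .pos 1 ++ [pos 0])
    ([pos 0] ++ shift 1 (ring .pos 1)) :=
  .calculate isotopies
    [.back 0 2 2, .up 6 1, .back 3 3 1, .use 2 1 1, .up 1 1, .use 13 5 0, .up 5 2, .use 10 1 0,
    .use 1 2 0]
    (by decide +kernel)

theorem ring_past_neg_one : Moves 2 (shift 1 (ring .pos 1) ++ [neg 0]) ([neg 0] ++ ring .pos 1) :=
  .calculate isotopies
    [.use 10 0 1, .back 1 2 0, .up 4 1, .back 13 4 0, .up 6 1, .back 6 3 1, .back 7 1 0,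
    .up 1 1, .back 10 1 1, .up 3 1, .use 0 3 2, .back 10 1 0]
    (by decide +kernel)

/-- Since the strand on the left of an annulus may make a full turn around the strand inside, its
next crossing with that strand may be switched. -/
theorem ring_switch_one : Moves 2 (shift 1 (ring .pos 1) ++ [neg 0])
    (shift 1 (ring .pos 1) ++ [pos 0]) :=
  .calculate (isotopies ++ [full_ring_one.move, ring_past_neg_one.move, ring_past_pos_one.move])
    [.use 22 0 0, .use 23 2 0, .use 0 1 0, .back 24 0 0]
    (by decide +kernel)

/-- The same for a strand on the right of the annulus. -/
theorem ring_switch_left_one : Moves 2 (ring .pos 1 ++ [neg 0]) (ring .pos 1 ++ [pos 0]) :=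
  .calculate (isotopies ++ [ring_switch_one.move, ring_past_block_pos_one.move,
       ring_past_neg_one.move])
    [.back 0 0 0, .back 24 1 0, .use 22 1 0, .use 0 5 0, .back 23 0 0]
    (by decide +kernel)

theorem ring_past_pos_two : Moves 3 (shift 1 (ring .pos 2) ++ [pos 0, pos 1])
    ([pos 0, pos 1] ++ ring .pos 2) :=
  .calculate isotopies
    [.use 10 0 1, .back 0 2 0, .down 3 3, .back 12 6 0, .up 8 1, .back 2 5 1, .up 5 2,
    .back 3 1 0, .up 1 1, .back 11 1 1, .up 3 1, .up 9 2, .back 2 5 2, .use 4 3 2, .up 3 2,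
    .use 1 5 3, .back 10 2 0]
    (by decide +kernel)

theorem ring_past_block_pos_two : Moves 3 (ring .pos 2 ++ [pos 1, pos 0])
    ([pos 1, pos 0] ++ shift 1 (ring .pos 2)) :=
  .calculate isotopies
    [.use 10 0 0, .back 0 3 3, .up 8 2, .back 3 4 2, .use 2 2 2, .up 2 2, .up 9 1, .back 3 6 1,
    .up 6 2, .use 13 8 0, .up 3 1, .up 8 3, .use 10 1 1, .back 5 2 0, .up 2 1, .use 1 4 0,
    .back 10 2 1]
    (by decide +kernel)

theorem ring_past_neg_two : Moves 3 (shift 1 (ring .pos 2) ++ [neg 0, neg 1])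
    ([neg 0, neg 1] ++ ring .pos 2) :=
  .calculate isotopies
    [.use 10 0 1, .back 1 2 0, .down 3 3, .back 13 6 0, .up 8 1, .back 6 5 1, .up 5 2, .up 9 2,
    .back 6 5 2, .back 7 1 0, .up 1 1, .back 10 1 1, .up 3 1, .use 3 3 2, .up 3 2, .use 0 5 3,
    .back 10 2 0]
    (by decide +kernel)

/-- The crossings of a strand on the left of an annulus with the strands inside may be switched. -/
theorem ring_switch_two : Moves 3 (shift 1 (ring .pos 2) ++ [neg 0, neg 1])
    (shift 1 (ring .pos 2) ++ [pos 0, pos 1]) :=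
  .calculate (isotopies ++ [full_ring_two.move, ring_past_neg_two.move, ring_past_pos_two.move])
    [.use 22 0 0, .use 23 4 0, .use 0 3 0, .use 0 2 1, .back 24 0 0]
    (by decide +kernel)

/-- The same for a strand on the right of the annulus. -/
theorem ring_switch_left_two : Moves 3 (ring .pos 2 ++ [neg 1, neg 0])
    (ring .pos 2 ++ [pos 1, pos 0]) :=
  .calculate (isotopies ++ [ring_switch_two.move, ring_past_block_pos_two.move,
       ring_past_neg_two.move])
    [.back 0 0 1, .back 0 1 0, .back 24 2 0, .use 22 2 0, .use 0 9 1, .use 0 8 0, .back 23 0 0]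
    (by decide +kernel)

theorem ring_past_pos_three : Moves 4 (shift 1 (ring .pos 3) ++ block .pos 1 3)
    (block .pos 1 3 ++ ring .pos 3) :=
  .calculate isotopies
    [.back 0 1 0, .back 11 0 0, .down 2 6, .back 12 8 0, .up 10 1, .back 2 7 1, .up 7 4,
    .use 4 1 1, .up 1 1, .up 11 2, .back 2 7 2, .up 7 2, .use 4 3 2, .up 3 2, .up 12 3,
    .back 2 7 3, .use 4 5 3, .up 5 3, .use 1 7 4]
    (by decide +kernel)

theorem ring_past_neg_three : Moves 4 (shift 1 (ring .pos 3) ++ block .neg 1 3)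
    (block .neg 1 3 ++ ring .pos 3) :=
  .calculate isotopies
    [.back 1 1 0, .back 10 0 0, .down 2 6, .back 13 8 0, .up 10 1, .back 6 7 1, .up 7 4,
    .use 3 1 1, .up 1 1, .up 11 2, .back 6 7 2, .up 7 2, .up 12 3, .back 6 7 3, .use 3 3 2,
    .up 3 2, .use 3 5 3, .up 5 3, .use 0 7 4]
    (by decide +kernel)

/-- The crossings of a strand on the left of an annulus with the strands inside may be switched. -/
theorem ring_switch_three : Moves 4 (shift 1 (ring .pos 3) ++ block .neg 1 3)
    (shift 1 (ring .pos 3) ++ block .pos 1 3) :=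
  .calculate (isotopies ++ [full_ring_three.move, ring_past_neg_three.move,
       ring_past_pos_three.move])
    [.use 22 0 0, .use 23 6 0, .use 0 5 0, .use 0 4 1, .use 0 3 2, .back 24 0 0]
    (by decide +kernel)

/-! ### The generators in terms of annuli -/

/-- A circle passing through an annulus is a Hopf link. -/
theorem ring_hopfLink : Moves 0 ([cap 0] ++ ring .pos 1 ++ [cup 0]) (copairing ++ [cup 0, cup 0]) :=
  .calculate isotopies [.up 1 1] (by decide +kernel)

theorem ring_hopf : Moves 0 ([cap 0] ++ ring .pos 1 ++ [cup 0]) [] :=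
  ring_hopfLink.trans (.of_localMove LocalMove.hopf)

/-- The tangle of the multiplication consists of one annulus, which fuses two strands, and of the
remaining strands. -/
theorem mul_ring : Moves 4 (tangle .mul) mulRing :=
  .calculate isotopies
    [.back 11 0 3, .use 12 2 2, .up 2 1, .up 4 2, .up 5 2, .use 13 4 3, .up 4 1, .up 6 1,
    .back 12 4 1, .up 6 2, .back 10 0 2, .up 2 1, .back 10 0 1, .down 4 2]
    (by decide +kernel)

/-- Multiplying the unit with the identity gives the boundary tangle. Hence the unit law is the
boundary move. -/
theorem boundary_left : Moves 2 ([cap 0] ++ mulRing) boundary :=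
  .calculate isotopies
    [.up 7 2, .use 10 1 1, .up 1 1, .use 11 1 0, .up 3 2, .up 4 2, .up 5 2, .back 13 2 1,
    .up 6 1, .back 13 6 0, .use 10 0 0, .up 2 1, .back 12 2 0, .use 11 0 1, .use 10 4 1]
    (by decide +kernel)

theorem counit_ring : Moves 2 (tangle .counit) (ring .pos 1 ++ [cup 0]) :=
  .calculate isotopies
    [.back 11 0 1, .use 12 2 0, .up 2 1, .use 13 2 1, .up 4 1, .back 10 0 0]
    (by decide +kernel)

theorem counit_ring_right : Moves 2 (ring .pos 1 ++ [cup 0]) (shift 1 (ring .pos 1) ++ [cup 0]) :=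
  .calculate (isotopies ++ [ring_turn_one.move])
    [.use 22 0 0, .back 13 2 0, .up 4 1, .back 12 2 1, .up 2 1, .back 13 2 0, .up 4 1,
    .back 12 2 1]
    (by decide +kernel)

/-- The tangle of the comultiplication has one annulus, around an arc at the top and two strands. -/
theorem comul_ring : Moves 2 (tangle .comul) comulRing :=
  .calculate isotopies
    [.down 5 2, .use 10 4 0, .back 10 0 1, .down 6 3, .back 13 9 1, .down 5 4, .back 12 9 0,
    .up 4 2, .up 5 2, .up 6 2, .up 7 2, .up 8 2, .up 9 2, .up 10 1, .back 12 8 1, .back 1 5 4,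
    .use 3 6 4, .down 8 4, .back 6 4 4, .up 4 1, .use 11 2 3, .back 10 4 5, .up 2 2, .up 4 3,
    .down 5 6]
    (by decide +kernel)

theorem ring_flip_two : Moves 2 (ring .pos 2) (ring .neg 2) :=
  .calculate isotopies
    [.back 16 1 0, .up 7 3, .up 8 3, .up 9 3, .up 10 3, .back 19 0 0, .use 15 6 0, .use 11 6 0,
    .up 9 2, .use 8 6 1, .back 0 7 1, .back 0 8 2, .back 2 5 0, .up 5 2, .up 8 1, .back 2 5 1,
    .back 2 4 1, .back 2 2 0, .use 1 1 0, .use 10 0 0, .up 3 2, .use 10 0 1, .use 1 2 0,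
    .use 1 1 1, .back 11 0 1, .up 2 1, .back 11 0 0]
    (by decide +kernel)

theorem ring_turn_two : Moves 2 (ring .neg 2) (ringRight 2) :=
  .calculate isotopies
    [.use 11 0 0, .use 13 4 0, .up 4 2, .use 13 4 1, .up 3 2, .use 11 0 1]
    (by decide +kernel)

/-- The unit law on the other side is the boundary move for the other form of the multiplication. -/
theorem boundary_right : Moves 2 ([cap 2] ++ mulRing') boundary :=
  .calculate (isotopies ++ [ring_flip_two.move])
    [.use 22 1 1, .down 0 2, .use 13 5 1, .up 5 3, .up 7 4, .use 11 0 1]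
    (by decide +kernel)

/-- An annulus around a strand cancels with a `0`-framed circle which passes through it: switching
crossings with the annulus separates the strand, and a Hopf link is left. -/
theorem absorb_one : Moves 1 ([cap 0] ++ mulRing') [] :=
  .calculate (isotopies ++ [ring_switch_left_one.move, ring_turn_one.move, ring_hopf.move])
    [.use 12 5 1, .up 5 2, .up 7 3, .use 13 3 0, .up 3 1, .back 11 1 0, .up 1 1, .back 10 1 1,
    .back 22 1 1, .use 1 5 1, .use 23 1 1, .up 1 1, .up 5 1, .use 24 0 0]
    (by decide +kernel)

/-! ### Relations holding by isotopy and slides -/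

/-- The second annulus encloses the two strands in the first one and two others. The former are
pulled out of it by switching crossings. -/
theorem mul_assoc_moves : Moves 6 (tangle .mul ++ tangle .mul)
    (shift 2 (tangle .mul) ++ tangle .mul) :=
  .calculate (isotopies ++ [mul_ring.move, ring_switch_two.move])
    [.use 22 7 0, .up 13 2, .use 22 0 0, .down 6 2, .back 0 8 3, .back 12 9 3, .down 10 3,
    .back 0 13 4, .use 13 14 3, .upLeft 6 1, .up 5 1, .up 4 1, .up 3 1, .up 2 1, .up 1 1,
    .down 15 2, .down 12 5, .up 17 5, .up 17 2, .back 23 1 2, .back 13 14 3, .use 0 13 4,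
    .down 0 6, .up 13 3, .use 11 6 1, .use 12 14 1, .up 14 6, .up 15 1, .use 0 7 1, .use 11 6 2,
    .up 8 1, .back 13 8 2, .up 10 2, .up 11 2, .up 12 1, .back 12 10 3, .up 6 6, .up 7 6,
    .up 8 6, .up 9 6, .up 13 9, .up 11 6, .up 12 6, .back 22 7 0, .down 4 2, .back 22 0 2]
    (by decide +kernel)

/-- One of the two strands in the annulus of the multiplication passes through the annulus of the
counit, too. It is pulled out of the former by switching crossings. -/
theorem counit_mul_moves : Moves 4 (tangle .mul ++ tangle .counit)
    (tangle .counit ++ tangle .counit) :=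
  .calculate (isotopies ++ [mul_ring.move, counit_ring.move, counit_ring_right.move,
       ring_switch_one.move])
    [.use 23 7 0, .down 6 5, .use 24 6 0, .up 11 5, .use 22 0 0, .up 6 2, .use 12 5 1, .up 5 3,
    .up 6 1, .back 24 7 0, .up 7 7, .up 8 7, .up 9 7, .up 10 7, .up 11 4, .use 10 0 0,
    .use 13 6 0, .up 6 1, .back 11 4 0, .use 12 6 1, .upLeft 4 1, .up 3 3, .back 10 1 2,
    .use 25 1 1, .use 0 5 1, .use 24 1 2, .back 1 1 1, .down 2 4, .back 13 6 1, .use 25 2 2,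
    .up 2 2, .up 3 2, .up 4 2, .up 5 2, .use 11 4 0, .up 6 1, .back 13 6 0, .up 8 2, .up 9 2,
    .up 10 1, .back 12 8 1, .up 11 3, .upLeft 4 1, .up 3 1, .up 2 1, .up 1 1, .down 8 2,
    .up 10 2, .back 25 1 2, .down 0 4, .use 11 4 1, .use 12 9 1, .up 9 3, .up 11 4, .up 11 1,
    .use 0 5 1, .up 5 1, .back 23 5 0, .back 24 0 0, .back 23 0 0]
    (by decide +kernel)

theorem antipode_antipodeInv_moves : Moves 2 (tangle .antipode ++ tangle .antipodeInv) [] :=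
  .calculate isotopies [.use 16 1 0, .use 0 0 0] (by decide +kernel)

theorem antipodeInv_antipode_moves : Moves 2 (tangle .antipodeInv ++ tangle .antipode) [] :=
  .calculate isotopies [.use 1 3 0, .use 17 0 0] (by decide +kernel)

theorem integral_antipode_moves : Moves 2 (tangle .antipode ++ [cup 0]) [cup 0] :=
  .calculate isotopies
    [.use 14 1 0, .use 10 1 0, .up 4 2, .use 8 1 1, .use 0 0 0]
    (by decide +kernel)

theorem ribbon_antipode_moves : Moves 0 (tangle .ribbon ++ tangle .antipode) (tangle .ribbon) :=
  .calculate isotopies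
    [.back 18 0 0, .back 11 3 0, .back 1 5 2, .use 12 6 1, .use 7 4 1, .up 4 1, .use 0 2 0,
    .use 11 2 0, .up 4 1, .use 11 2 1, .up 5 1, .use 20 0 0, .use 17 1 1, .use 18 0 0]
    (by decide +kernel)

/-- The sign of the curl does not matter, since the crossings of the arc with itself may be switched
by means of the annulus around it. -/
theorem ribbon_counit_swap : Moves 0 (tangle .ribbon ++ tangle .counit)
    (tangle .ribbonInv ++ tangle .counit) :=
  .calculate (isotopies ++ [counit_ring.move, ring_switch_left_one.move])
    [.use 22 4 0, .up 4 4, .back 18 1 2, .down 0 2, .use 20 0 0, .up 4 3, .up 5 3, .up 6 3,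
    .up 7 3, .use 15 5 1, .use 13 6 1, .up 8 1, .use 12 6 0, .up 5 4, .use 23 2 0, .down 1 4,
    .back 13 6 0, .up 8 1, .back 12 6 1, .back 14 5 1, .up 5 4, .up 6 4, .up 7 4, .back 21 0 0,
    .back 22 2 0, .use 19 0 0]
    (by decide +kernel)

/-- The Hopf link with a component of framing `-1` disappears, too. -/
theorem ring_hopfOne : Moves 0 (tangle .ribbon ++ ring .pos 1 ++ [cup 0]) [] :=
  .calculate [counit_ring.move, ribbon_counit_swap.move,
      (Moves.of_localMove LocalMove.hopf_one).move]
    [.back 0 4 0, .use 1 0 0, .use 2 0 0] (by decide +kernel)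

/-- An annulus around two strands cancels with a `0`-framed circle which passes through it. -/
theorem absorb_two : Moves 2 ([cap 0] ++ shift 1 (ring .pos 3) ++ [cup 0]) [] :=
  .calculate (isotopies ++ [ring_switch_left_one.move, ring_turn_one.move, ring_hopf.move])
    [.use 12 7 1, .up 7 4, .up 9 5, .use 13 3 0, .up 3 1, .back 11 1 0, .up 1 1, .back 10 1 1,
    .back 22 1 1, .back 0 7 1, .use 4 5 1, .up 5 5, .use 4 8 1, .up 11 1, .use 1 7 2,
    .back 22 2 1, .use 1 6 1, .up 7 6, .use 0 0 0, .back 1 4 3, .up 6 2, .use 1 5 1,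
    .use 23 1 1, .up 1 1, .up 5 1, .use 24 0 0]
    (by decide +kernel)

/-! ### Arcs hooked into a strand -/

/-- If an arc hooked into a strand is fused with a second strand, the two strands make a full turn
around each other. -/
theorem hook_ring_two : Moves 2 (hook ++ shift 1 mulRing') [pos 0, pos 0] :=
  .calculate (isotopies ++ [ring_switch_two.move, absorb_one.move])
    [.down 2 6, .back 13 8 0, .back 1 9 1, .use 12 10 0, .back 1 9 2, .use 22 2 1,
    .back 12 12 0, .use 1 11 1, .up 11 2, .use 12 8 0, .up 8 6, .use 0 1 0, .use 23 0 1]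
    (by decide +kernel)

/-- The same for two strands in place of the second strand. -/
theorem hook_ring_three : Moves 3 (hook ++ shift 2 (ring .pos 3) ++ [cup 1]) (full 2) :=
  .calculate (isotopies ++ [ring_switch_three.move, absorb_two.move])
    [.down 2 8, .back 13 10 0, .back 1 11 1, .use 12 12 0, .back 1 11 2, .back 1 12 3,
    .use 22 2 1, .back 12 16 0, .use 1 15 1, .up 15 4, .use 12 10 0, .up 10 8, .use 0 1 0,
    .use 23 0 1]
    (by decide +kernel)

/-- An arc hooked into a strand may be removed by the counit, whose annulus allows to unhook it. -/
theorem hook_counit : Moves 1 (hook ++ shift 1 (tangle .counit)) [] :=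
  .calculate (isotopies ++ [ring_switch_one.move, ring_hopf.move])
    [.up 3 3, .up 4 2, .use 10 1 1, .up 7 1, .back 13 5 2, .up 5 3, .up 6 2, .back 12 3 1,
    .use 11 1 2, .up 1 1, .back 22 1 0, .use 1 5 0, .use 23 0 1]
    (by decide +kernel)

/-- The comultiplication doubles an arc hooked into a strand. -/
theorem hook_comul : Moves 1 (hook ++ shift 1 (tangle .comul)) (hook ++ hook) :=
  .calculate (isotopies ++ [comul_ring.move, hook_ring_three.move])
    [.use 22 3 1, .up 3 3, .up 4 3, .use 23 2 0, .up 2 1, .up 6 3, .use 10 2 2, .back 11 0 0,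
    .up 2 1, .use 6 2 1, .up 7 1, .back 3 4 1, .use 1 3 1, .down 0 3, .use 11 3 0]
    (by decide +kernel)

/-- Fusing a hooked arc with one half of the copairing gives a hooked arc. -/
theorem hook_mul : Moves 1 (shift 1 copairing ++ ring .pos 2 ++ [cup 1]) hook :=
  .calculate (isotopies ++ [hook_ring_two.move, ring_flip_two.move])
    [.up 4 3, .up 5 3, .up 6 3, .up 7 3, .up 8 3, .up 9 3, .use 23 1 0, .down 0 2, .back 10 2 2,
    .use 11 0 0, .up 7 3, .up 8 3, .up 9 3, .up 10 2, .back 12 7 2, .use 13 9 0, .up 4 4,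
    .up 9 6, .use 22 1 0]
    (by decide +kernel)

/-- A strand making a full turn around the first upper end of the comultiplication is moved through
it. -/
theorem full_comul : Moves 3 ([pos 0, pos 0] ++ shift 1 (tangle .comul))
    (shift 1 (tangle .comul) ++ [neg 2, neg 1, pos 0] ++ block .pos 1 3 ++ [pos 0, pos 0]) :=
  .calculate (isotopies ++ [comul_ring.move, ring_switch_three.move])
    [.use 22 2 1, .up 4 3, .up 5 3, .up 4 1, .up 6 2, .down 5 6, .back 13 11 0, .back 1 12 1,
    .use 12 13 0, .back 1 12 2, .back 1 13 3, .up 3 2, .up 5 3, .use 23 3 1, .up 3 2, .up 4 2,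
    .up 5 1, .back 12 17 0, .use 1 16 1, .up 16 4, .use 12 11 0, .up 11 10, .use 0 0 0,
    .back 1 8 5, .up 10 2, .up 11 2, .up 12 2, .back 2 12 0, .back 2 13 0, .up 17 6,
    .back 0 12 2, .up 2 2, .up 4 3, .back 22 0 1, .up 18 2]
    (by decide +kernel)

/-- The multiplication is moved up through the crossing of two pairs of strands. -/
theorem braid_mul : Moves 6 (block .pos 2 2 ++ shift 2 mulRing')
    ([neg 3, neg 2] ++ mulRing' ++ [pos 0, pos 1]) :=
  .calculate (isotopies ++ [ring_past_block_pos_two.move])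
    [.up 2 1, .back 1 0 3, .down 1 2, .back 1 1 2, .down 7 6, .back 22 5 2, .down 4 6,
    .back 22 2 1, .back 13 13 1, .use 0 12 2, .up 12 1, .back 13 10 0, .use 0 9 1, .up 9 1]
    (by decide +kernel)

/-- The two copies of a hooked arc are fused with two further pairs of strands. By `hook_ring_two`
only crossings are left. -/
theorem hook_comul_mul : Moves 5
    (hook ++ shift 1 (tangle .comul) ++ shift 3 (block .pos 2 2) ++ shift 1 mulRing' ++
      shift 3 mulRing')
    ([neg 2, neg 1, pos 0] ++ block .pos 1 3 ++ [pos 0, pos 0]) :=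
  .calculate (isotopies ++ [hook_comul.move, hook_ring_two.move, braid_mul.move])
    [.up 18 4, .up 19 4, .up 18 1, .up 20 2, .up 21 2, .up 22 2, .up 23 2, .up 24 2,
    .use 22 0 0, .up 8 5, .up 9 5, .up 15 10, .up 16 10, .use 23 7 0, .up 5 1, .up 9 2,
    .up 10 2, .up 11 2, .up 12 2, .up 13 2, .up 14 2, .up 15 2, .use 24 3 1, .up 3 3, .up 4 3,
    .down 13 2, .use 23 2 0, .up 7 2]
    (by decide +kernel)

/-! ### The antipode on the left -/

/-- The `0`-framed circle on the right of the strand cancels with the annulus, too. -/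
theorem absorb_one_left : Moves 1 ([cap 1] ++ ring .pos 2 ++ [cup 1]) [] :=
  .calculate (isotopies ++ [ring_flip_two.move, ring_turn_two.move, absorb_one.move])
    [.use 22 1 0, .use 23 1 0, .back 11 1 1, .up 1 1, .up 3 2, .up 4 2, .back 10 3 2, .up 5 1,
    .back 11 3 1, .back 8 2 1, .up 4 1, .back 11 2 0, .up 2 2, .up 5 4, .back 11 2 4, .up 4 1,
    .up 6 2, .back 10 2 3, .up 4 1, .back 10 2 2, .use 13 5 4, .down 6 3, .use 24 1 1,
    .use 8 0 0, .back 24 0 0, .use 24 0 0]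
    (by decide +kernel)

/-- Comultiplication and multiplication are written with annuli. -/
theorem antipode_left_rings : Moves 2 (tangle .comul ++ tangle .antipode ++ tangle .mul)
    (comulRing ++ tangle .antipode ++ mulRing) :=
  .calculate (isotopies ++ [comul_ring.move, mul_ring.move])
    [.use 22 0 0, .up 2 2, .up 3 2, .up 4 1, .use 23 17 0, .up 2 2, .up 4 3]
    (by decide +kernel)

/-- The antipode is moved down past the annulus of the multiplication. -/
theorem antipode_left_straighten : Moves 2 (comulRing ++ tangle .antipode ++ mulRing)
    ([cap 2, cap 3] ++ shift 1 (ring .pos 3) ++ [cup 0] ++ ring .pos 2 ++ [cup 1] ++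
      tangle .antipode) :=
  .calculate (isotopies ++ [ring_past_block_pos_two.move])
    [.up 2 2, .up 3 2, .up 4 1, .up 17 3, .up 18 3, .up 19 3, .up 20 3, .up 21 3, .up 22 3,
    .back 22 12 0, .up 23 4, .back 13 18 1, .up 18 6, .up 19 2, .use 0 11 2, .up 2 2, .up 4 3,
    .down 15 2]
    (by decide +kernel)

/-- Annuli of which one encloses more strands than the other commute. -/
theorem ring_comm : Moves 3 (ring .pos 3 ++ shift 1 (ring .pos 2))
    (shift 1 (ring .pos 2) ++ ring .pos 3) :=
  .calculate (isotopies ++ [ring_past_pos_two.move, ring_past_block_pos_two.move])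
    [.up 8 2, .up 9 2, .up 10 2, .up 11 2, .up 12 2, .up 13 2, .back 23 4 2, .back 22 2 2,
    .up 2 2, .up 3 2, .up 4 2, .up 5 2, .up 6 2, .up 7 2]
    (by decide +kernel)

/-- The annulus of the multiplication is moved above the one of the comultiplication. -/
theorem antipode_left_comm : Moves 2
    ([cap 2, cap 3] ++ shift 1 (ring .pos 3) ++ [cup 0] ++ ring .pos 2 ++ [cup 1] ++
      tangle .antipode)
    ([cap 2, cap 3] ++ shift 2 (ring .pos 2) ++ shift 1 (ring .pos 3) ++ [cup 0, cup 1] ++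
      tangle .antipode) :=
  .calculate (isotopies ++ [ring_comm.move])
    [.down 10 6, .use 22 2 1]
    (by decide +kernel)

/-- Two of the strands inside the annulus of the comultiplication are the legs of one arc. They are
pulled out by switching crossings. -/
theorem antipode_left_pull : Moves 2
    ([cap 2, cap 3] ++ shift 2 (ring .pos 2) ++ shift 1 (ring .pos 3) ++ [cup 0, cup 1] ++
      tangle .antipode)
    ([cap 2, cap 3] ++ shift 2 (ring .pos 2) ++ shift 1 (ring .pos 1) ++ [cup 0, cup 1] ++
      tangle .antipode) :=
  .calculate (isotopies ++ [ring_switch_two.move])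
    [.up 8 8, .up 9 8, .up 17 4, .back 22 4 3, .down 3 2, .use 1 11 4, .up 11 3, .use 1 11 3,
    .up 2 2, .up 5 4, .up 4 2, .up 5 2, .up 6 2, .up 7 2, .up 9 3, .up 10 3, .down 10 3]
    (by decide +kernel)

/-- The half twist and the curl of the antipode cancel in an arc. -/
theorem cap_antipode : Moves 0 ([cap 0] ++ tangle .antipode) [cap 0] :=
  .calculate isotopies [.use 18 0 0, .use 17 1 0] (by decide +kernel)

/-- The annulus of the multiplication cancels with an arc passing through it, and the remaining
annulus is that of the counit. -/
theorem antipode_left_absorb : Moves 2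
    ([cap 2, cap 3] ++ shift 2 (ring .pos 2) ++ shift 1 (ring .pos 1) ++ [cup 0, cup 1] ++
      tangle .antipode)
    (tangle .counit ++ [cap 0]) :=
  .calculate (isotopies ++ [absorb_one_left.move, counit_ring.move, ring_turn_one.move,
       cap_antipode.move])
    [.up 8 8, .up 9 8, .up 10 8, .up 11 8, .up 12 8, .down 6 2, .up 13 2, .use 24 0 1, .up 4 1,
    .use 23 0 0, .up 8 2, .down 11 2, .use 22 6 0, .use 25 5 0, .back 23 0 0]
    (by decide +kernel)

/-! ### The antipode on the right -/

/-- A hooked pair of arcs, seen from the other side. -/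
theorem hooking_neg_reflect : Moves 2 (hooking .neg) [cap 0, neg 1, neg 1, cup 2] :=
  .calculate isotopies
    [.back 10 0 1, .use 13 2 0, .up 2 1, .use 12 2 1, .back 11 0 0]
    (by decide +kernel)

/-- The comultiplication is symmetric under rotation about a vertical axis. -/
theorem comul_reflect : Moves 2 (tangle .comul) (reflect 2 (tangle .comul)) :=
  .calculate (isotopies ++ [hooking_neg_reflect.move])
    [.down 5 2, .use 22 0 0, .up 7 3, .up 8 2, .up 9 2]
    (by decide +kernel)

theorem comul_ring_reflect : Moves 2 (reflect 2 (tangle .comul)) (reflect 2 comulRing) :=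
  .calculate isotopies
    [.up 5 1, .up 8 3, .up 9 3, .use 11 0 0, .up 4 4, .up 5 2, .up 6 2, .back 11 7 3,
    .use 12 9 2, .up 9 1, .use 13 9 3, .up 7 2, .up 8 2, .up 9 2, .up 10 1, .use 13 8 4,
    .up 5 1, .back 1 5 2, .back 4 6 1, .up 4 1, .use 5 4 1, .down 0 4, .use 11 4 0,
    .back 10 2 0, .up 2 2, .up 4 3, .down 5 2, .up 9 2, .up 10 2, .up 11 2, .up 12 2]
    (by decide +kernel)

/-- The other form of the multiplication, with the annulus starting on the right. -/
theorem mul_ringRight : Moves 4 mulRing' (shift 1 (ringRight 2) ++ [cup 0]) :=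
  .calculate (isotopies ++ [ring_flip_two.move, ring_turn_two.move])
    [.use 22 0 1, .use 23 0 1]
    (by decide +kernel)

theorem ringRight_past_pos : Moves 3 (shift 1 (ringRight 2) ++ [pos 0, pos 1])
    ([pos 0, pos 1] ++ ringRight 2) :=
  .calculate isotopies
    [.up 6 2, .back 0 3 0, .use 4 4 0, .back 2 2 0, .up 2 2, .up 9 1, .use 4 6 1, .back 12 8 2,
    .up 6 2, .back 2 2 1, .up 2 1, .back 11 2 2, .down 3 4, .use 1 7 3]
    (by decide +kernel)

theorem ringRight_past_block : Moves 3 (ringRight 2 ++ [pos 1, pos 0])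
    ([pos 1, pos 0] ++ shift 1 (ringRight 2)) :=
  .calculate isotopies
    [.back 0 1 3, .down 2 4, .use 10 0 2, .use 13 6 2, .up 8 1, .use 2 5 1, .up 5 2, .up 9 2,
    .back 3 1 1, .up 1 1, .use 2 5 0, .back 3 3 0, .up 3 2, .use 1 5 0]
    (by decide +kernel)

theorem ringRight_comm : Moves 3 (ringRight 3 ++ ringRight 2) (ringRight 2 ++ ringRight 3) :=
  .calculate (isotopies ++ [ringRight_past_pos.move, ringRight_past_block.move])
    [.up 8 2, .up 9 2, .up 10 2, .up 11 2, .up 12 2, .up 13 2, .back 22 4 0, .back 23 2 0,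
    .up 2 2, .up 3 2, .up 4 2, .up 5 2, .up 6 2, .up 7 2]
    (by decide +kernel)

theorem ringRight_switch : Moves 3 (ringRight 2 ++ [neg 1, neg 0])
    (ringRight 2 ++ [pos 1, pos 0]) :=
  .calculate (isotopies ++ [ring_flip_two.move, ring_turn_two.move, ring_switch_left_two.move])
    [.back 23 0 0, .back 22 0 0, .use 24 0 0, .use 22 0 0, .use 23 0 0]
    (by decide +kernel)

/-- The proof on the right is the mirror image, under rotation about a vertical axis, of the one on
the left: comultiplication and multiplication are written with annuli. -/
theorem antipode_right_rings : Moves 2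
    (tangle .comul ++ shift 2 (reflect 2 (tangle .antipode)) ++ mulRing')
    (reflect 2 comulRing ++ shift 2 (reflect 2 (tangle .antipode)) ++ shift 1 (ringRight 2) ++
      [cup 0]) :=
  .calculate (isotopies ++ [comul_reflect.move, comul_ring_reflect.move, mul_ringRight.move])
    [.up 15 4, .up 16 4, .up 17 3, .up 18 3, .up 19 3, .up 20 3, .up 21 3, .use 22 0 0, .up 5 1,
    .up 8 3, .up 9 3, .up 13 2, .up 19 7, .up 20 7, .up 21 7, .use 24 15 0, .up 7 3, .up 8 2,
    .up 9 2, .up 21 2, .use 23 0 0, .down 21 2]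
    (by decide +kernel)

/-- The antipode is moved down past the annulus of the multiplication. -/
theorem antipode_right_straighten : Moves 2
    (reflect 2 comulRing ++ shift 2 (reflect 2 (tangle .antipode)) ++ shift 1 (ringRight 2) ++
      [cup 0])
    ([cap 0, cap 1] ++ shift 2 (ringRight 3) ++ [cup 4] ++ shift 2 (ringRight 2) ++ [cup 1] ++
      reflect 2 (tangle .antipode)) :=
  .calculate (isotopies ++ [ringRight_past_pos.move])
    [.up 11 9, .up 12 4, .up 13 3, .up 23 2, .use 10 14 3, .upLeft 17 1, .up 16 2, .up 18 3,
    .up 19 3, .up 20 3, .up 21 3, .up 22 3, .up 23 3, .up 9 1, .up 11 2, .up 12 2, .up 13 2,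
    .down 18 2, .back 22 12 1, .up 18 2, .up 20 3, .back 10 21 1, .use 12 16 0, .up 16 13,
    .use 0 2 0, .down 15 2]
    (by decide +kernel)

/-- The annulus of the multiplication is moved above the one of the comultiplication. -/
theorem antipode_right_comm : Moves 2
    ([cap 0, cap 1] ++ shift 2 (ringRight 3) ++ [cup 4] ++ shift 2 (ringRight 2) ++ [cup 1] ++
      reflect 2 (tangle .antipode))
    ([cap 0, cap 1] ++ shift 2 (ringRight 2) ++ shift 2 (ringRight 3) ++ [cup 4, cup 1] ++
      reflect 2 (tangle .antipode)) :=
  .calculate (isotopies ++ [ringRight_comm.move])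
    [.up 17 2, .down 15 2, .upLeft 11 1, .down 11 7, .use 22 2 2, .up 18 2]
    (by decide +kernel)

/-- The legs of one arc are pulled out of the annulus of the comultiplication. -/
theorem antipode_right_pull : Moves 2
    ([cap 0, cap 1] ++ shift 2 (ringRight 2) ++ shift 2 (ringRight 3) ++ [cup 4, cup 1] ++
      reflect 2 (tangle .antipode))
    ([cap 0, cap 1] ++ shift 2 (ringRight 2) ++ shift 4 (ringRight 1) ++ [cup 4, cup 1] ++
      reflect 2 (tangle .antipode)) :=
  .calculate (isotopies ++ [ringRight_switch.move])
    [.up 8 6, .up 9 6, .up 17 4, .up 18 3, .back 22 4 2, .up 4 2, .up 5 2, .up 6 2, .up 7 2,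
    .up 8 2, .up 9 2, .use 1 11 2, .up 11 5, .use 1 11 1, .down 6 4, .up 12 2, .up 13 2,
    .up 14 2]
    (by decide +kernel)

theorem absorb_one_ringRight : Moves 1 ([cap 0] ++ shift 1 (ringRight 2) ++ [cup 0]) [] :=
  .calculate (isotopies ++ [ring_flip_two.move, ring_turn_two.move, absorb_one.move])
    [.back 23 1 1, .back 22 1 1, .use 24 0 0]
    (by decide +kernel)

theorem cap_antipode_reflect : Moves 0 ([cap 0] ++ reflect 2 (tangle .antipode)) [cap 0] :=
  .calculate isotopies [.back 14 2 1, .use 20 0 0, .use 17 1 1] (by decide +kernel)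

theorem ring_turn_one_symm : Moves 1 (ringRight 1) (ring .pos 1) :=
  .calculate (isotopies ++ [ring_turn_one.move]) [.back 22 0 0] (by decide +kernel)

/-- The annulus of the multiplication cancels with an arc passing through it, and the remaining
annulus is that of the counit. -/
theorem antipode_right_absorb : Moves 2
    ([cap 0, cap 1] ++ shift 2 (ringRight 2) ++ shift 4 (ringRight 1) ++ [cup 4, cup 1] ++
      reflect 2 (tangle .antipode))
    (tangle .counit ++ [cap 0]) :=
  .calculate (isotopies ++ [absorb_one_ringRight.move, ring_turn_one_symm.move,
       counit_ring_right.move, cap_antipode_reflect.move])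
    [.up 13 5, .up 14 5, .up 15 5, .up 16 5, .up 17 5, .use 22 1 1, .use 25 0 0, .use 23 1 2,
    .use 24 1 2, .down 0 5, .back 23 0 1, .up 4 1, .back 25 5 0, .use 25 5 0]
    (by decide +kernel)

/-! ### Circles with a curl -/

/-- A strand which passes through an annulus together with a circle of framing `-1` is slid over
this circle. -/
theorem slide_loop_one : Moves 1 ([cap 1] ++ shift 2 (loop .neg) ++ ringRight 2 ++ [cup 1])
    ([cap 1, cap 2, cup 0, cap 0, cap 5, cap 6] ++ shift 3 (block .neg 2 2) ++ [cup 6, cup 5] ++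
      ringRight 3 ++ [cup 2, cup 1]) :=
  .slide [] [true] 1 [true]
    (shift 2 (loop .neg) ++ ringRight 2 ++ [cup 1]) (by decide +kernel)

/-- Two parallel strands with the framing of a curl: each has a curl, and they make a full turn
around each other. -/
theorem cabled_loop : Moves 2 ([cap 2, cap 3] ++ block .neg 2 2 ++ [cup 3, cup 2])
    (loop .neg ++ shift 1 (loop .neg) ++ [neg 0, neg 0]) :=
  .calculate isotopies
    [.up 2 1, .up 4 2, .up 6 1, .back 12 4 2, .up 3 2, .up 4 2, .up 5 1, .back 12 3 1,
    .back 0 2 2, .use 4 3 2, .up 6 1, .back 11 1 2, .use 1 2 3, .back 7 4 0, .up 7 1,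
    .use 12 2 1, .down 0 4, .use 15 4 1, .use 11 4 1, .back 0 6 0, .back 12 7 0, .back 2 5 0,
    .up 5 1, .use 1 3 0, .back 11 3 1, .up 3 3, .up 5 4, .up 6 4, .back 11 0 0, .back 15 0 0]
    (by decide +kernel)

/-- The strand, which now passes through the annulus back and forth, is pulled out of it. -/
theorem slide_loop_one_isotopy : Moves 1
    ([cap 1, cap 2, cup 0, cap 0, cap 5, cap 6] ++ shift 3 (block .neg 2 2) ++ [cup 6, cup 5] ++
      ringRight 3 ++ [cup 2, cup 1])
    ([cap 0, cap 3, cap 4] ++ shift 1 (block .neg 2 2) ++ [cup 4, cup 3] ++ ringRight 1 ++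
      [cup 0]) :=
  .calculate isotopies
    [.up 2 1, .up 12 8, .up 13 8, .up 14 8, .up 15 8, .up 16 8, .up 17 8, .up 18 8, .up 19 8,
    .up 14 1, .up 16 2, .up 20 5, .up 19 1, .up 21 1, .use 9 0 0, .down 1 2, .use 10 3 0,
    .use 1 4 0, .back 11 3 0, .up 3 2, .use 1 4 1, .back 9 0 0, .down 3 12, .use 8 15 0,
    .use 9 0 0, .up 5 4, .up 9 7, .up 7 4, .up 10 6, .up 9 4, .up 12 6, .up 12 5, .up 13 5]
    (by decide +kernel)

/-- The two parallel strands of the curl are separated; the strand itself gets a curl. -/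
theorem slide_loop_one_rings : Moves 1
    ([cap 0, cap 3, cap 4] ++ shift 1 (block .neg 2 2) ++ [cup 4, cup 3] ++ ringRight 1 ++ [cup 0])
    ([cap 0] ++ shift 1 (loop .neg) ++ shift 1 (ring .pos 1) ++ [cup 0] ++ loop .neg) :=
  .calculate (isotopies ++ [cabled_loop.move, ring_turn_one.move, ring_switch_left_one.move])
    [.up 9 8, .up 10 8, .up 11 8, .up 12 8, .up 7 1, .up 9 2, .up 13 5, .up 12 1, .back 23 1 0,
    .up 9 3, .up 10 2, .up 12 2, .down 11 2, .use 22 5 1, .up 1 1, .up 5 3, .up 6 3, .up 7 3,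
    .back 20 1 2, .use 13 10 0, .down 0 2, .up 6 4, .up 7 4, .up 8 4, .up 9 4, .back 24 6 0,
    .up 6 4, .up 7 4, .up 8 4, .up 9 4, .back 12 10 0, .use 1 9 1, .up 9 3, .use 10 2 0,
    .up 6 1, .back 13 4 1, .up 4 1, .back 12 4 0, .use 11 2 1, .up 6 1, .back 23 2 1,
    .back 0 5 3, .up 7 2, .back 24 2 1, .use 20 0 0, .use 24 4 1, .up 4 3, .use 0 8 1,
    .down 1 3]
    (by decide +kernel)

/-- The Hopf link with a component of framing `-1`, in another position. -/
theorem loop_ring_hopfOne : Moves 0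
    ([cap 0] ++ shift 1 (loop .neg) ++ shift 1 (ring .pos 1) ++ [cup 0])
    [] :=
  .calculate (isotopies ++ [counit_ring.move, ring_hopfOne.move, ring_turn_one.move])
    [.back 20 0 0, .use 24 2 1, .up 6 1, .use 22 2 0, .up 2 2, .use 18 1 2, .down 0 4,
    .use 23 0 0]
    (by decide +kernel)

/-- A circle of framing `-1` passing through an annulus around a strand is absorbed, together with
the annulus, into a curl of the strand. -/
theorem absorb_loop_one : Moves 1 ([cap 1] ++ shift 2 (loop .neg) ++ ringRight 2 ++ [cup 1])
    (loop .neg) :=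
  .calculate (isotopies ++ [slide_loop_one.move, slide_loop_one_isotopy.move,
       slide_loop_one_rings.move, loop_ring_hopfOne.move])
    [.use 22 0 0, .use 23 0 0, .use 24 0 0, .use 25 0 0]
    (by decide +kernel)

/-- The second of two strands which pass through an annulus together with a circle of framing `-1`
is slid over this circle. -/
theorem slide_loop_two : Moves 2 ([cap 2] ++ shift 3 (loop .neg) ++ ringRight 3 ++ [cup 2])
    ([cap 2, cap 3, cup 1, cap 1, cap 6, cap 7] ++ shift 4 (block .neg 2 2) ++ [cup 7, cup 6] ++
      ringRight 4 ++ [cup 3, cup 2]) :=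
  .slide [false] [true] 2 [true]
    (shift 3 (loop .neg) ++ ringRight 3 ++ [cup 2]) (by decide +kernel)

/-- The strand, which now passes through the annulus back and forth, is pulled out of it. -/
theorem slide_loop_two_isotopy : Moves 2
    ([cap 2, cap 3, cup 1, cap 1, cap 6, cap 7] ++ shift 4 (block .neg 2 2) ++ [cup 7, cup 6] ++
      ringRight 4 ++ [cup 3, cup 2])
    ([cap 1, cap 4, cap 5] ++ shift 2 (block .neg 2 2) ++ [cup 5, cup 4] ++ ringRight 2 ++
      [cup 1]) :=
  .calculate isotopies
    [.up 2 1, .up 12 8, .up 13 8, .up 14 8, .up 15 8, .up 16 8, .up 17 8, .up 18 8, .up 19 8,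
    .up 20 8, .up 21 8, .up 16 1, .up 18 2, .up 22 5, .up 21 1, .up 23 1, .use 9 0 1, .down 1 2,
    .use 10 3 1, .use 1 4 1, .down 3 2, .back 11 5 1, .use 1 6 2, .down 5 2, .back 9 0 1,
    .down 9 8, .use 8 17 1, .use 9 0 1, .up 7 6, .up 11 9, .up 9 6, .up 12 8, .up 11 6,
    .up 14 8, .up 14 7, .up 15 7]
    (by decide +kernel)

/-- The two parallel strands of the curl are separated. -/
theorem slide_loop_two_rings : Moves 2
    ([cap 1, cap 4, cap 5] ++ shift 2 (block .neg 2 2) ++ [cup 5, cup 4] ++ ringRight 2 ++ [cup 1])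
    ([cap 1] ++ shift 2 (loop .neg) ++ ring .pos 2 ++ [neg 2, neg 2, cup 1] ++
      shift 1 (loop .neg)) :=
  .calculate (isotopies ++ [cabled_loop.move, ring_turn_two.move, ring_flip_two.move])
    [.up 9 8, .up 10 8, .up 11 8, .up 12 8, .up 13 8, .up 14 8, .use 22 7 2, .up 7 6, .up 8 6,
    .up 9 6, .back 20 0 1, .back 1 2 2, .down 3 7, .up 13 1, .use 5 10 2, .back 10 9 3,
    .up 11 1, .back 13 12 3, .use 0 11 4, .back 12 10 2, .back 23 3 0, .up 3 3, .up 4 3,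
    .down 4 4, .back 1 10 4, .use 11 9 3, .up 14 1, .back 4 11 3, .use 0 10 3, .up 2 2, .up 3 2,
    .back 24 2 0, .up 2 2, .up 3 2, .use 12 11 2, .up 11 2, .up 13 3, .use 12 12 1, .use 20 2 3,
    .up 2 2, .up 3 2, .up 4 2, .up 5 2]
    (by decide +kernel)

theorem cup_under_twist : Moves 4 (block .neg 3 1 ++ [neg 0, pos 1, pos 2, cup 1])
    [cup 1, neg 0, neg 0] :=
  .calculate isotopies
    [.use 12 5 1, .use 0 4 1, .up 4 2, .back 12 1 1, .use 1 0 2]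
    (by decide +kernel)

theorem loop_past_twist : Moves 2 ([neg 0, neg 0] ++ shift 1 (loop .neg))
    (shift 1 (loop .neg) ++ [neg 0, neg 0]) :=
  .calculate isotopies
    [.back 0 4 0, .up 2 1, .up 6 1, .use 6 2 0, .back 11 1 1, .up 3 1, .back 12 4 1, .use 1 3 2,
    .back 0 2 2, .up 4 2, .use 13 4 1, .up 3 1, .use 10 1 1, .back 5 2 0, .up 2 1, .up 5 1,
    .use 1 0 0]
    (by decide +kernel)

/-- By means of the annulus, the full turn of the second strand around the circle is replaced by one
around the first strand. -/
theorem slide_loop_two_switch : Moves 2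
    ([cap 1] ++ shift 2 (loop .neg) ++ ring .pos 2 ++ [neg 2, neg 2, cup 1] ++ shift 1 (loop .neg))
    ([cap 1] ++ shift 2 (loop .neg) ++ ring .pos 2 ++ [cup 1] ++ shift 1 (loop .neg) ++
      [neg 0, neg 0]) :=
  .calculate (isotopies ++ [ring_switch_left_two.move, cup_under_twist.move, loop_past_twist.move])
    [.up 4 4, .up 5 4, .back 20 2 3, .use 13 9 1, .back 0 10 1, .back 12 11 1, .use 20 2 3,
    .up 6 3, .up 7 3, .up 8 3, .up 9 3, .back 0 12 0, .up 2 2, .up 7 6, .up 8 6, .up 9 6,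
    .up 10 6, .back 22 5 0, .up 5 5, .up 6 5, .up 7 4, .up 8 4, .up 9 4, .up 10 4, .use 23 10 0,
    .up 10 1, .use 24 11 0, .up 2 2, .up 7 6, .up 8 6, .up 10 7]
    (by decide +kernel)

/-- For two strands, a circle of framing `-1` is absorbed into a full negative twist of the strands,
including their framings. -/
theorem absorb_loop_two : Moves 2 ([cap 2] ++ shift 3 (loop .neg) ++ ringRight 3 ++ [cup 2])
    (loop .neg ++ shift 1 (loop .neg) ++ [neg 0, neg 0]) :=
  .calculate (isotopies ++ [slide_loop_two.move, slide_loop_two_isotopy.move,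
       slide_loop_two_rings.move, slide_loop_two_switch.move, absorb_loop_one.move,
       ring_turn_two.move, ring_flip_two.move])
    [.use 22 0 0, .use 23 0 0, .use 24 0 0, .use 25 0 0, .up 4 3, .up 5 3, .up 6 3, .up 7 3,
    .up 8 3, .up 9 3, .up 10 1, .use 28 1 0, .use 27 1 0, .up 7 6, .up 8 6, .up 10 7,
    .use 26 0 0]
    (by decide +kernel)

/-! ### The copairing -/

/-- The comultiplication of the ribbon element contains a circle of framing `-1`. -/
theorem ribbon_comul_ring : Moves 0 (tangle .ribbon ++ tangle .comul)
    ([cap 0, cap 1, cap 4] ++ shift 5 (loop .neg) ++ shift 2 (ringRight 3) ++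
      [cup 4, pos 0, pos 1]) :=
  .calculate (isotopies ++ [comul_reflect.move, comul_ring_reflect.move])
    [.use 22 4 0, .use 23 4 0, .up 4 4, .up 5 4, .up 15 13, .up 16 4, .back 18 3 4, .use 20 3 4,
    .down 2 9, .up 13 2, .up 14 2, .up 15 2, .up 16 2]
    (by decide +kernel)

/-- The circle of framing `-1` is absorbed into a full twist. -/
theorem ribbon_comul_absorb : Moves 0
    ([cap 0, cap 1, cap 4] ++ shift 5 (loop .neg) ++ shift 2 (ringRight 3) ++ [cup 4, pos 0, pos 1])
    ([cap 0, cap 1] ++ shift 2 (loop .neg) ++ shift 3 (loop .neg) ++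
      [neg 2, neg 2, pos 0, pos 1]) :=
  .calculate (isotopies ++ [absorb_loop_two.move])
    [.up 15 13, .use 22 3 2, .down 2 8]
    (by decide +kernel)

/-- The full twist of two arcs is the copairing, up to curls. -/
theorem ribbon_comul_copairing : Moves 0
    ([cap 0, cap 1] ++ shift 2 (loop .neg) ++ shift 3 (loop .neg) ++ [neg 2, neg 2, pos 0, pos 1])
    (copairing ++ loop .neg ++ shift 2 (loop .neg)) :=
  .calculate isotopies
    [.up 5 4, .up 6 4, .up 7 4, .up 10 5, .back 20 0 0, .down 3 3, .back 20 2 1, .back 1 3 2,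
    .up 7 1, .back 4 4 1, .use 11 2 1, .use 0 3 1, .down 1 2, .use 2 3 0, .down 0 2,
    .use 10 2 0, .use 1 3 0, .use 18 2 1, .up 6 3, .use 11 2 1, .back 0 5 3, .up 7 2,
    .use 13 7 2, .up 6 1, .use 10 4 2, .back 5 5 1, .up 5 1, .up 8 1, .use 1 8 1, .use 18 0 0,
    .up 4 3, .up 5 3, .up 6 3]
    (by decide +kernel)

/-- The curls in the two factors are undone by multiplication with the inverse of the ribbon
element. -/
theorem copairing_loops : Moves 0
    (copairing ++ loop .neg ++ shift 2 (loop .neg) ++ loop .pos ++ shift 2 (loop .pos))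
    copairing :=
  .calculate isotopies
    [.up 4 3, .up 5 3, .up 6 3, .up 10 6, .up 11 6, .up 12 6, .use 17 10 2, .use 17 1 0]
    (by decide +kernel)

/-! ### Curls and the boundary tangle -/

/-- In a boundary tangle, a curl of one strand of a pair may be moved to the other one, since both
lower ends belong to the same arc. -/
theorem boundary_loop_neg : Moves 2 ([cap 0] ++ mulRing ++ loop .neg)
    ([cap 0] ++ mulRing ++ shift 1 (loop .neg)) :=
  .calculate isotopies
    [.up 7 2, .use 12 6 1, .up 8 7, .up 9 7, .up 10 7, .up 9 3, .up 10 1, .back 18 0 0,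
    .use 10 2 1, .back 1 4 0, .up 2 1, .use 5 2 0, .up 1 1, .use 11 1 0, .up 7 6, .up 8 6,
    .up 10 7, .use 0 5 0, .back 12 7 1, .back 0 5 2, .use 10 4 1, .up 9 1, .back 3 6 1,
    .use 1 5 1, .use 20 4 2, .up 8 3, .up 9 3, .up 10 3, .back 10 4 1, .up 4 3, .up 6 4,
    .back 11 1 0, .up 1 1, .back 10 1 1, .down 5 2]
    (by decide +kernel)

theorem boundary_loop_pos : Moves 2 ([cap 0] ++ mulRing ++ loop .pos)
    ([cap 0] ++ mulRing ++ shift 1 (loop .pos)) :=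
  .calculate isotopies
    [.up 7 2, .use 12 6 1, .up 8 7, .up 9 7, .up 10 7, .up 9 3, .up 10 1, .back 19 0 0,
    .use 10 2 1, .back 1 4 0, .up 2 1, .use 7 2 0, .up 1 1, .use 11 1 0, .up 7 6, .up 8 6,
    .up 10 7, .use 0 5 0, .back 12 7 1, .back 0 5 2, .use 10 4 1, .up 9 1, .back 5 6 1,
    .use 1 5 1, .use 21 4 2, .up 8 3, .up 9 3, .up 10 3, .back 10 4 1, .up 4 3, .up 6 4,
    .back 11 1 0, .up 1 1, .back 10 1 1, .down 5 2]
    (by decide +kernel)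

/-- A pair of strands inserted in the middle may be fused with the first pair before or after it is
fused with the last pair. -/
theorem mul_boundary : Moves 4 ([cap 2] ++ mulRing' ++ mulRing)
    ([cap 2] ++ shift 2 mulRing ++ mulRing') :=
  .calculate isotopies
    [.up 8 7, .up 9 7, .up 10 7, .up 11 7, .up 12 7, .up 13 7, .up 14 7]
    (by decide +kernel)

/-- Multiplication by the ribbon element adds a curl to one strand. -/
theorem ribbon_mul_moves : Moves 2 (tangle .ribbon ++ mulRing) ([cap 0] ++ mulRing ++ loop .neg) :=
  .calculate isotopies
    [.up 10 2, .back 10 1 0, .up 4 3, .up 5 3, .up 6 3, .up 7 3, .up 8 3, .up 9 3, .up 10 3,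
    .use 10 8 0, .down 5 2]
    (by decide +kernel)

theorem ribbonInv_mul_moves : Moves 2 (tangle .ribbonInv ++ mulRing)
    ([cap 0] ++ mulRing ++ loop .pos) :=
  .calculate isotopies
    [.up 10 2, .back 11 1 0, .up 4 3, .up 5 3, .up 6 3, .up 7 3, .up 8 3, .up 9 3, .up 10 3,
    .use 11 8 0, .down 5 2]
    (by decide +kernel)

theorem mul_ribbon_moves : Moves 2 (shift 2 (tangle .ribbon) ++ mulRing')
    ([cap 2] ++ mulRing' ++ shift 1 (loop .neg)) :=
  .calculate isotopies
    [.up 4 4, .up 5 4, .back 18 2 4, .use 20 2 4, .up 2 2, .up 6 3, .up 7 3, .up 8 3, .up 9 3,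
    .up 10 3]
    (by decide +kernel)

theorem ribbonInv_loop : Moves 0 (tangle .ribbonInv ++ loop .neg) [cap 0] :=
  .calculate isotopies [.use 16 1 0] (by decide +kernel)

/-! ### Non-degeneracy of the copairing -/

/-- The copairing and the other half of it form a boundary tangle. This makes the copairing
non-degenerate. -/
theorem copairing_snake_left : Moves 2 (copairing ++ [neg 3, neg 3, cup 4, cup 2]) boundary :=
  .calculate (isotopies ++ [ring_flip_two.move, boundary_left.move])
    [.down 3 2, .up 7 1, .back 13 5 1, .up 7 2, .back 11 1 1, .down 5 2, .back 22 1 1,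
    .use 23 0 0]
    (by decide +kernel)

theorem copairing_snake_right : Moves 2 (shift 2 copairing ++ [neg 1, neg 1, cup 2, cup 0])
    boundary :=
  .calculate (isotopies ++ [boundary_right.move])
    [.up 4 3, .up 5 3, .up 7 4, .back 10 0 1, .up 4 2, .up 5 2, .up 6 2, .up 7 1, .back 12 5 1,
    .up 2 2, .use 22 0 0]
    (by decide +kernel)

/-- An arc hooked into the strand in an annulus may be unhooked. -/
theorem ring_hook : Moves 1 (ringRight 1 ++ hook) (ringRight 1 ++ [cap 1]) :=
  .calculate (isotopies ++ [ring_turn_one.move, ring_switch_left_one.move])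
    [.back 22 0 0, .up 4 4, .back 23 1 0, .down 0 4, .use 1 5 0, .back 0 5 0, .use 22 0 0,
    .use 0 5 0]
    (by decide +kernel)

theorem hook_ringRight : Moves 1 (hook ++ ringRight 1) (ringRight 1 ++ hook) :=
  .calculate isotopies
    [.back 1 4 2, .down 5 2, .use 11 3 1, .up 3 1, .use 2 3 0, .use 2 4 0, .use 12 7 1,
    .use 0 6 1, .up 6 1, .back 11 0 0, .back 0 3 3, .up 5 2, .up 6 2, .up 8 3, .use 13 7 2,
    .up 6 3, .use 10 2 2, .up 2 1, .use 6 2 1, .up 7 1, .back 3 4 1, .up 8 2, .use 1 3 1,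
    .down 0 4, .use 11 4 0]
    (by decide +kernel)

theorem comul_unit_moves : Moves 0 ([cap 0] ++ tangle .comul) [cap 0, cap 2] :=
  .calculate (isotopies ++ [comul_ring.move, absorb_two.move])
    [.use 22 1 0, .down 0 2, .use 23 2 0, .use 10 1 1, .use 1 2 1]
    (by decide +kernel)

/-! ### Composites with a hooked arc -/

/-- Both sides hook three arcs into the strand. -/
theorem hook_coassoc : Moves 1 (hook ++ shift 1 (tangle .comul) ++ shift 1 (tangle .comul))
    (hook ++ shift 1 (tangle .comul) ++ shift 3 (tangle .comul)) :=
  .calculate (isotopies ++ [hook_comul.move])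
    [.down 19 2, .use 22 0 0, .up 13 2, .use 22 3 0, .back 22 0 0, .down 13 3, .down 12 3,
    .down 11 3, .down 10 3, .down 9 3, .down 8 5, .down 7 3, .upLeft 7 1, .down 7 2, .down 5 3,
    .down 4 3, .down 3 3, .back 22 0 0, .up 21 2]
    (by decide +kernel)

theorem hook_counit_comul : Moves 1 (hook ++ shift 1 (tangle .comul) ++ shift 1 (tangle .counit))
    hook :=
  .calculate (isotopies ++ [hook_comul.move, hook_counit.move])
    [.use 22 0 0, .use 23 3 0]
    (by decide +kernel)

theorem hook_comul_counit : Moves 1 (hook ++ shift 1 (tangle .comul) ++ shift 3 (tangle .counit))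
    hook :=
  .calculate (isotopies ++ [hook_comul.move, hook_counit.move])
    [.use 22 0 0, .up 6 3, .up 7 3, .up 8 3, .up 9 3, .up 10 3, .use 23 0 0]
    (by decide +kernel)

/-- Closing one of two hooked arcs leaves an annulus around the strand, from which the other arc is
unhooked. -/
theorem hook_integral_left : Moves 1 (hook ++ shift 1 (tangle .comul) ++ [cup 3])
    (ringRight 1 ++ [cap 1]) :=
  .calculate (isotopies ++ [hook_comul.move, ring_hook.move])
    [.use 22 0 0, .up 6 3, .use 23 0 0]
    (by decide +kernel)

theorem hook_integral_right : Moves 1 (hook ++ shift 1 (tangle .comul) ++ [cup 1])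
    (ringRight 1 ++ [cap 1]) :=
  .calculate (isotopies ++ [hook_comul.move, ring_hook.move, hook_ringRight.move])
    [.use 22 0 0, .use 24 0 0, .use 23 0 0]
    (by decide +kernel)

/-- The multiplication with a hooked arc is the full turn of `hook_ring_two`, which is moved through
the comultiplication. -/
theorem hook_comul_mul_eq : Moves 3 (hook ++ shift 1 mulRing' ++ shift 1 (tangle .comul))
    (hook ++ shift 1 (tangle .comul) ++ shift 5 (tangle .comul) ++ shift 3 (block .pos 2 2) ++
      shift 1 mulRing' ++ shift 3 mulRing') :=
  .calculate (isotopies ++ [hook_ring_two.move, full_comul.move, hook_comul_mul.move])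
    [.down 15 2, .use 22 0 0, .up 9 2, .use 23 0 0, .down 5 2, .back 24 11 0, .down 10 27,
    .down 9 27, .down 8 27, .down 7 27, .down 24 7, .down 23 2, .down 22 8, .down 6 23,
    .down 5 23, .down 19 2, .down 4 16, .upLeft 4 1, .down 4 2, .upLeft 7 1, .down 7 4,
    .upLeft 12 1, .down 12 7, .down 2 16, .down 1 16, .down 0 16, .down 13 2, .down 12 2,
    .down 11 2, .down 8 4, .down 33 4, .down 32 4, .down 31 4, .down 30 4, .up 30 1, .up 29 1,
    .down 27 8, .down 26 8, .down 25 8, .down 24 8, .down 23 8, .down 22 7, .down 21 6,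
    .down 11 19, .down 10 19, .up 10 1, .up 9 1]
    (by decide +kernel)

/-- The reflected antipode has its curl in the other strand. -/
theorem antipode_reflect : Moves 2 (reflect 2 (tangle .antipode))
    ([pos 0] ++ shift 1 (loop .pos)) :=
  .calculate isotopies [.back 14 1 1] (by decide +kernel)

/-- The comultiplication doubles the hooked arc, and the first factors of two copairings hooked in
this way are fused. -/
theorem copairing_comul : Moves 0 (copairing ++ shift 2 (tangle .comul))
    (copairing ++ shift 2 copairing ++ tangle .mul) :=
  .calculate (isotopies ++ [hook_comul.move, hook_mul.move, mul_ring.move])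
    [.use 22 1 1, .back 23 4 1, .back 24 8 0]
    (by decide +kernel)

/-- Both factors of the copairing are closed to a Hopf link. -/
theorem copairing_integral : Moves 0 (copairing ++ [cup 2, cup 0]) [] :=
  .calculate (isotopies ++ [ring_hopf.move])
    [.up 1 1, .up 5 1, .use 22 0 0]
    (by decide +kernel)

theorem ribbon_ribbonInv_swap : Moves 0
    (tangle .ribbon ++ shift 2 (tangle .ribbonInv) ++ tangle .mul)
    (tangle .ribbonInv ++ tangle .ribbon ++ tangle .mul) :=
  .calculate isotopies
    [.up 8 4, .up 9 3, .up 5 5, .up 7 6, .up 8 6, .up 9 6]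
    (by decide +kernel)

end Bare

/-! ### Equality of tangles, in terms of words -/

theorem Bare.strip_shift_fill (i b a : ℕ) (w : Bare) :
    strip (HopfTangle.shift i b (fill a w)) = Bare.shift i w := by
  induction w generalizing a with
  | nil => rfl
  | cons s w ih =>
    have := ih (a - src s.2 + tgt s.2)
    simp only [strip, Bare.shift, fill, shift_cons, List.map_cons] at this ⊢
    rw [this]

theorem Bare.shift_zero (w : Bare) : Bare.shift 0 w = w := by
  simp [Bare.shift]

/-- Diagrams lying next to each other may be moved past each other vertically. -/
theorem Moves.interchange_word {a c : ℕ} {u v : Bare} (hu : fits a u = true)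
    (hv : fits c v = true) :
    Moves (a + c) (u ++ Bare.shift (width a u) v) (Bare.shift a v ++ u) := by
  have := Moves.of_localMove (LocalMove.isIsotopyCong.interchange_word (typed_fill hu)
    (typed_fill hv))
  have e : ∀ x y : Word TangleGen, strip (x ++ y) = strip x ++ strip y := fun x y => by
    simp [strip]
  simpa only [e, strip_shift_fill, Bare.shift_zero] using this

/-- The next point after `p` on a strand followed downwards (`true`) or upwards (`false`), together
with the new direction. -/
def nextPoint (w : Word TangleGen) : Bool → ℕ × ℕ → Option (Bool × ℕ × ℕ)
  | true, (t, i) => w[t]?.bind fun s =>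
    if i < s.left then some (true, t + 1, i)
    else if s.left + src s.gen ≤ i then
      if i < s.dom then some (true, t + 1, s.left + tgt s.gen + (i - (s.left + src s.gen)))
      else none
    else match s.gen with
      | .max => none
      | .min => some (false, t, 2 * s.left + 1 - i)
      | _ => some (true, t + 1, 2 * s.left + 1 - i)
  | false, (0, _) => none
  | false, (t + 1, i) => w[t]?.bind fun s =>
    if i < s.left then some (false, t, i)
    else if s.left + tgt s.gen ≤ i then
      if i < s.cod then some (false, t, s.left + src s.gen + (i - (s.left + tgt s.gen))) else none
    else match s.gen with
      | .max => some (true, t + 1, 2 * s.left + 1 - i)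
      | .min => none
      | _ => some (false, t, 2 * s.left + 1 - i)

theorem Connected.of_nextPoint {w : Word TangleGen} {d e : Bool} {p q : ℕ × ℕ}
    (h : nextPoint w d p = some (e, q)) : Connected w p q := by
  obtain ⟨t, i⟩ := p
  cases d with
  | true =>
    simp only [nextPoint, Option.bind_eq_some_iff] at h
    obtain ⟨⟨l, g, r⟩, hs, h⟩ := h
    simp only [Slice.dom] at h
    split at h
    · rename_i h1
      simp only [Option.some.injEq, Prod.mk.injEq] at h
      obtain ⟨-, rfl⟩ := h
      exact of_joins hs (.inl ⟨i, h1, rfl, rfl⟩)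
    split at h
    · obtain ⟨h3, h⟩ := Option.ite_none_right_eq_some.1 h
      simp only [Option.some.injEq, Prod.mk.injEq] at h
      obtain ⟨-, rfl⟩ := h
      refine of_joins hs (.inr (.inl ⟨i - (l + src g), by dsimp only; omega, ?_, rfl⟩))
      simp only [Prod.mk.injEq, true_and]; omega
    · have hi : i = l ∨ i = l + 1 := by
        have : src g ≤ 2 := by cases g <;> decide
        omega
      have e1 : 2 * l + 1 - l = l + 1 := by omega
      have e2 : 2 * l + 1 - (l + 1) = l := by omega
      cases g <;> simp only [Option.some.injEq, Prod.mk.injEq, reduceCtorEq] at h <;>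
        obtain ⟨-, rfl⟩ := h <;> rcases hi with rfl | rfl <;> simp only [e1, e2]
      · exact of_joins hs (.inr (.inr ⟨rfl, rfl⟩))
      · exact (of_joins hs (.inr (.inr ⟨rfl, rfl⟩))).symm
      · exact of_joins hs (.inr (.inr (.inl ⟨rfl, rfl⟩)))
      · exact of_joins hs (.inr (.inr (.inr ⟨rfl, rfl⟩)))
      · exact of_joins hs (.inr (.inr (.inl ⟨rfl, rfl⟩)))
      · exact of_joins hs (.inr (.inr (.inr ⟨rfl, rfl⟩)))
  | false =>
    cases t with
    | zero => simp [nextPoint] at h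
    | succ t =>
      simp only [nextPoint, Option.bind_eq_some_iff] at h
      obtain ⟨⟨l, g, r⟩, hs, h⟩ := h
      simp only [Slice.cod] at h
      split at h
      · rename_i h1
        simp only [Option.some.injEq, Prod.mk.injEq] at h
        obtain ⟨-, rfl⟩ := h
        exact (of_joins hs (.inl ⟨i, h1, rfl, rfl⟩)).symm
      split at h
      · obtain ⟨h3, h⟩ := Option.ite_none_right_eq_some.1 h
        simp only [Option.some.injEq, Prod.mk.injEq] at h
        obtain ⟨-, rfl⟩ := h
        refine (of_joins hs (.inr (.inl ⟨i - (l + tgt g), by dsimp only; omega, rfl, ?_⟩))).symm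
        simp only [Prod.mk.injEq, true_and]; omega
      · have hi : i = l ∨ i = l + 1 := by
          have : tgt g ≤ 2 := by cases g <;> decide
          omega
        have e1 : 2 * l + 1 - l = l + 1 := by omega
        have e2 : 2 * l + 1 - (l + 1) = l := by omega
        cases g <;> simp only [Option.some.injEq, Prod.mk.injEq, reduceCtorEq] at h <;>
          obtain ⟨-, rfl⟩ := h <;> rcases hi with rfl | rfl <;> simp only [e1, e2]
        · exact of_joins hs (.inr (.inr ⟨rfl, rfl⟩))
        · exact (of_joins hs (.inr (.inr ⟨rfl, rfl⟩))).symm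
        · exact (of_joins hs (.inr (.inr (.inr ⟨rfl, rfl⟩)))).symm
        · exact (of_joins hs (.inr (.inr (.inl ⟨rfl, rfl⟩)))).symm
        · exact (of_joins hs (.inr (.inr (.inr ⟨rfl, rfl⟩)))).symm
        · exact (of_joins hs (.inr (.inr (.inl ⟨rfl, rfl⟩)))).symm

/-- Follow a strand from `p` for at most the given number of steps in search of `q`. -/
def reaches (w : Word TangleGen) (q : ℕ × ℕ) : ℕ → Bool → ℕ × ℕ → Bool
  | 0, _, p => Nat.beq p.1 q.1 && Nat.beq p.2 q.2
  | n + 1, d, p => (Nat.beq p.1 q.1 && Nat.beq p.2 q.2) ||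
    match nextPoint w d p with
    | some (e, a) => reaches w q n e a
    | none => false

theorem Connected.of_reaches {w : Word TangleGen} {n : ℕ} {d : Bool} {p q : ℕ × ℕ}
    (h : reaches w q n d p = true) : Connected w p q := by
  have heq : ∀ {p : ℕ × ℕ}, (Nat.beq p.1 q.1 && Nat.beq p.2 q.2) = true → p = q := by
    intro p h
    rw [Bool.and_eq_true, Nat.beq_eq, Nat.beq_eq] at h
    exact Prod.ext h.1 h.2
  induction n generalizing d p with
  | zero => exact heq h ▸ .refl
  | succ n ih =>
    rw [reaches, Bool.or_eq_true] at h
    rcases h with h | h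
    · exact heq h ▸ .refl
    · split at h
      · rename_i h'
        exact (Connected.of_nextPoint h').trans (ih h)
      · simp at h

/-- A sufficient test for admissibility, following the components from their end points. -/
def admissibleTest (k l : ℕ) (w : Word TangleGen) : Bool :=
  let m := w.length
  let n := 10 * m
  let through i j :=
    (reaches w (m, 2 * j) n true (0, 2 * i) && reaches w (m, 2 * j + 1) n true (0, 2 * i + 1)) ||
    (reaches w (m, 2 * j + 1) n true (0, 2 * i) && reaches w (m, 2 * j) n true (0, 2 * i + 1))
  decide (Typed (2 * k) w (2 * l)) &&
  ((List.range k).all fun i => reaches w (0, 2 * i + 1) n true (0, 2 * i) ||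
    (List.range l).any fun j => through i j) &&
  ((List.range l).all fun j => reaches w (m, 2 * j + 1) n false (m, 2 * j) ||
    (List.range k).any fun i => through i j)

theorem Admissible.of_test {k l : ℕ} {w : Word TangleGen} (h : admissibleTest k l w = true) :
    Admissible k l w := by
  simp only [admissibleTest, Bool.and_eq_true, decide_eq_true_eq, List.all_eq_true, List.mem_range,
    Bool.or_eq_true, List.any_eq_true] at h
  obtain ⟨⟨h1, h2⟩, h3⟩ := h
  refine ⟨h1, fun i hi => ?_, fun j hj => ?_⟩
  · refine (h2 i hi).imp Connected.of_reaches ?_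
    rintro ⟨j, hj, h⟩
    exact ⟨j, hj, h.imp (fun h => ⟨.of_reaches h.1, .of_reaches h.2⟩)
      fun h => ⟨.of_reaches h.1, .of_reaches h.2⟩⟩
  · refine (h3 j hj).imp Connected.of_reaches ?_
    rintro ⟨i, hi, h⟩
    exact ⟨i, hi, h.imp (fun h => ⟨.of_reaches h.1, .of_reaches h.2⟩)
      fun h => ⟨.of_reaches h.1, .of_reaches h.2⟩⟩

/-- The word describes an admissible tangle `k ⟶ l`. -/
structure Bare.Admits (k l : ℕ) (u : Bare) : Prop where
  fits : fits (2 * k) u = true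
  admissible : Admissible k l (fill (2 * k) u)

/-- A test for `Bare.Admits`, sufficient but not necessary. -/
def Bare.admits (k l : ℕ) (u : Bare) : Bool :=
  Bare.fits (2 * k) u && admissibleTest k l (fill (2 * k) u)

namespace Bare.Admits

variable {k l m n i j : ℕ} {u v A B : Bare}

theorem of_test (h : admits k l u = true) : Admits k l u := by
  simp only [admits, Bool.and_eq_true] at h
  exact ⟨h.1, .of_test h.2⟩

theorem width_eq (h : Admits k l u) : width (2 * k) u = 2 * l := by
  have h1 := fill_strip (typed_fill h.fits)
  have h2 := fill_strip h.admissible.typed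
  exact h1.2.1.symm.trans h2.2.1

theorem of_word {w : Word TangleGen} (h : Admissible k l w) : Admits k l (strip w) := by
  obtain ⟨h1, -, h2⟩ := fill_strip h.typed
  exact ⟨h1, h2.symm ▸ h⟩

theorem fill_append (hu : Admits k l u) (v : Bare) :
    fill (2 * k) (u ++ v) = fill (2 * k) u ++ fill (2 * l) v := by
  rw [Bare.fill_append, hu.width_eq]

theorem append (hu : Admits k l u) (hv : Admits l m v) : Admits k m (u ++ v) := by
  refine ⟨?_, ?_⟩
  · rw [fits_append, hu.width_eq, hu.fits, hv.fits]; rfl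
  · rw [hu.fill_append]; exact hu.admissible.append hv.admissible

theorem fill_shift (h : Admits k l u) (i j : ℕ) : fill (2 * (i + k + j)) (Bare.shift (2 * i) u) =
    HopfTangle.shift (2 * i) (2 * j) (fill (2 * k) u) := by
  have := (shift_spec (i := 2 * i) (2 * j) h.fits).2.2
  rwa [show 2 * i + 2 * k + 2 * j = 2 * (i + k + j) by omega] at this

theorem shift (h : Admits k l u) (i j : ℕ) :
    Admits (i + k + j) (i + l + j) (Bare.shift (2 * i) u) := by
  refine ⟨?_, ?_⟩
  · have := (shift_spec (i := 2 * i) (2 * j) h.fits).1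
    rwa [show 2 * i + 2 * k + 2 * j = 2 * (i + k + j) by omega] at this
  · rw [h.fill_shift]; exact h.admissible.shift i j

end Bare.Admits

/-- Equality in `Tgl` of the tangles `k ⟶ l` described by two words. -/
structure Equal (k l : ℕ) (u v : Bare) : Prop where
  left : Admits k l u
  right : Admits k l v
  rel : TglRel k l (fill (2 * k) u) (fill (2 * k) v)

namespace Equal

variable {k l m n : ℕ} {u v w x y A B : Bare}

theorem refl (h : Admits k l u) : Equal k l u u :=
  ⟨h, h, tglRel_isMoveCong.refl _ _ _ h.admissible⟩

theorem symm (h : Equal k l u v) : Equal k l v u :=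
  ⟨h.right, h.left, tglRel_isMoveCong.symm _ _ _ _ h.rel⟩

theorem trans (h : Equal k l u v) (h' : Equal k l v w) : Equal k l u w :=
  ⟨h.left, h'.right, tglRel_isMoveCong.trans _ _ _ _ _ h.rel h'.rel⟩

theorem append (h : Equal k l u v) (h' : Equal l m x y) : Equal k m (u ++ x) (v ++ y) := by
  refine ⟨h.left.append h'.left, h.right.append h'.right, ?_⟩
  rw [h.left.fill_append, h.right.fill_append]
  exact tglRel_isMoveCong.comp _ _ _ _ _ _ _ h.rel h'.rel

theorem shift (h : Equal k l u v) (i j : ℕ) :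
    Equal (i + k + j) (i + l + j) (Bare.shift (2 * i) u) (Bare.shift (2 * i) v) := by
  refine ⟨h.left.shift i j, h.right.shift i j, ?_⟩
  rw [h.left.fill_shift, h.right.fill_shift]
  have hM := tglRel_isMoveCong
  have h1 := hM.tensor _ _ _ _ _ _ _ _ (hM.tensor _ _ _ _ _ _ _ _ (hM.refl i i [] (.nil i)) h.rel)
    (hM.refl j j [] (.nil j))
  simpa using h1

theorem of_moves (h : Moves (2 * k) u v) (hu : Admits k l u) : Equal k l u v := by
  have hl := h.localMove
  rw [hu.width_eq] at hl
  exact ⟨hu, ⟨h.fits_right, hl.admissible hu.admissible⟩, hl.tglRel hu.admissible⟩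

theorem calculate (T : List Move) (s : List Step)
    (h : (leadsTo T (2 * k) s u v && admits k l u) = true) : Equal k l u v := by
  rw [Bool.and_eq_true] at h
  exact of_moves (.calculate T s h.1) (.of_test h.2)

/-- Replace a part of a diagram, between parts which are admissible tangles and with `i` pairs of
strands on its left and `j` pairs on its right. -/
theorem within (h : Equal k l u v) (A : Bare) (i j : ℕ) (B : Bare)
    (ht : (admits m (i + k + j) A && admits (i + l + j) n B &&
      decide (x = A ++ Bare.shift (2 * i) u ++ B) &&
      decide (y = A ++ Bare.shift (2 * i) v ++ B)) = true) : Equal m n x y := by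
  simp only [Bool.and_eq_true, decide_eq_true_eq] at ht
  obtain ⟨⟨⟨hA, hB⟩, rfl⟩, rfl⟩ := ht
  exact ((refl (.of_test hA)).append (h.shift i j)).append (refl (.of_test hB))

end Equal

/-! ### Consequences of the boundary move -/

/-- The boundary move. -/
theorem equal_boundary : Equal 1 1 [] boundary :=
  ⟨.of_test (by decide +kernel), .of_test (by decide +kernel), tglRel_isMoveCong.boundary⟩

/-- By the boundary move, a tangle is determined by its composite with the boundary tangle. -/
theorem Equal.of_boundary {k l : ℕ} {u v : Bare} (hu : Admits (1 + k) l u) (hv : Admits (1 + k) l v)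
    (h : Moves (2 * (1 + k)) (boundary ++ u) (boundary ++ v)) : Equal (1 + k) l u v := by
  have hb : Equal (1 + k) (1 + k) [] boundary := by
    have := equal_boundary.shift 0 k
    simpa [Bare.shift] using this
  have key : ∀ {w}, Admits (1 + k) l w → Equal (1 + k) l w (boundary ++ w) :=
    fun hw => hb.append (.refl hw)
  exact ((key hu).trans (.of_moves h (hb.right.append hu))).trans (key hv).symm

/-- The other half of the copairing, which forms a boundary tangle with it. -/
def evaluation : Bare := [neg 1, neg 1, cup 2, cup 0]

/-- Two tangles are equal if they become so after hooking a single strand into the first pair of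
upper ends. -/
theorem Equal.of_hook {k l : ℕ} {u v : Bare} (hu : Admits (1 + k) l u) (hv : Admits (1 + k) l v)
    (h : Moves (1 + 2 * k) (hook ++ Bare.shift 1 u) (hook ++ Bare.shift 1 v)) :
    Equal (1 + k) l u v := by
  have hs : ∀ i j (w : Bare), Bare.shift i (Bare.shift j w) = Bare.shift (i + j) w := by
    intro i j w; simp [Bare.shift, Nat.add_assoc]
  have ha : ∀ i (w w' : Bare), Bare.shift i (w ++ w') = Bare.shift i w ++ Bare.shift i w' := by
    intro i w w'; simp [Bare.shift]
  -- the boundary tangle is undone and its lower half moved down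
  have key : ∀ {w}, Admits (1 + k) l w → Moves (2 * (1 + k)) (boundary ++ w)
      ([cap 2] ++ Bare.shift 3 (hook ++ Bare.shift 1 w) ++ evaluation) := by
    intro w hw
    have h1 : Moves (2 * (1 + k)) (Bare.shift 2 copairing ++ evaluation) boundary := by
      have := copairing_snake_right.shift (i := 0) (n := 2 * (1 + k)) (by omega)
      rwa [Bare.shift_zero, Bare.shift_zero] at this
    have h2 := h1.symm.append_right (B := w) (by
      have : width (2 * (1 + k)) boundary = 2 * (1 + k) := by
        simp [width, boundary, strip, boundaryTangle, clasp, src, tgt]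
      rw [this]; exact hw.fits)
    have hc : fits (2 * (1 + k)) (Bare.shift 2 copairing) = true := by
      have := h1.fits_left
      rw [fits_append, Bool.and_eq_true] at this
      exact this.1
    have hcw : width (2 * (1 + k)) (Bare.shift 2 copairing) = 4 + 2 * (1 + k) := by
      simp [width, copairing, hook, Bare.shift, src, tgt]; omega
    have h3 := Moves.interchange_word (a := 4) (c := 2 * (1 + k)) (u := evaluation) (v := w)
      (by decide) hw.fits
    rw [show width 4 evaluation = 0 by decide, Bare.shift_zero] at h3
    have h4 := Moves.append_left hc (hcw.symm ▸ h3)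
    rw [List.append_assoc] at h2
    refine h2.trans ?_
    have e : Bare.shift 2 copairing = [cap 2] ++ Bare.shift 3 hook := rfl
    rw [ha, hs]
    simpa only [List.append_assoc, e] using h4
  refine .of_boundary hu hv ((key hu).trans (.trans ?_ (key hv).symm))
  have hf := (key hu).fits_right
  rw [List.append_assoc] at hf ⊢
  rw [List.append_assoc]
  rw [fits_append, fits_append, Bool.and_eq_true, Bool.and_eq_true] at hf
  have hw : width (2 * (1 + k)) [cap 2] = 3 + (1 + 2 * k) := by
    simp [width, src, tgt]; omega
  rw [hw] at hf
  have h1 := h.shift (i := 3) (n := 3 + (1 + 2 * k)) (by omega)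
  exact .append_left hf.1 (hw.symm ▸ h1.append_right hf.2.2)

/-! ### Equalities of admissible tangles -/

theorem equal_mul_mulRing' : Equal 2 1 (tangle .mul) mulRing' := by
  have h1 : Equal 2 1 (tangle .mul) mulRing := .calculate [mul_ring.move] [.use 0 0 0]
    (by decide +kernel)
  -- a boundary tangle in the first pair of strands is absorbed into the second one
  have h2 : Equal 2 1 mulRing (boundary ++ mulRing) :=
    equal_boundary.within [] 0 1 mulRing (by decide +kernel)
  have h3 : Equal 2 1 (boundary ++ mulRing) (Bare.shift 2 boundary ++ mulRing') :=
    .calculate [boundary_left.move, boundary_right.move, mul_boundary.move]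
      [.back 1 0 0, .use 2 0 0, .use 0 0 2] (by decide +kernel)
  have h4 : Equal 2 1 mulRing' (Bare.shift 2 boundary ++ mulRing') :=
    equal_boundary.within [] 1 0 mulRing' (by decide +kernel)
  exact ((h1.trans h2).trans h3).trans h4.symm

/-- A curl may be moved from one strand of a pair to the other. -/
theorem equal_loop_neg : Equal 1 1 (loop .neg) (Bare.shift 1 (loop .neg)) :=
  .trans (v := boundary ++ Bare.shift 1 (loop .neg))
    (.trans (v := boundary ++ loop .neg)
      (equal_boundary.within [] 0 0 (loop .neg) (by decide +kernel))
      (.calculate [boundary_left.move, boundary_loop_neg.move]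
        [.back 0 0 0, .use 1 0 0, .use 0 0 0] (by decide +kernel)))
    (equal_boundary.symm.within [] 0 0 (Bare.shift 1 (loop .neg)) (by decide +kernel))

theorem equal_loop_pos : Equal 1 1 (loop .pos) (Bare.shift 1 (loop .pos)) :=
  .trans (v := boundary ++ Bare.shift 1 (loop .pos))
    (.trans (v := boundary ++ loop .pos)
      (equal_boundary.within [] 0 0 (loop .pos) (by decide +kernel))
      (.calculate [boundary_left.move, boundary_loop_pos.move]
        [.back 0 0 0, .use 1 0 0, .use 0 0 0] (by decide +kernel)))
    (equal_boundary.symm.within [] 0 0 (Bare.shift 1 (loop .pos)) (by decide +kernel))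

/-- Multiplication by the ribbon element adds a curl. -/
theorem equal_ribbon_mul : Equal 1 1 (tangle .ribbon ++ tangle .mul) (loop .neg) :=
  .trans (v := boundary ++ loop .neg)
    (.calculate [mul_ring.move, ribbon_mul_moves.move, boundary_left.move]
      [.use 0 4 0, .use 1 0 0, .use 2 0 0] (by decide +kernel))
    (equal_boundary.symm.within [] 0 0 (loop .neg) (by decide +kernel))

theorem equal_ribbonInv_mul : Equal 1 1 (tangle .ribbonInv ++ tangle .mul) (loop .pos) :=
  .trans (v := boundary ++ loop .pos)
    (.calculate [mul_ring.move, ribbonInv_mul_moves.move, boundary_left.move]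
      [.use 0 4 0, .use 1 0 0, .use 2 0 0] (by decide +kernel))
    (equal_boundary.symm.within [] 0 0 (loop .pos) (by decide +kernel))

theorem equal_mul_ribbon :
    Equal 1 1 (Bare.shift 2 (tangle .ribbon) ++ tangle .mul) (Bare.shift 1 (loop .neg)) :=
  .trans (v := boundary ++ Bare.shift 1 (loop .neg))
    (.trans (v := Bare.shift 2 (tangle .ribbon) ++ mulRing')
      (equal_mul_mulRing'.within (Bare.shift 2 (tangle .ribbon)) 0 0 [] (by decide +kernel))
      (.calculate [mul_ribbon_moves.move, boundary_right.move]
        [.use 0 0 0, .use 1 0 0] (by decide +kernel)))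
    (equal_boundary.symm.within [] 0 0 (Bare.shift 1 (loop .neg)) (by decide +kernel))

/-- The word of the tangle assigned to a diagram. -/
abbrev word (w : Word AlgGen) : Bare := strip (tangleOf w)

theorem equal_pairing : Equal 0 2 (word pairing) copairing :=
  .trans (v := tangle .ribbon ++ tangle .comul ++ loop .pos ++ Bare.shift 2 (loop .pos))
    (.trans (v := tangle .ribbon ++ tangle .comul ++ loop .pos ++
        Bare.shift 2 (tangle .ribbonInv ++ tangle .mul))
      (equal_ribbonInv_mul.within (tangle .ribbon ++ tangle .comul) 0 1
        (Bare.shift 2 (tangle .ribbonInv ++ tangle .mul)) (by decide +kernel))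
      (equal_ribbonInv_mul.within (tangle .ribbon ++ tangle .comul ++ loop .pos) 1 0 []
        (by decide +kernel)))
    (.calculate [ribbon_comul_ring.move, ribbon_comul_absorb.move, ribbon_comul_copairing.move,
        copairing_loops.move]
      [.use 0 0 0, .use 1 0 0, .use 2 0 0, .use 3 0 0] (by decide +kernel))

/-! ### The relations -/

theorem equal_mul_assoc : Equal 3 1 (word [⟨0, .mul, 1⟩, ⟨0, .mul, 0⟩])
    (word [⟨1, .mul, 0⟩, ⟨0, .mul, 0⟩]) :=
  .calculate [mul_assoc_moves.move] [.use 0 0 0] (by decide +kernel)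

theorem equal_unit_mul : Equal 1 1 (word [⟨0, .unit, 1⟩, ⟨0, .mul, 0⟩]) [] :=
  .trans (.calculate [mul_ring.move, boundary_left.move] [.use 0 1 0, .use 1 0 0]
    (by decide +kernel)) equal_boundary.symm

theorem equal_mul_unit : Equal 1 1 (word [⟨1, .unit, 0⟩, ⟨0, .mul, 0⟩]) [] :=
  .trans (v := boundary)
    (.trans (v := [cap 2] ++ mulRing')
      (equal_mul_mulRing'.within [cap 2] 0 0 [] (by decide +kernel))
      (.calculate [boundary_right.move] [.use 0 0 0] (by decide +kernel)))
    equal_boundary.symm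

theorem equal_comul_coassoc : Equal 1 3 (word [⟨0, .comul, 0⟩, ⟨0, .comul, 1⟩])
    (word [⟨0, .comul, 0⟩, ⟨1, .comul, 0⟩]) :=
  .of_hook (k := 0) (.of_test (by decide +kernel)) (.of_test (by decide +kernel))
    (.calculate [hook_coassoc.move] [.use 0 0 0] (by decide +kernel))

theorem equal_counit_comul : Equal 1 1 (word [⟨0, .comul, 0⟩, ⟨0, .counit, 1⟩]) [] :=
  .of_hook (k := 0) (.of_test (by decide +kernel)) (.of_test (by decide +kernel))
    (.calculate [hook_counit_comul.move] [.use 0 0 0] (by decide +kernel))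

theorem equal_comul_counit : Equal 1 1 (word [⟨0, .comul, 0⟩, ⟨1, .counit, 0⟩]) [] :=
  .of_hook (k := 0) (.of_test (by decide +kernel)) (.of_test (by decide +kernel))
    (.calculate [hook_comul_counit.move] [.use 0 0 0] (by decide +kernel))

theorem equal_comul_mul : Equal 2 2 (word [⟨0, .mul, 0⟩, ⟨0, .comul, 0⟩])
    (word [⟨0, .comul, 1⟩, ⟨2, .comul, 0⟩, ⟨1, .braid, 1⟩, ⟨0, .mul, 2⟩, ⟨1, .mul, 0⟩]) := by
  let A : Bare := tangle .comul ++ Bare.shift 4 (tangle .comul) ++ Bare.shift 2 (block .pos 2 2)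
  have h1 : Equal 2 2 (mulRing' ++ tangle .comul) (A ++ mulRing' ++ Bare.shift 2 mulRing') :=
    .of_hook (k := 1) (.of_test (by decide +kernel)) (.of_test (by decide +kernel))
      (.calculate [hook_comul_mul_eq.move] [.use 0 0 0] (by decide +kernel))
  have h2 : Equal 2 2 (word [⟨0, .mul, 0⟩, ⟨0, .comul, 0⟩]) (mulRing' ++ tangle .comul) :=
    equal_mul_mulRing'.within [] 0 0 (tangle .comul) (by decide +kernel)
  have h3 : Equal 2 2
      (word [⟨0, .comul, 1⟩, ⟨2, .comul, 0⟩, ⟨1, .braid, 1⟩, ⟨0, .mul, 2⟩, ⟨1, .mul, 0⟩])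
      (A ++ mulRing' ++ Bare.shift 2 (tangle .mul)) :=
    equal_mul_mulRing'.within A 0 2 (Bare.shift 2 (tangle .mul)) (by decide +kernel)
  have h4 : Equal 2 2 (A ++ mulRing' ++ Bare.shift 2 (tangle .mul))
      (A ++ mulRing' ++ Bare.shift 2 mulRing') :=
    equal_mul_mulRing'.within (A ++ mulRing') 1 0 [] (by decide +kernel)
  exact ((h2.trans h1).trans h4.symm).trans h3.symm

theorem equal_counit_mul : Equal 2 0 (word [⟨0, .mul, 0⟩, ⟨0, .counit, 0⟩])
    (word [⟨0, .counit, 1⟩, ⟨0, .counit, 0⟩]) :=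
  .calculate [counit_mul_moves.move] [.use 0 0 0] (by decide +kernel)

theorem equal_comul_unit : Equal 0 2 (word [⟨0, .unit, 0⟩, ⟨0, .comul, 0⟩])
    (word [⟨0, .unit, 0⟩, ⟨1, .unit, 0⟩]) :=
  .calculate [comul_unit_moves.move] [.use 0 0 0] (by decide +kernel)

theorem equal_antipode_left :
    Equal 1 1 (word [⟨0, .comul, 0⟩, ⟨0, .antipode, 1⟩, ⟨0, .mul, 0⟩])
      (word [⟨0, .counit, 0⟩, ⟨0, .unit, 0⟩]) :=
  .calculate [antipode_left_rings.move, antipode_left_straighten.move, antipode_left_comm.move,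
      antipode_left_pull.move, antipode_left_absorb.move]
    [.use 0 0 0, .use 1 0 0, .use 2 0 0, .use 3 0 0, .use 4 0 0] (by decide +kernel)

theorem equal_antipode_right :
    Equal 1 1 (word [⟨0, .comul, 0⟩, ⟨1, .antipode, 0⟩, ⟨0, .mul, 0⟩])
      (word [⟨0, .counit, 0⟩, ⟨0, .unit, 0⟩]) := by
  -- the calculation is the mirror image of the one for the other side, in which the curl of the
  -- antipode is on the right and the multiplication closes the first pair of strands
  have h1 : Equal 1 1 (word [⟨0, .comul, 0⟩, ⟨1, .antipode, 0⟩, ⟨0, .mul, 0⟩])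
      (tangle .comul ++ Bare.shift 2 ([pos 0] ++ Bare.shift 1 (loop .pos)) ++ tangle .mul) :=
    equal_loop_pos.within (tangle .comul ++ [pos 2]) 1 0 (tangle .mul) (by decide +kernel)
  have h2 : Equal 1 1
      (tangle .comul ++ Bare.shift 2 ([pos 0] ++ Bare.shift 1 (loop .pos)) ++ tangle .mul)
      (tangle .comul ++ Bare.shift 2 ([pos 0] ++ Bare.shift 1 (loop .pos)) ++ mulRing') :=
    equal_mul_mulRing'.within
      (tangle .comul ++ Bare.shift 2 ([pos 0] ++ Bare.shift 1 (loop .pos))) 0 0 []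
      (by decide +kernel)
  refine (h1.trans h2).trans (.calculate [antipode_reflect.move, antipode_right_rings.move,
      antipode_right_straighten.move, antipode_right_comm.move, antipode_right_pull.move,
      antipode_right_absorb.move]
    [.back 0 11 2, .use 1 0 0, .use 2 0 0, .use 3 0 0, .use 4 0 0, .use 5 0 0] (by decide +kernel))

theorem equal_antipode_antipodeInv :
    Equal 1 1 (word [⟨0, .antipode, 0⟩, ⟨0, .antipodeInv, 0⟩]) [] :=
  .calculate [antipode_antipodeInv_moves.move] [.use 0 0 0] (by decide +kernel)

theorem equal_antipodeInv_antipode :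
    Equal 1 1 (word [⟨0, .antipodeInv, 0⟩, ⟨0, .antipode, 0⟩]) [] :=
  .calculate [antipodeInv_antipode_moves.move] [.use 0 0 0] (by decide +kernel)

theorem equal_integral_left : Equal 1 1 (word [⟨0, .comul, 0⟩, ⟨1, .integral, 0⟩])
    (word [⟨0, .integral, 0⟩, ⟨0, .unit, 0⟩]) :=
  .of_hook (k := 0) (.of_test (by decide +kernel)) (.of_test (by decide +kernel))
    (.calculate [hook_integral_left.move] [.use 0 0 0] (by decide +kernel))

theorem equal_integral_right : Equal 1 1 (word [⟨0, .comul, 0⟩, ⟨0, .integral, 1⟩])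
    (word [⟨0, .integral, 0⟩, ⟨0, .unit, 0⟩]) :=
  .of_hook (k := 0) (.of_test (by decide +kernel)) (.of_test (by decide +kernel))
    (.calculate [hook_integral_right.move] [.use 0 0 0] (by decide +kernel))

theorem equal_integral_antipode :
    Equal 1 0 (word [⟨0, .antipode, 0⟩, ⟨0, .integral, 0⟩]) (word [⟨0, .integral, 0⟩]) :=
  .calculate [integral_antipode_moves.move] [.use 0 0 0] (by decide +kernel)

theorem equal_ribbon_central : Equal 1 1 (word [⟨0, .ribbon, 1⟩, ⟨0, .mul, 0⟩])
    (word [⟨1, .ribbon, 0⟩, ⟨0, .mul, 0⟩]) :=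
  (equal_ribbon_mul.trans equal_loop_neg).trans equal_mul_ribbon.symm

theorem equal_ribbon_ribbonInv :
    Equal 0 1 (word [⟨0, .ribbon, 0⟩, ⟨1, .ribbonInv, 0⟩, ⟨0, .mul, 0⟩])
      (word [⟨0, .unit, 0⟩]) :=
  (Equal.calculate (v := tangle .ribbonInv ++ tangle .ribbon ++ tangle .mul)
    [ribbon_ribbonInv_swap.move] [.use 0 0 0] (by decide +kernel)).trans
    (.trans (v := tangle .ribbonInv ++ loop .neg)
      (equal_ribbon_mul.within (tangle .ribbonInv) 0 0 [] (by decide +kernel))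
      (.calculate [ribbonInv_loop.move] [.use 0 0 0] (by decide +kernel)))

theorem equal_ribbon_antipode :
    Equal 0 1 (word [⟨0, .ribbon, 0⟩, ⟨0, .antipode, 0⟩]) (word [⟨0, .ribbon, 0⟩]) :=
  .calculate [ribbon_antipode_moves.move] [.use 0 0 0] (by decide +kernel)

theorem equal_pairing_comul : Equal 0 3 (word (pairing ++ [⟨1, .comul, 0⟩]))
    (word (pairing ++ HopfTangle.shift 1 1 pairing ++ [⟨0, .mul, 2⟩])) := by
  have h1 : Equal 0 3 (word (pairing ++ [⟨1, .comul, 0⟩]))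
      (copairing ++ Bare.shift 2 (tangle .comul)) :=
    equal_pairing.within [] 0 0 (Bare.shift 2 (tangle .comul)) (by decide +kernel)
  have h2 : Equal 0 3 (copairing ++ Bare.shift 2 (tangle .comul))
      (copairing ++ Bare.shift 2 copairing ++ tangle .mul) :=
    .calculate [copairing_comul.move] [.use 0 0 0] (by decide +kernel)
  have h3 : Equal 0 3 (copairing ++ Bare.shift 2 (word pairing) ++ tangle .mul)
      (copairing ++ Bare.shift 2 copairing ++ tangle .mul) :=
    equal_pairing.within copairing 1 1 (tangle .mul) (by decide +kernel)
  have h4 : Equal 0 3 (word (pairing ++ HopfTangle.shift 1 1 pairing ++ [⟨0, .mul, 2⟩]))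
      (copairing ++ Bare.shift 2 (word pairing) ++ tangle .mul) :=
    equal_pairing.within [] 0 0 (Bare.shift 2 (word pairing) ++ tangle .mul) (by decide +kernel)
  exact (h1.trans h2).trans (h4.trans h3).symm

theorem equal_unit_counit : Equal 0 0 (word [⟨0, .unit, 0⟩, ⟨0, .counit, 0⟩]) [] :=
  .calculate [(Moves.of_localMove LocalMove.hopf).move] [.use 0 0 0] (by decide +kernel)

theorem equal_ribbon_counit : Equal 0 0 (word [⟨0, .ribbon, 0⟩, ⟨0, .counit, 0⟩]) [] :=
  .calculate [ribbon_counit_swap.move, (Moves.of_localMove LocalMove.hopf_one).move]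
    [.use 0 0 0, .use 1 0 0] (by decide +kernel)

theorem equal_integral_pairing :
    Equal 0 0 (word (pairing ++ [⟨1, .integral, 0⟩, ⟨0, .integral, 0⟩])) [] :=
  .trans (v := copairing ++ [cup 2, cup 0])
    (equal_pairing.within [] 0 0 [cup 2, cup 0] (by decide +kernel))
    (.calculate [copairing_integral.move] [.use 0 0 0] (by decide +kernel))

/-! ### The tangles of diagrams -/

theorem tangleOf_append (u v : Word AlgGen) : tangleOf (u ++ v) = tangleOf u ++ tangleOf v := by
  simp [tangleOf]

theorem tangleOf_cons (s : Slice AlgGen) (w : Word AlgGen) :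
    tangleOf (s :: w) =
      HopfTangle.shift (2 * s.left) (2 * s.right) (genTangle s.gen) ++ tangleOf w := rfl

theorem tangleOf_shift (i j : ℕ) (w : Word AlgGen) :
    tangleOf (HopfTangle.shift i j w) = HopfTangle.shift (2 * i) (2 * j) (tangleOf w) := by
  induction w with
  | nil => rfl
  | cons s w ih =>
    rw [shift_cons, tangleOf_cons, tangleOf_cons, ih, shift_append, shift_shift]
    simp only [Nat.mul_add, Nat.add_comm]

theorem admissible_tangleOf {n m : ℕ} {w : Word AlgGen} (h : Typed n w m) :
    Admissible n m (tangleOf w) := by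
  induction w generalizing n with
  | nil => obtain rfl : n = m := h; exact .nil n
  | cons s w ih =>
    obtain ⟨rfl, h⟩ := h
    exact ((admissible_genTangle s.gen).shift s.left s.right).append (ih h)

/-- The tangle of a crossing of bundles of strands is the crossing of the doubled bundles. -/
theorem isotopic_tangleOf_blockCross (n m : ℕ) : Isotopic (2 * n + 2 * m) (2 * n + 2 * m)
    (tangleOf (blockCross .braid n m)) (blockCross .pos (2 * n) (2 * m)) := by
  have hI := isotopic_isIsotopyCong.toIsBraidedCong
  have tB := fun n m => typed_blockCross (G := TangleGen) (x := .pos) rfl rfl n m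
  have one : ∀ m, Isotopic (2 + 2 * m) (2 + 2 * m)
      (tangleOf (crossOne .braid m)) (blockCross .pos 2 (2 * m)) := by
    intro m
    induction m with
    | zero => exact hI.refl _ _ _ rfl
    | succ m ih =>
      have h1 := hI.blockCross_add_right 2 2 (2 * m)
      have h2 := hI.comp_left ((tB 2 2).shift 0 (2 * m))
        (rel_cast (hI.whisker 2 0 _ _ _ _ ih) (n' := 0 + (2 + 2) + 2 * m) (by omega) rfl rfl rfl)
      rw [show 2 * (m + 1) = 2 + 2 * m by omega]
      refine hI.trans _ _ _ _ _ (rel_cast h2 (by omega) (by omega) ?_ rfl)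
        (hI.symm _ _ _ _ (rel_cast h1 rfl (by omega) rfl rfl))
      rw [crossOne, tangleOf_cons, tangleOf_shift]
      rfl
  induction n with
  | zero => simpa [blockCross, tangleOf] using hI.refl (2 * m) (2 * m) [] rfl
  | succ n ih =>
    have h1 := hI.whisker (2 * n) 0 _ _ _ _ (one m)
    have h2 := hI.whisker 0 2 _ _ _ _ ih
    have h3 := hI.comp _ _ _ _ _ _ _ h1
      (rel_cast h2 (n' := 2 * n + (2 + 2 * m) + 0) (by omega) rfl rfl rfl)
    refine rel_cast h3 (by omega) (by omega) ?_ ?_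
    · rw [blockCross, tangleOf_append, tangleOf_shift, tangleOf_shift]
    · rw [show 2 * (n + 1) = 2 * n + 2 by omega, blockCross_add_left]

theorem tglRel_whisker {n m : ℕ} {u v : Word TangleGen} (h : TglRel n m u v) (i j : ℕ) :
    TglRel (i + n + j) (i + m + j) (HopfTangle.shift (2 * i) (2 * j) u)
      (HopfTangle.shift (2 * i) (2 * j) v) := by
  have hM := tglRel_isMoveCong
  have h1 := hM.tensor _ _ _ _ _ _ _ _ (hM.tensor _ _ _ _ _ _ _ _ (hM.refl i i [] (.nil i)) h)
    (hM.refl j j [] (.nil j))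
  simpa using h1

/-- Equality of the tangles of two diagrams. -/
def TangleRel (n m : ℕ) (u v : Word AlgGen) : Prop := TglRel n m (tangleOf u) (tangleOf v)

theorem TangleRel.of_isotopic {n m : ℕ} {u v : Word AlgGen} (hu : Typed n u m) (hv : Typed n v m)
    (h : Isotopic (2 * n) (2 * m) (tangleOf u) (tangleOf v)) : TangleRel n m u v :=
  tglRel_isMoveCong.isotopy _ _ _ _ (admissible_tangleOf hu) (admissible_tangleOf hv) h

theorem equal_iff {n m : ℕ} {u v : Word AlgGen} (hu : Typed n u m) (hv : Typed n v m) :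
    Equal n m (word u) (word v) ↔ TangleRel n m u v := by
  have hu' := admissible_tangleOf hu
  have hv' := admissible_tangleOf hv
  have eu := (fill_strip hu'.typed).2.2
  have ev := (fill_strip hv'.typed).2.2
  refine ⟨fun h => ?_, fun h => ⟨.of_word hu', .of_word hv', ?_⟩⟩
  · have := h.rel
    rwa [eu, ev] at this
  · rwa [eu, ev]

theorem isBraidedCong_tangleRel : IsBraidedCong TangleRel := by
  have hM := tglRel_isMoveCong
  have hI := isotopic_isIsotopyCong.toIsBraidedCong
  have tB := fun n m => typed_blockCross (G := AlgGen) (x := .braid) rfl rfl n m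
  have tT := fun g => (admissible_genTangle g).typed
  exact {
    refl n m u h := hM.refl _ _ _ (admissible_tangleOf h)
    symm n m u v h := hM.symm _ _ _ _ h
    trans n m u v w h h' := hM.trans _ _ _ _ _ h h'
    comp n m k u u' v v' h h' := by
      have := hM.comp _ _ _ _ _ _ _ h h'
      rwa [← tangleOf_append, ← tangleOf_append] at this
    whisker i j n m u v h := by
      have := tglRel_whisker h i j
      rwa [← tangleOf_shift, ← tangleOf_shift] at this
    interchange g h a := by
      refine .of_isotopic ⟨by simp [Slice.dom]; omega, by simp [Typed, Slice.dom, Slice.cod]; omega⟩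
        ⟨by simp [Slice.dom], by simp [Typed, Slice.dom, Slice.cod]; omega⟩ ?_
      have := hI.interchange_word (tT g) ((tT h).shift (2 * a) 0)
      refine rel_cast this (by omega) (by omega) ?_ ?_
      · simp [tangleOf, Nat.mul_add]
      · simp [tangleOf, Nat.mul_add]
    cross_crossInv := by
      refine .of_isotopic (by decide) (by decide) ?_
      exact hI.blockCross_inv (x := .pos) (y := .neg) rfl rfl rfl rfl hI.cross_crossInv 2 2
    crossInv_cross := by
      refine .of_isotopic (by decide) (by decide) ?_
      exact hI.inv_blockCross (x := .pos) (y := .neg) rfl rfl rfl rfl hI.crossInv_cross 2 2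
    naturality_left g := by
      have tl : Typed (src g + 1) [⟨0, g, 1⟩] (tgt g + 1) := by simp [Typed, Slice.dom, Slice.cod]
      have tr : Typed (1 + src g) [⟨1, g, 0⟩] (1 + tgt g) := by simp [Typed, Slice.dom, Slice.cod]
      refine .of_isotopic (tl.append ((tB (tgt g) 1).cast rfl (Nat.add_comm _ _)))
        (((tB (src g) 1).cast rfl (Nat.add_comm _ _)).append tr) ?_
      have h1 := hI.comp_left (((tT g).shift 0 2).cast rfl (by omega))
        (isotopic_tangleOf_blockCross (tgt g) 1)
      have h2 := hI.naturality_word_left (tT g) 2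
      have h3 := hI.comp_right (isotopic_tangleOf_blockCross (src g) 1)
        (((tT g).shift 2 0).cast (by omega) rfl)
      refine hI.trans _ _ _ _ _ (rel_cast h1 (by omega) (by omega) rfl rfl)
        (hI.trans _ _ _ _ _ (rel_cast h2 (by omega) (by omega) rfl rfl)
          (hI.symm _ _ _ _ (rel_cast h3 (by omega) (by omega) ?_ rfl)))
      simp [tangleOf]; rfl
    naturality_right g := by
      have tl : Typed (1 + src g) [⟨1, g, 0⟩] (1 + tgt g) := by simp [Typed, Slice.dom, Slice.cod]
      have tr : Typed (src g + 1) [⟨0, g, 1⟩] (tgt g + 1) := by simp [Typed, Slice.dom, Slice.cod]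
      refine .of_isotopic (tl.append ((tB 1 (tgt g)).cast rfl (Nat.add_comm _ _)))
        (((tB 1 (src g)).cast rfl (Nat.add_comm _ _)).append tr) ?_
      have h1 := hI.comp_left (((tT g).shift 2 0).cast rfl (by omega))
        (isotopic_tangleOf_blockCross 1 (tgt g))
      have h2 := hI.naturality_word_right (tT g) 2
      have h3 := hI.comp_right (isotopic_tangleOf_blockCross 1 (src g))
        (((tT g).shift 0 2).cast (by omega) rfl)
      refine hI.trans _ _ _ _ _ (rel_cast h1 (by omega) (by omega) rfl rfl)
        (hI.trans _ _ _ _ _ (rel_cast h2 (by omega) (by omega) rfl rfl)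
          (hI.symm _ _ _ _ (rel_cast h3 (by omega) (by omega) ?_ rfl)))
      simp [tangleOf]; rfl }

/-- By the non-degeneracy of the copairing, a tangle with one pair of upper ends is determined by
its composite with the copairing. -/
theorem Equal.of_copairing {m : ℕ} {u v : Bare} (hu : Admits 1 m u) (hv : Admits 1 m v)
    (h : Equal 0 (m + 1) (copairing ++ u) (copairing ++ v)) : Equal 1 m u v := by
  have he : Admits 2 0 evaluation := .of_test (by decide +kernel)
  -- the lower half of the boundary tangle is moved down past the tangle
  have key : ∀ {w}, Admits 1 m w →
      Equal 1 m w (copairing ++ w ++ Bare.shift (2 * m) evaluation) := by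
    intro w hw
    have h1 : Equal 1 1 [] (copairing ++ Bare.shift 2 evaluation) :=
      equal_boundary.trans (.of_moves copairing_snake_left.symm (.of_test (by decide +kernel)))
    have h2 := h1.append (.refl hw)
    have h3 := (Moves.interchange_word (a := 2) (c := 4) hw.fits he.fits).symm
    have hc : Admits 1 3 copairing := .of_test (by decide +kernel)
    have h4 : Equal 3 m (Bare.shift 2 evaluation ++ w) (w ++ Bare.shift (2 * m) evaluation) := by
      have := hw.width_eq
      rw [show width 2 w = 2 * m from this] at h3
      exact .of_moves h3 ((he.shift 1 0).append hw)
    have h5 := (Equal.refl hc).append h4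
    rw [List.append_assoc] at h2
    rw [List.append_assoc]
    exact h2.trans h5
  have h1 : Equal 1 (m + 2) (copairing ++ u) (copairing ++ v) := by
    have := h.shift 0 1
    simpa [Bare.shift_zero] using this
  have h2 := h1.append (.refl (he.shift m 0))
  exact ((key hu).trans h2).trans (key hv).symm

theorem isAlgCong_tangleRel : IsAlgCong TangleRel where
  toIsBraidedCong := isBraidedCong_tangleRel
  mul_assoc := (equal_iff (by decide) (by decide)).1 equal_mul_assoc
  unit_mul := (equal_iff (by decide) (by decide)).1 equal_unit_mul
  mul_unit := (equal_iff (by decide) (by decide)).1 equal_mul_unit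
  comul_coassoc := (equal_iff (by decide) (by decide)).1 equal_comul_coassoc
  counit_comul := (equal_iff (by decide) (by decide)).1 equal_counit_comul
  comul_counit := (equal_iff (by decide) (by decide)).1 equal_comul_counit
  comul_mul := (equal_iff (by decide) (by decide)).1 equal_comul_mul
  counit_mul := (equal_iff (by decide) (by decide)).1 equal_counit_mul
  comul_unit := (equal_iff (by decide) (by decide)).1 equal_comul_unit
  antipode_left := (equal_iff (by decide) (by decide)).1 equal_antipode_left
  antipode_right := (equal_iff (by decide) (by decide)).1 equal_antipode_right
  antipode_antipodeInv := (equal_iff (by decide) (by decide)).1 equal_antipode_antipodeInv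
  antipodeInv_antipode := (equal_iff (by decide) (by decide)).1 equal_antipodeInv_antipode
  integral_left := (equal_iff (by decide) (by decide)).1 equal_integral_left
  integral_right := (equal_iff (by decide) (by decide)).1 equal_integral_right
  integral_antipode := (equal_iff (by decide) (by decide)).1 equal_integral_antipode
  ribbon_central := (equal_iff (by decide) (by decide)).1 equal_ribbon_central
  ribbon_ribbonInv := (equal_iff (by decide) (by decide)).1 equal_ribbon_ribbonInv
  ribbon_antipode := (equal_iff (by decide) (by decide)).1 equal_ribbon_antipode
  pairing_comul := (equal_iff (by decide) (by decide)).1 equal_pairing_comul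
  pairing_nondegenerate m f g hf hg h := by
    have tp : Typed 0 pairing 2 := by decide
    have tf := tp.append (hf.shift 0 1)
    have tg := tp.append (hg.shift 0 1)
    have hs : ∀ {w}, Typed 1 w m →
        word (pairing ++ HopfTangle.shift 0 1 w) = word pairing ++ word w := by
      intro w hw
      simp only [word, tangleOf_append, tangleOf_shift, strip, List.map_append]
      congr 1
      simp [HopfTangle.shift]
    have h1 := (equal_iff (m := m + 1) (tf.cast rfl (by omega)) (tg.cast rfl (by omega))).2 h
    rw [hs hf, hs hg] at h1
    have hu := Admits.of_word (admissible_tangleOf hf)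
    have hv := Admits.of_word (admissible_tangleOf hg)
    have key : ∀ {w}, Admits 1 m w → Equal 0 (m + 1) (word pairing ++ w) (copairing ++ w) := by
      intro w hw
      have := equal_pairing.append (.refl (hw.shift 0 1))
      simpa [Bare.shift_zero] using this
    exact (equal_iff hf hg).1 (.of_copairing hu hv (((key hu).symm.trans h1).trans (key hv)))
  unit_counit := (equal_iff (by decide) (by decide)).1 equal_unit_counit
  ribbon_counit := (equal_iff (by decide) (by decide)).1 equal_ribbon_counit
  integral_pairing := (equal_iff (by decide) (by decide)).1 equal_integral_pairing

/-! ### The functor -/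

theorem TangleRel.of_algRel {n m : ℕ} {u v : Word AlgGen} (h : AlgRel n m u v) :
    TangleRel n m u v :=
  h _ isAlgCong_tangleRel

/-- The functor mapping each diagram to its tangle. -/
def tangleFunctor : Alg ⥤ Tgl where
  obj a := ⟨a.n⟩
  map {a b} := Quotient.map (sa := algPresentation.setoid a.n b.n)
    (sb := tglPresentation.setoid a.n b.n)
    (fun u => ⟨tangleOf u.1, admissible_tangleOf u.2⟩) fun _ _ h => TangleRel.of_algRel h
  map_id _ := rfl
  map_comp {a b c} f g := by
    induction f using Presentation.hom_ind with | _ f hf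
    induction g using Presentation.hom_ind with | _ g hg
    exact tglPresentation.cls_eq (a := ⟨a.n⟩) (b := ⟨c.n⟩)
      (admissible_tangleOf (algPresentation.ok_comp hf hg))
      (tglPresentation.ok_comp (admissible_tangleOf hf) (admissible_tangleOf hg))
      (tangleOf_append f g)

theorem tangleFunctor_map_gen (g : AlgGen) : tangleFunctor.map (Alg.gen g) = Tgl.gen g :=
  tglPresentation.cls_eq (a := ⟨src g⟩) (b := ⟨tgt g⟩) _ (admissible_genTangle g)
    (by simp [tangleOf])

theorem tangleFunctor_map_tensor {a b c d : Alg} (f : a ⟶ b) (g : c ⟶ d) :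
    tangleFunctor.map (f ⊗ₘ g) = tangleFunctor.map f ⊗ₘ tangleFunctor.map g := by
  induction f using Presentation.hom_ind with | _ f hf
  induction g using Presentation.hom_ind with | _ g hg
  refine tglPresentation.cls_eq (a := ⟨a.n + c.n⟩) (b := ⟨b.n + d.n⟩)
    (admissible_tangleOf (algPresentation.ok_tensor hf hg))
    (tglPresentation.ok_tensor (admissible_tangleOf hf) (admissible_tangleOf hg)) ?_
  simp only [tangleOf_append, tangleOf_shift, algPresentation, tglPresentation, Nat.one_mul,
    Nat.mul_zero]

/-- Juxtaposition is respected strictly. -/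
instance : tangleFunctor.Monoidal := Functor.CoreMonoidal.toMonoidal {
  εIso := Iso.refl _
  μIso := fun _ _ => Iso.refl _
  μIso_hom_natural_left := by
    intro a b f c
    have := tangleFunctor_map_tensor f (𝟙 c)
    rw [Iso.refl_hom, Iso.refl_hom]
    refine (Category.comp_id _).trans (Eq.trans ?_ (Category.id_comp _).symm)
    exact this.symm
  μIso_hom_natural_right := by
    intro a b c f
    have := tangleFunctor_map_tensor (𝟙 c) f
    rw [Iso.refl_hom, Iso.refl_hom]
    refine (Category.comp_id _).trans (Eq.trans ?_ (Category.id_comp _).symm)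
    exact this.symm
  associativity := fun _ _ _ => rfl
  left_unitality := fun _ => rfl
  right_unitality := fun _ => rfl }

instance : tangleFunctor.Braided where
  braided a b := by
    refine (Category.id_comp _).trans (Eq.trans ?_ (Category.comp_id _).symm)
    exact tglPresentation.cls_base (a := ⟨a.n + b.n⟩) (b := ⟨b.n + a.n⟩)
      (admissible_tangleOf (algPresentation.ok_braiding a.n b.n))
      (tglPresentation.ok_braiding a.n b.n)
      (rel_cast (isotopic_tangleOf_blockCross a.n b.n) rfl rfl
        (by simp only [algPresentation, Nat.one_mul]; rfl) rfl)
      (Nat.mul_add _ _ _).symm (by simp only [tglPresentation]; omega)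

theorem eqToHom_tensor {C : Type*} [Category C] [MonoidalCategory C] {a b a' b' : C} (h : a = b)
    (h' : a' = b') : eqToHom h ⊗ₘ eqToHom h' = eqToHom (congrArg₂ (· ⊗ ·) h h') := by
  subst h h'
  simp

/-- A diagram consisting of one slice is a generator with vertical strands on both sides. -/
theorem hom_slice (i : ℕ) (g : AlgGen) (j : ℕ)
    (h : algPresentation.ok (i + src g + j) (i + tgt g + j) [⟨i, g, j⟩]) :
    (Presentation.hom [⟨i, g, j⟩] h : (⟨i + src g + j⟩ : Alg) ⟶ ⟨i + tgt g + j⟩) =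
      (𝟙 (⟨i⟩ : Alg) ⊗ₘ Alg.gen g) ⊗ₘ 𝟙 (⟨j⟩ : Alg) := by
  refine algPresentation.cls_eq _ _ ?_
  simp [algPresentation]

/-- A strict tensor functor is determined by the images of the generators. -/
theorem eq_tangleFunctor {X : Alg ⥤ Tgl} [X.Monoidal] (hX : ∀ n : ℕ, X.obj ⟨n⟩ = ⟨n⟩)
    (hμ : ∀ a b : Alg, Functor.LaxMonoidal.μ X a b =
      eqToHom ((congrArg₂ (· ⊗ ·) (hX a.n) (hX b.n)).trans (hX (a.n + b.n)).symm))
    (hg : ∀ g : AlgGen,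
      X.map (Alg.gen g) = eqToHom (hX _) ≫ Tgl.gen g ≫ eqToHom (hX _).symm) :
    X = tangleFunctor := by
  -- `X` up to the identification of the objects
  let F : ∀ {a b : Alg}, (a ⟶ b) → ((⟨a.n⟩ : Tgl) ⟶ ⟨b.n⟩) := fun {a b} f =>
    eqToHom (hX a.n).symm ≫ X.map f ≫ eqToHom (hX b.n)
  have F_id : ∀ a : Alg, F (𝟙 a) = 𝟙 _ := by
    intro a
    simp [F]
  have F_comp : ∀ {a b c : Alg} (f : a ⟶ b) (g : b ⟶ c), F (f ≫ g) = F f ≫ F g := by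
    intro a b c f g
    simp [F]
  have F_tensor : ∀ {a b c d : Alg} (f : a ⟶ b) (g : c ⟶ d), F (f ⊗ₘ g) = F f ⊗ₘ F g := by
    intro a b c d f g
    have h := Functor.LaxMonoidal.μ_natural X f g
    rw [hμ, hμ] at h
    have h' : X.map (f ⊗ₘ g) = eqToHom ((congrArg₂ (· ⊗ ·) (hX a.n) (hX c.n)).trans
        (hX (a.n + c.n)).symm).symm ≫ (X.map f ⊗ₘ X.map g) ≫
        eqToHom ((congrArg₂ (· ⊗ ·) (hX b.n) (hX d.n)).trans (hX (b.n + d.n)).symm) := by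
      rw [h]; simp
    simp only [F, h', ← MonoidalCategory.tensorHom_comp_tensorHom, eqToHom_tensor]
    simp
  have agree_tensor : ∀ {a b c d : Alg} {f : a ⟶ b} {g : c ⟶ d}, F f = tangleFunctor.map f →
      F g = tangleFunctor.map g → F (f ⊗ₘ g) = tangleFunctor.map (f ⊗ₘ g) := by
    intro a b c d f g h h'
    refine (F_tensor f g).trans (Eq.trans ?_ (tangleFunctor_map_tensor f g).symm)
    rw [h, h']
    rfl
  have F_gen : ∀ g, F (Alg.gen g) = tangleFunctor.map (Alg.gen g) := by
    intro g
    refine Eq.trans ?_ (tangleFunctor_map_gen g).symm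
    simp [F, hg]
  -- a diagram is a composite of slices
  have F_hom : ∀ (n m : ℕ) (u : Word AlgGen) (hu : algPresentation.ok n m u),
      F (Presentation.hom u hu : (⟨n⟩ : Alg) ⟶ ⟨m⟩) =
        tangleFunctor.map (Presentation.hom u hu : (⟨n⟩ : Alg) ⟶ ⟨m⟩) := by
    intro n m u hu
    induction u generalizing n with
    | nil =>
      obtain rfl : n = m := hu
      exact F_id ⟨n⟩
    | cons s u ih =>
      obtain ⟨i, g, j⟩ := s
      obtain ⟨rfl, hu⟩ := hu
      have hs : algPresentation.ok (i + src g + j) (i + tgt g + j) [⟨i, g, j⟩] := ⟨rfl, rfl⟩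
      have e : (Presentation.hom (⟨i, g, j⟩ :: u) ⟨rfl, hu⟩ : (⟨i + src g + j⟩ : Alg) ⟶ ⟨m⟩) =
        Presentation.hom (b := ⟨i + tgt g + j⟩) [⟨i, g, j⟩] hs ≫ Presentation.hom u hu := rfl
      have e1 : F (Presentation.hom [⟨i, g, j⟩] hs : (⟨i + src g + j⟩ : Alg) ⟶ ⟨i + tgt g + j⟩) =
          tangleFunctor.map (Presentation.hom [⟨i, g, j⟩] hs) := by
        rw [hom_slice]
        exact agree_tensor (agree_tensor (F_id _) (F_gen g)) (F_id _)
      exact (congrArg F e).trans ((F_comp _ _).trans ((congrArg₂ (· ≫ ·) e1 (ih _ hu)).trans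
        (tangleFunctor.map_comp _ _).symm))
  refine CategoryTheory.Functor.ext (fun a => hX a.n) fun a b f => ?_
  induction f using Presentation.hom_ind with | _ u hu
  refine Eq.trans ?_ (congrArg (fun k => eqToHom (hX a.n) ≫ k ≫ eqToHom (hX b.n).symm)
    (F_hom a.n b.n u hu))
  simp [F]

end HopfTangle

theorem mainTheorem3 :
    -- all defining relations of `Alg` hold for the assigned tangles
    HopfTangle.IsAlgCong (fun n m u v =>
      HopfTangle.TglRel n m (HopfTangle.tangleOf u) (HopfTangle.tangleOf v)) ∧
    -- hence the assignment extends uniquely to a strict braided tensor functor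
    ∃! X : HopfTangle.Alg ⥤ HopfTangle.Tgl,
      ∃ hX : ∀ n : ℕ, X.obj ⟨n⟩ = ⟨n⟩,
        (∃ _ : X.Braided,
          Functor.LaxMonoidal.ε X = eqToHom (hX 0).symm ∧
          ∀ a b : HopfTangle.Alg, Functor.LaxMonoidal.μ X a b =
            eqToHom ((congrArg₂ (· ⊗ ·) (hX a.n) (hX b.n)).trans (hX (a.n + b.n)).symm)) ∧
        ∀ g : HopfTangle.AlgGen,
          X.map (HopfTangle.Alg.gen g) =
            eqToHom (hX _) ≫ HopfTangle.Tgl.gen g ≫ eqToHom (hX _).symm := by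
  refine ⟨HopfTangle.isAlgCong_tangleRel, HopfTangle.tangleFunctor,
    ⟨fun _ => rfl, ⟨inferInstance, rfl, fun _ _ => rfl⟩, fun g => ?_⟩, ?_⟩
  · rw [HopfTangle.tangleFunctor_map_gen]
    exact ((Category.id_comp _).trans (Category.comp_id _)).symm
  · rintro X ⟨hX, ⟨_, -, hμ⟩, hg⟩
    exact HopfTangle.eq_tangleFunctor hX hμ hg
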